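/- **Setting.** Let $\mathcal S$ be a finite non-empty set and let $c(x,y)=c(y,x)\ge 0$ ($x\ne y$) be such that $\mathcal S$ is connected through the pairs with $c(x,y)\neq 0$. Fix $\beta>0$. Let $\nu$ range over a compact set in $\mathbb R^{d}$ and $\kappa$ over a compact set in $\mathbb R^{e}$, and let $\epsilon\in[0,\epsilon_{\max}]$. Let $H^\nu_x\in\mathbb R$ ($x\in\mathcal S$) depend smoothly on $\nu$, and for $x\ne y$ with $c(x,y)\ne0$ let $\xi^\kappa_{x\to y}$ be real, Lipschitz in $\kappa$, with $|\xi^\kappa_{x\to y}|\le 1$. For $\alpha=(\beta,\epsilon,\nu,\kappa)$ and $x\ne y$ let $$R^\alpha_{x\to y}=e^{\epsilon\,\xi^\kappa_{x\to y}}R^{(\beta,\nu)}_{x\to y},$$ where either $R^{(\beta,\nu)}_{x\to y}=c(x,y)e^{\beta H^\nu_x}$ for all $x\neq y$, or $R^{(\beta,\nu)}_{x\to y}=c(x,y)e^{(\beta/2)(H^\nu_x-H^\nu_y)}$ for all $x\ne y$. Let $\lambda^\alpha_x=\sum_{y\ne x}R^\alpha_{x\to y}$, and let $\rho^\alpha$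 be the stationary distribution of the Markov jump process with rates $R^\alpha$. Put $$\theta^\alpha_{x\to y}=\log\frac{R^\alpha_{x\to y}}{R^\alpha_{y\to x}},\qquad \psi^\alpha_{x\to y}=\theta^\alpha_{x\to y}-\beta(H^\nu_x-H^\nu_y).$$ A path on $[a,b]$ has jump times $a=t_0<t_1<\dots<t_m<t_{m+1}=b$ and states $x_0,\dots,x_m$ with $x_{j-1}\ne x_j$. Under a protocol $\hat\alpha=(\alpha(t))$, with Hamiltonian parameter $\nu(t)$, it has the weight $\prod_{j=1}^m R^{\alpha(t_j)}_{x_{j-1}\to x_j}\prod_{j=0}^m\exp\bigl[-\int_{t_j}^{t_{j+1}}\lambda^{\alpha(t)}_{x_j}dt\bigr]$, and one sets $$\Theta^{\hat\alpha}=\sum_{j=1}^m\theta^{\alpha(t_j)}_{x_{j-1}\to x_j},\qquad \Psi^{\hat\alpha}=\sum_{j=1}^m\psi^{\alpha(t_j)}_{x_{j-1}\to x_j},\qquad W^{\hat\nu}=\sum_{j=0}^m\bigl(H^{\nu(t_{j+1})}_{x_j}-H^{\nu(t_j)}_{x_j}\bigr).$$ $\langle\cdot\rangle^{\hat\alpha}_{\mathrm{st}\to}$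 denotes the path expectation on $[-\tau,\tau]$ with initial distribution $\rho^{\alpha(-\tau)}$. The $k$-th cumulant is ${}^{\mathrm c}\langle X^k\rangle=\frac{d^k}{du^k}\log\langle e^{uX}\rangle\big|_{u=0}$. The reversed protocol is $\hat\alpha^\dagger=(\alpha(-t))$. The nonequilibrium free energy $F(\alpha)$ is the number with $$e^{-\beta F(\alpha)}=e^{-\beta H^\nu_x}\lim_{\tau\to\infty}\frac{\langle e^{-\Psi^{(\alpha)}/2}\rangle^{[-\tau,-\tau/2],(\alpha)}_{x\to}}{[e^{-\Psi^{(\alpha)}/2}]^{[\tau/2,\tau],(\alpha)}_{\mathrm{st}\to x}}\qquad\text{for every }x\in\mathcal S .$$ Here $(\alpha)$ is the constant protocol, the numerator is the expectation on $[-\tau,-\tau/2]$ started in $x$, and the denominator is the expectation on $[\tau/2,\tau]$ started from $\rho^\alpha$ and restricted to paths that end in $x$. It is part of the claim that the limit exists and that $F(\alpha)$ does not depend on $x$. Let $S(\alpha)=\beta\{\sum_xH^\nu_x\rho^\alpha_x-F(\alpha)\}$. **Theorem (extended Clausius relation for the step protocol).** There are positive constants $B$, $C_n$, $C_n'$ ($n=1,2,\dots$),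 which do not depend on $\epsilon,\nu,\nu',\kappa,\kappa'$, such that the following holds for all allowed $\alpha=(\beta,\epsilon,\nu,\kappa)$ and $\alpha'=(\beta,\epsilon,\nu',\kappa')$. Let $\hat\alpha$ be the step protocol $\alpha(t)=\alpha$ for $t\le0$, $\alpha(t)=\alpha'$ for $t>0$, and let $\delta=|\nu-\nu'|+B\epsilon|\kappa-\kappa'|$. Then for every $n\ge1$ the following limit exists and $$\Biggl|F(\alpha')-F(\alpha)+\frac1\beta\lim_{\tau\to\infty}\sum_{k=1}^{2n-1}\frac{(-1)^k}{2^kk!}\Bigl\{{}^{\mathrm c}\bigl\langle(\beta W^{\hat\nu}+\Psi^{\hat\alpha})^k\bigr\rangle^{\hat\alpha}_{\mathrm{st}\to}-{}^{\mathrm c}\bigl\langle(\beta W^{\hat\nu^\dagger}+\Psi^{\hat\alpha^\dagger})^k\bigr\rangle^{\hat\alpha^\dagger}_{\mathrm{st}\to}\Bigr\}\Biggr|\le C_n\epsilon^{2n}\delta+C_n'\delta^2 .$$ Moreover, with $C=\beta C_1$ and $C'=\beta C_1'$, the following limit exists and $$\Biggl|S(\alpha')-S(\alpha)+\lim_{\tau\to\infty}\frac{\langle\Theta^{\hat\alpha}\rangle^{\hat\alpha}_{\mathrm{st}\to}-\langle\Theta^{\hat\alpha^\dagger}\rangle^{\hat\alpha^\dagger}_{\mathrm{st}\to}}2\Biggr|\le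 C\epsilon^2\delta+C'\delta^2 .$$ -/

import Mathlib

open Filter Topology
open scoped ContDiff NNReal

/-! ### Paths of a jump process and integration over them -/

/-- A path with `n` jumps: the visited states `x 0, …, x n` and the jump times `t 0, …, t (n-1)`. -/
structure JumpPath (S : Type*) where
  n : ℕ
  x : Fin (n + 1) → S
  t : Fin n → ℝ

namespace JumpPath

variable {S : Type*}

/-- The initial state `x(a)` of a path on a time interval `[a, b]`. -/
def first (p : JumpPath S) : S := p.x 0

/-- The final state `x(b)` of a path on a time interval `[a, b]`. -/
def last (p : JumpPath S) : S := p.x (Fin.last p.n)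

/-- The jump times completed by the end points of the time interval `[a, b]`:
`a, t 0, …, t (n-1), b`. -/
def times (a b : ℝ) (p : JumpPath S) : Fin (p.n + 2) → ℝ :=
  Fin.cons (α := fun _ => ℝ) a (Fin.snoc (α := fun _ => ℝ) p.t b)

end JumpPath

/-- The iterated integral
`∫_a^b dt₁ ∫_{t₁}^b dt₂ ⋯ ∫_{t_{n-1}}^b dt_n g (t₁, …, t_n)`. -/
noncomputable def orderedIntegral (b : ℝ) : (n : ℕ) → ℝ → ((Fin n → ℝ) → ℝ) → ℝ
  | 0, _, g => g Fin.elim0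
  | n + 1, a, g =>
      ∫ s in a..b, orderedIntegral b n s (fun t => g (Fin.cons (α := fun _ => ℝ) s t))

/-- The integral over all paths on `[a, b]`: sum over the number `n` of jumps and over the
states `x₀, …, x_n` with `x_{j-1} ≠ x_j`, and integral over the ordered jump times. -/
noncomputable def pathIntegral {S : Type*} [Fintype S] [DecidableEq S] (a b : ℝ)
    (f : JumpPath S → ℝ) : ℝ :=
  ∑' n : ℕ, ∑ x : Fin (n + 1) → S with (∀ j : Fin n, x j.castSucc ≠ x j.succ),
    orderedIntegral b n a (fun t => f ⟨n, x, t⟩)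

/-! ### The class of models -/

/-- The two standard choices of equilibrium transition rates:
`c(x,y) exp (β H_x)` and `c(x,y) exp ((β/2) (H_x - H_y))`. -/
inductive RateRule
  | exponential
  | symmetric

/-- The parameters `α = (ε, ν, κ)`; the reference inverse temperature `β` is fixed once and
for all in the model. -/
structure Param (d e : ℕ) where
  eps : ℝ
  nu : EuclideanSpace ℝ (Fin d)
  kappa : EuclideanSpace ℝ (Fin e)

/-- The data which define a class of models on the finite state space `S`, with Hamiltonian
parameters `ν ∈ ℝ^d` and nonequilibrium parameters `κ ∈ ℝ^e`. -/
structure NESSModel (S : Type*) (d e : ℕ) where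
  /-- reference inverse temperature -/
  beta : ℝ
  beta_pos : 0 < beta
  /-- connectivity function -/
  c : S → S → ℝ
  c_symm : ∀ x y, x ≠ y → c x y = c y x
  c_nonneg : ∀ x y, x ≠ y → 0 ≤ c x y
  c_connected : ∀ x y, Relation.ReflTransGen (fun u v => u ≠ v ∧ c u v ≠ 0) x y
  /-- choice of the equilibrium rates -/
  rule : RateRule
  /-- allowed range of `ε`: the interval `[0, epsMax]` -/
  epsMax : ℝ
  /-- allowed range of `ν` -/
  nuSet : Set (EuclideanSpace ℝ (Fin d))
  nuSet_compact : IsCompact nuSet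
  /-- allowed range of `κ` -/
  kappaSet : Set (EuclideanSpace ℝ (Fin e))
  kappaSet_compact : IsCompact kappaSet
  /-- Hamiltonian -/
  H : EuclideanSpace ℝ (Fin d) → S → ℝ
  H_smooth : ∀ x, ∀ ν ∈ nuSet, ContDiffAt ℝ ∞ (fun ν' => H ν' x) ν
  /-- nonequilibrium function, relevant only where `c x y ≠ 0` -/
  xi : EuclideanSpace ℝ (Fin e) → S → S → ℝ
  xi_bound : ∀ κ ∈ kappaSet, ∀ x y, x ≠ y → c x y ≠ 0 → |xi κ x y| ≤ 1
  xi_lipschitz : ∀ x y, x ≠ y → c x y ≠ 0 →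
    ∃ K : ℝ≥0, LipschitzOnWith K (fun κ => xi κ x y) kappaSet

namespace NESSModel

variable {S : Type*} {d e : ℕ} (M : NESSModel S d e)

/-- The allowed values of the parameters. -/
def range : Set (Param d e) :=
  {α | α.eps ∈ Set.Icc 0 M.epsMax ∧ α.nu ∈ M.nuSet ∧ α.kappa ∈ M.kappaSet}

/-- The equilibrium rate from `x` to `y`, for `x ≠ y`. -/
noncomputable def eqRate (ν : EuclideanSpace ℝ (Fin d)) (x y : S) : ℝ :=
  match M.rule with
  | RateRule.exponential => M.c x y * Real.exp (M.beta * M.H ν x)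
  | RateRule.symmetric => M.c x y * Real.exp (M.beta / 2 * (M.H ν x - M.H ν y))

/-- The transition rate from `x` to `y`, for `x ≠ y`. -/
noncomputable def rate (α : Param d e) (x y : S) : ℝ :=
  Real.exp (α.eps * M.xi α.kappa x y) * M.eqRate α.nu x y

/-- Entropy production (in the baths) of the transition from `x` to `y`. -/
noncomputable def theta (α : Param d e) (x y : S) : ℝ :=
  Real.log (M.rate α x y / M.rate α y x)

/-- Nonequilibrium part of the entropy production of the transition from `x` to `y`. -/
noncomputable def psi (α : Param d e) (x y : S) : ℝ :=
  M.theta α x y - M.beta * (M.H α.nu x - M.H α.nu y)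

/-- Total entropy production of a path under the protocol `A`. -/
noncomputable def Theta (A : ℝ → Param d e) (p : JumpPath S) : ℝ :=
  ∑ j : Fin p.n, M.theta (A (p.t j)) (p.x j.castSucc) (p.x j.succ)

/-- Nonequilibrium part of the entropy production of a path under the protocol `A`. -/
noncomputable def Psi (A : ℝ → Param d e) (p : JumpPath S) : ℝ :=
  ∑ j : Fin p.n, M.psi (A (p.t j)) (p.x j.castSucc) (p.x j.succ)

/-- Work done by the external agent along a path on `[a, b]` under the protocol `A`. -/
noncomputable def work (a b : ℝ) (A : ℝ → Param d e) (p : JumpPath S) : ℝ :=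
  ∑ j : Fin (p.n + 1), (M.H (A (p.times a b j.succ)).nu (p.x j)
    - M.H (A (p.times a b j.castSucc)).nu (p.x j))

variable [Fintype S] [DecidableEq S]

/-- The escape rate at `x`. -/
noncomputable def escape (α : Param d e) (x : S) : ℝ :=
  ∑ y with y ≠ x, M.rate α x y

/-- `ρ` is a probability distribution that is stationary for the master equation with the
constant parameters `α`. -/
def IsStationary (α : Param d e) (ρ : S → ℝ) : Prop :=
  (∀ x, 0 ≤ ρ x) ∧ ∑ x, ρ x = 1 ∧
    ∀ x, -M.escape α x * ρ x + ∑ y with y ≠ x, ρ y * M.rate α y x = 0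

/-- The stationary distribution for the constant parameters `α` (the one probability
distribution that satisfies `IsStationary`, by irreducibility). -/
noncomputable def stationary (α : Param d e) : S → ℝ :=
  Classical.epsilon (M.IsStationary α)

/-- The weight (transition probability density) of a path on `[a, b]` under the protocol `A`. -/
noncomputable def weight (a b : ℝ) (A : ℝ → Param d e) (p : JumpPath S) : ℝ :=
  (∏ j : Fin p.n, M.rate (A (p.t j)) (p.x j.castSucc) (p.x j.succ)) *
    ∏ j : Fin (p.n + 1), Real.exp
      (-∫ s in (p.times a b j.castSucc)..(p.times a b j.succ), M.escape (A s) (p.x j))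

/-- Expectation on `[a, b]` under the protocol `A`, started in the steady state for the initial
parameters `A a`. -/
noncomputable def expectSt (a b : ℝ) (A : ℝ → Param d e) (f : JumpPath S → ℝ) : ℝ :=
  pathIntegral a b (fun p => f p * M.stationary (A a) p.first * M.weight a b A p)

/-- Expectation on `[a, b]` under the protocol `A`, started in the state `x`. -/
noncomputable def expectFrom (a b : ℝ) (A : ℝ → Param d e) (x : S) (f : JumpPath S → ℝ) : ℝ :=
  pathIntegral a b (fun p => f p * (if p.first = x then 1 else 0) * M.weight a b A p)

/-- Unnormalized expectation on `[a, b]` under the protocol `A`, started in the steady state for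
the initial parameters and restricted to the paths that end in `y`. -/
noncomputable def expectStTo (a b : ℝ) (A : ℝ → Param d e) (y : S) (f : JumpPath S → ℝ) : ℝ :=
  pathIntegral a b (fun p => f p * M.stationary (A a) p.first *
    (if p.last = y then 1 else 0) * M.weight a b A p)

/-- The `k`-th cumulant of `X` in the expectation `expectSt`. -/
noncomputable def cumulant (a b : ℝ) (A : ℝ → Param d e) (k : ℕ) (X : JumpPath S → ℝ) : ℝ :=
  iteratedDeriv k (fun u : ℝ => Real.log (M.expectSt a b A (fun p => Real.exp (u * X p)))) 0

/-- `F` is the nonequilibrium free energy at `α`:  for every state `x`,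
`exp (-β F) = exp (-β H_x) lim_{τ → ∞} ⟨exp (-Ψ/2)⟩_{x →} / [exp (-Ψ/2)]_{st → x}`,
with the numerator taken on `[-τ, -τ/2]` and the denominator on `[τ/2, τ]`, both with
constant parameters `α`. -/
def IsFreeEnergy (α : Param d e) (F : ℝ) : Prop :=
  ∀ x : S, Tendsto
    (fun τ : ℝ => Real.exp (-M.beta * M.H α.nu x) *
      (M.expectFrom (-τ) (-τ / 2) (fun _ => α) x
          (fun p => Real.exp (-M.Psi (fun _ => α) p / 2)) /
        M.expectStTo (τ / 2) τ (fun _ => α) x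
          (fun p => Real.exp (-M.Psi (fun _ => α) p / 2))))
    atTop (𝓝 (Real.exp (-M.beta * F)))

/-- The nonequilibrium entropy `β (⟨H⟩_st - F)` at `α`, where `F` is the free energy at `α`. -/
noncomputable def entropy (F : Param d e → ℝ) (α : Param d e) : ℝ :=
  M.beta * (∑ x, M.H α.nu x * M.stationary α x - F α)

/-- The difference of the `k`-th cumulants of `β W + Ψ` on `[-τ, τ]` for the protocol `A` and for
the protocol `A'`. -/
noncomputable def cumulantDiff (τ : ℝ) (A A' : ℝ → Param d e) (k : ℕ) : ℝ :=
  M.cumulant (-τ) τ A k (fun p => M.beta * M.work (-τ) τ A p + M.Psi A p) -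
    M.cumulant (-τ) τ A' k (fun p => M.beta * M.work (-τ) τ A' p + M.Psi A' p)

end NESSModel

/-- The step protocol from `α` to `α'`. -/
noncomputable def stepProtocol {d e : ℕ} (α α' : Param d e) (t : ℝ) : Param d e :=
  if t ≤ 0 then α else α'

/-- The time reversal of a protocol. -/
def reverseProtocol {d e : ℕ} (A : ℝ → Param d e) (t : ℝ) : Param d e := A (-t)

/-!
The proof reduces all path expectations to Perron–Frobenius theory of tilted generators, and the
estimate to a symmetry of a smooth function of finitely many variables.

*Path integrals.*  For a protocol which is constant before and after time `0`, the path integral of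
`exp (u (β W + Ψ))` is a matrix element of `exp (τ L_u) D_u exp (τ L'_u)`, where `L_u`, `L'_u` are
the generators with rates tilted by `exp (u ψ)` and the diagonal matrix `D_u` carries the work of
the step (`NESSModel.pathIntegral_twoStep`).

*Long times.*  The tilted generators are irreducible with nonnegative off-diagonal entries, so
after removal of the Perron eigenvalue their exponentials converge, with all `u`-derivatives at
`u = 0`, to the Perron projections (`jetTendsto_exp_smul`, `IsIrredMetzler.tendsto_exp_sub_pow`).
The exponential growth rates are the same for the step and for its reversal and cancel in the
difference of the cumulants. What is left are the derivatives at `0` of an explicit function `G` of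
the Perron vectors, `NESSModel.cumulantGap` (`NESSModel.tendsto_cumulantDiff`).

*Time reversal.*  Detailed balance turns the transpose of the generator with tilt `u` into the
generator with tilt `-1 - u`, up to conjugation with `exp (-β H)` (`NESSModel.genMat_reversal`).
Hence left Perron vectors are right Perron vectors for the reversed tilt. This gives the free
energy in terms of the Perron vectors for the symmetric tilt `-1/2`
(`NESSModel.isFreeEnergy_freeEnergy`), and `G (-1/2) = β (F α - F α')`
(`NESSModel.cumulantGap_half`). Since `G 0 = 0`, the quantity to be estimated is the remainder at
`-1/2` of the Taylor polynomial of `G` of degree `2 n - 1`.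

*The estimate.*  `G u = g (u ε, u δ, ε, δ, q)` for a smooth function `g` and parameters `q` in a
compact set. Without a step `g` vanishes, so the remainder is of order `δ`. Its part linear in `δ`
comes from the derivatives of `g` in the second and in the fourth argument. The latter depends on
`u` through `u ε` only, so its remainder is of order `ε ^ (2 n)`; the former carries an additional
factor `u` and loses one power of `ε`. At equilibrium `g` is odd in the tilts
(`NESSModel.cumulantGap_neg`), which removes the term of order `ε ^ (2 n - 1)`
(`exists_taylorRem_bound`).

*Entropy.*  Pathwise `Θ` is `β W + Ψ` minus the increment of `β H`, and the mean of `β W + Ψ` is its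
first cumulant; so the statement on the entropy follows from the case `n = 1`
(`NESSModel.tendsto_expectSt_Theta_sub`).
-/


/-! ### Derivatives in a fixed direction -/

section DirectionalDerivatives

variable {E F : Type*} [NormedAddCommGroup E] [NormedSpace ℝ E] [NormedAddCommGroup F]
  [NormedSpace ℝ F]

/-- The derivative of `f` in the fixed direction `e`, as a function of the base point. -/
noncomputable def dirDeriv (e : E) (f : E → F) (x : E) : F := fderiv ℝ f x e

theorem ContDiff.dirDeriv {f : E → F} (hf : ContDiff ℝ ∞ f) (e : E) :
    ContDiff ℝ ∞ (dirDeriv e f) :=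
  (hf.fderiv_right (m := ∞) (by simp)).clm_apply contDiff_const

theorem ContDiff.dirDeriv_iterate {f : E → F} (hf : ContDiff ℝ ∞ f) (e : E) (k : ℕ) :
    ContDiff ℝ ∞ ((_root_.dirDeriv e)^[k] f) := by
  induction k with
  | zero => exact hf
  | succ k ih => rw [Function.iterate_succ_apply']; exact ih.dirDeriv e

theorem dirDeriv_comm {f : E → F} (hf : ContDiff ℝ ∞ f) (e e' : E) :
    dirDeriv e (dirDeriv e' f) = dirDeriv e' (dirDeriv e f) := by
  have key : ∀ (a b x : E), dirDeriv a (dirDeriv b f) x = fderiv ℝ (fderiv ℝ f) x a b := by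
    intro a b x
    have h1 : DifferentiableAt ℝ (fderiv ℝ f) x :=
      ((hf.fderiv_right (m := ∞) (by simp)).differentiable (by simp)) x
    have h2 := (h1.hasFDerivAt.clm_apply (hasFDerivAt_const b x)).fderiv
    have h3 : (fun y => (fderiv ℝ f y) b) = dirDeriv b f := rfl
    rw [h3] at h2
    simp only [ContinuousLinearMap.comp_zero, zero_add] at h2
    change fderiv ℝ (dirDeriv b f) x a = _
    rw [h2]
    rfl
  funext x
  rw [key, key]
  have hs : IsSymmSndFDerivAt ℝ f x := hf.contDiffAt.isSymmSndFDerivAt (by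
    rw [minSmoothness_of_isRCLikeNormedField]
    exact WithTop.coe_le_coe.2 (le_top : (2 : ℕ∞) ≤ ⊤))
  exact hs e e'

theorem dirDeriv_iterate_comm {f : E → F} (hf : ContDiff ℝ ∞ f) (e e' : E) (k : ℕ) :
    dirDeriv e ((dirDeriv e')^[k] f) = (dirDeriv e')^[k] (dirDeriv e f) := by
  induction k with
  | zero => rfl
  | succ k ih =>
    rw [Function.iterate_succ_apply', Function.iterate_succ_apply',
      dirDeriv_comm (hf.dirDeriv_iterate e' k), ih]

theorem ContDiff.hasDerivAt_line {f : E → F} (hf : ContDiff ℝ ∞ f) (x e : E) (t : ℝ) :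
    HasDerivAt (fun t : ℝ => f (x + t • e)) (_root_.dirDeriv e f (x + t • e)) t := by
  have h1 : HasDerivAt (fun t : ℝ => x + t • e) e t := by
    simpa using ((hasDerivAt_id t).smul_const e).const_add x
  exact ((hf.differentiable (by simp)) (x + t • e)).hasFDerivAt.comp_hasDerivAt t h1

theorem ContDiff.iteratedDeriv_line {f : E → F} (hf : ContDiff ℝ ∞ f) (x e : E) (k : ℕ) (t : ℝ) :
    iteratedDeriv k (fun t : ℝ => f (x + t • e)) t = (_root_.dirDeriv e)^[k] f (x + t • e) := by
  induction k generalizing t with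
  | zero => simp
  | succ k ih =>
    rw [iteratedDeriv_succ, Function.iterate_succ_apply', funext ih]
    exact ((hf.dirDeriv_iterate e k).hasDerivAt_line x e t).deriv

/-- Taylor's formula along a fixed direction, with a remainder bound that is uniform for base
points in a compact set. -/
theorem exists_uniform_taylor_bound {e : E} {K : Set E} (hK : IsCompact K) (b : ℝ) (n : ℕ)
    {f : E → ℝ} (hf : ContDiff ℝ ∞ f) :
    ∃ C : ℝ, 0 ≤ C ∧ ∀ x ∈ K, ∀ t : ℝ, |t| ≤ b →
      |f (x + t • e) - ∑ k ∈ Finset.range n, t ^ k / (k.factorial : ℝ) * (dirDeriv e)^[k] f x|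
        ≤ C * |t| ^ n := by
  induction n generalizing f with
  | zero =>
    have hc : IsCompact ((fun p : E × ℝ => p.1 + p.2 • e) '' (K ×ˢ Set.Icc (-b) b)) :=
      (hK.prod isCompact_Icc).image (by fun_prop)
    obtain ⟨C, hC⟩ := hc.exists_bound_of_continuousOn hf.continuous.continuousOn
    refine ⟨max C 0, le_max_right _ _, fun x hx t ht => ?_⟩
    have := hC (x + t • e) ⟨(x, t), ⟨hx, abs_le.1 ht⟩, rfl⟩
    simpa using Or.inl this
  | succ n ih =>
    obtain ⟨C, hC0, hC⟩ := ih (hf.dirDeriv e)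
    refine ⟨C, hC0, fun x hx t ht => ?_⟩
    set R : ℝ → ℝ := fun s => f (x + s • e) -
      ∑ k ∈ Finset.range (n + 1), s ^ k / (k.factorial : ℝ) * (dirDeriv e)^[k] f x with hR
    have hR0 : R 0 = 0 := by
      simp [hR, Finset.sum_range_succ']
    have hder : ∀ s, HasDerivAt R (dirDeriv e f (x + s • e) -
        ∑ k ∈ Finset.range n, s ^ k / (k.factorial : ℝ) * (dirDeriv e)^[k] (dirDeriv e f) x) s := by
      intro s
      refine (hf.hasDerivAt_line x e s).sub ?_
      have : HasDerivAt (fun s : ℝ => ∑ k ∈ Finset.range (n + 1),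
          s ^ k / (k.factorial : ℝ) * (dirDeriv e)^[k] f x)
          (∑ k ∈ Finset.range (n + 1),
            ((k : ℝ) * s ^ (k - 1)) / (k.factorial : ℝ) * (dirDeriv e)^[k] f x) s := by
        refine HasDerivAt.fun_sum fun k _ => ?_
        exact ((hasDerivAt_pow k s).div_const _).mul_const _
      refine this.congr_deriv ?_
      rw [Finset.sum_range_succ']
      simp only [Nat.cast_zero, zero_mul, zero_div, add_zero]
      refine Finset.sum_congr rfl fun k _ => ?_
      rw [Function.iterate_succ_apply, Nat.factorial_succ]
      have h1 : ((k.factorial : ℕ) : ℝ) ≠ 0 := by positivity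
      have h2 : ((k : ℝ) + 1) ≠ 0 := by positivity
      push_cast
      field_simp
    have hmv := Convex.norm_image_sub_le_of_norm_hasDerivWithin_le (f := R)
      (s := Set.Icc (-|t|) |t|) (C := C * |t| ^ n) (x := 0) (y := t)
      (fun s _ => (hder s).hasDerivWithinAt) (fun s hs => by
        have hs' : |s| ≤ |t| := abs_le.2 hs
        exact (hC x hx s (hs'.trans ht)).trans (by gcongr)) (convex_Icc _ _)
      ⟨by simp, by simp⟩ ⟨neg_abs_le t, le_abs_self t⟩
    rw [hR0, sub_zero, sub_zero, Real.norm_eq_abs, Real.norm_eq_abs, mul_assoc, ← pow_succ] at hmv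
    exact hmv

end DirectionalDerivatives

/-! ### The Taylor remainder at `-1/2` -/

section TaylorRemainder

/-- The error at `-1/2` of the Taylor polynomial of `φ` at `0` with the terms of order `< N`. -/
noncomputable def taylorRem (N : ℕ) (φ : ℝ → ℝ) : ℝ :=
  φ (-1 / 2) - ∑ k ∈ Finset.range N, (-1 / 2 : ℝ) ^ k / (k.factorial : ℝ) * iteratedDeriv k φ 0

theorem taylorRem_succ (N : ℕ) (φ : ℝ → ℝ) :
    taylorRem N φ = taylorRem (N + 1) φ +
      (-1 / 2 : ℝ) ^ N / (N.factorial : ℝ) * iteratedDeriv N φ 0 := by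
  simp only [taylorRem, Finset.sum_range_succ]; ring

theorem taylorRem_add (N : ℕ) {φ ψ : ℝ → ℝ} (hφ : ContDiff ℝ ∞ φ) (hψ : ContDiff ℝ ∞ ψ) :
    taylorRem N (fun u => φ u + ψ u) = taylorRem N φ + taylorRem N ψ := by
  have : ∀ k, iteratedDeriv k (fun u => φ u + ψ u) 0 =
      iteratedDeriv k φ 0 + iteratedDeriv k ψ 0 := fun k =>
    iteratedDeriv_fun_add (hφ.contDiffAt.of_le (by exact_mod_cast le_top))
      (hψ.contDiffAt.of_le (by exact_mod_cast le_top))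
  simp only [taylorRem, this, mul_add, Finset.sum_add_distrib]; ring

theorem iteratedDeriv_id_mul_zero (k : ℕ) {φ : ℝ → ℝ} (hφ : ContDiff ℝ ∞ φ) :
    iteratedDeriv (k + 1) (fun u => u * φ u) 0 = (k + 1) * iteratedDeriv k φ 0 := by
  rw [iteratedDeriv_fun_mul (by fun_prop) (hφ.contDiffAt.of_le (by exact_mod_cast le_top)),
    Finset.sum_eq_single 1]
  · simp [iteratedDeriv_fun_id_zero]
  · intro i _ hi
    simp [iteratedDeriv_fun_id_zero, hi]
  · intro h; simp at h

/-- A factor `u` lowers the order of the Taylor remainder by one. -/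
theorem taylorRem_id_mul (N : ℕ) {φ : ℝ → ℝ} (hφ : ContDiff ℝ ∞ φ) :
    taylorRem (N + 1) (fun u => u * φ u) = (-1 / 2) * taylorRem N φ := by
  simp only [taylorRem, Finset.sum_range_succ', iteratedDeriv_id_mul_zero _ hφ, mul_sub,
    Finset.mul_sum]
  simp only [iteratedDeriv_zero, zero_mul, mul_zero, add_zero]
  congr 1
  refine Finset.sum_congr rfl fun k _ => ?_
  rw [Nat.factorial_succ]
  have h1 : ((k.factorial : ℕ) : ℝ) ≠ 0 := by positivity
  have h2 : ((k : ℝ) + 1) ≠ 0 := by positivity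
  push_cast
  field_simp
  ring

variable {Q : Type*} [NormedAddCommGroup Q] [NormedSpace ℝ Q]

/-- If `u` enters only through `u ε`, then the Taylor remainder of order `N` is `O(ε ^ N)`. -/
theorem exists_taylorRem_scaled_bound {K : Set Q} (hK : IsCompact K) (b : ℝ) (N : ℕ)
    {A : ℝ × ℝ × Q → ℝ} (hA : ContDiff ℝ ∞ A) :
    ∃ C : ℝ, 0 ≤ C ∧ ∀ q ∈ K, ∀ ε ∈ Set.Icc 0 b,
      |taylorRem N (fun u => A (u * ε, ε, q))| ≤ C * ε ^ N := by
  have hK' : IsCompact ((fun p : ℝ × Q => ((0 : ℝ), p.1, p.2)) '' (Set.Icc 0 b ×ˢ K)) :=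
    (isCompact_Icc.prod hK).image (by fun_prop)
  obtain ⟨C, hC0, hC⟩ := exists_uniform_taylor_bound (e := ((1 : ℝ), (0 : ℝ), (0 : Q))) hK' b N hA
  refine ⟨C, hC0, fun q hq ε hε => ?_⟩
  have h1 := hC (0, ε, q) ⟨(ε, q), ⟨hε, hq⟩, rfl⟩ (-1 / 2 * ε) (by
    rw [abs_mul, abs_of_nonneg hε.1]; norm_num; nlinarith [hε.1, hε.2])
  have hline : ∀ u : ℝ, A (u * ε, ε, q) =
      (fun v : ℝ => A ((0, ε, q) + v • ((1 : ℝ), (0 : ℝ), (0 : Q)))) (ε * u) := by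
    intro u; simp [mul_comm]
  have hder : ∀ k, iteratedDeriv k (fun u => A (u * ε, ε, q)) 0 =
      ε ^ k * (dirDeriv ((1 : ℝ), (0 : ℝ), (0 : Q)))^[k] A (0, ε, q) := by
    intro k
    rw [funext hline, iteratedDeriv_comp_const_mul (n := k)
      (f := fun v : ℝ => A ((0, ε, q) + v • ((1 : ℝ), (0 : ℝ), (0 : Q))))
      ((hA.comp (by fun_prop)).of_le (by exact_mod_cast le_top))]
    simp only [hA.iteratedDeriv_line, mul_zero, zero_smul, add_zero]
  have h2 : taylorRem N (fun u => A (u * ε, ε, q)) = A ((0, ε, q) +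
      (-1 / 2 * ε) • ((1 : ℝ), (0 : ℝ), (0 : Q))) - ∑ k ∈ Finset.range N,
      (-1 / 2 * ε) ^ k / (k.factorial : ℝ) *
        (dirDeriv ((1 : ℝ), (0 : ℝ), (0 : Q)))^[k] A (0, ε, q) := by
    simp only [taylorRem, hder]
    congr 1
    · simp
    · refine Finset.sum_congr rfl fun k _ => ?_
      rw [mul_pow]; ring
  rw [h2]
  refine h1.trans ?_
  have : |(-1 / 2 * ε)| ≤ ε := by
    rw [abs_mul, abs_of_nonneg hε.1]; norm_num; nlinarith [hε.1, hε.2]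
  gcongr

/-- A Taylor remainder with a leading term that vanishes at `ε = 0` and has a factor `u` gains one
order in `ε`:  the highest coefficient of the Taylor polynomial is an odd derivative of the even
function `B (·, 0, q)`. -/
theorem exists_taylorRem_even_bound {K : Set Q} (hK : IsCompact K) (b : ℝ) {n : ℕ} (hn : 1 ≤ n)
    {B : ℝ × ℝ × Q → ℝ} (hB : ContDiff ℝ ∞ B) (heven : ∀ v q, B (-v, 0, q) = B (v, 0, q)) :
    ∃ C : ℝ, 0 ≤ C ∧ ∀ q ∈ K, ∀ ε ∈ Set.Icc 0 b,
      |taylorRem (2 * n) (fun u => u * B (u * ε, ε, q))| ≤ C * ε ^ (2 * n) := by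
  obtain ⟨m, rfl⟩ : ∃ m, n = m + 1 := ⟨n - 1, by omega⟩
  obtain ⟨C₁, hC₁, h₁⟩ := exists_taylorRem_scaled_bound hK b (2 * (m + 1)) hB
  set D : ℝ × ℝ × Q → ℝ := (dirDeriv ((1 : ℝ), (0 : ℝ), (0 : Q)))^[2 * m + 1] B with hD
  have hDs : ContDiff ℝ ∞ D := hB.dirDeriv_iterate _ _
  have hline : ∀ (q : Q) (ε v : ℝ), B (v, ε, q) =
      B ((0, ε, q) + v • ((1 : ℝ), (0 : ℝ), (0 : Q))) := by intro q ε v; simp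
  have hD0 : ∀ q, D (0, 0, q) = 0 := by
    intro q
    have h1 : iteratedDeriv (2 * m + 1) (fun v : ℝ => B (v, 0, q)) 0 = D (0, 0, q) := by
      simp only [hline q 0, hB.iteratedDeriv_line, zero_smul, add_zero, hD]
    have h2 := iteratedDeriv_comp_neg (2 * m + 1) (fun v : ℝ => B (v, 0, q)) 0
    simp only [heven, neg_zero, h1, smul_eq_mul] at h2
    rw [Odd.neg_one_pow ⟨m, rfl⟩] at h2
    linarith
  -- the value of `D` at `(0, ε, q)` is `O(ε)`
  have hK' : IsCompact ((fun q : Q => ((0 : ℝ), (0 : ℝ), q)) '' K) := hK.image (by fun_prop)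
  obtain ⟨C₂, hC₂, h₂⟩ := exists_uniform_taylor_bound (e := ((0 : ℝ), (1 : ℝ), (0 : Q))) hK' b 1 hDs
  refine ⟨C₁ + C₂, by positivity, fun q hq ε hε => ?_⟩
  have hBs : ContDiff ℝ ∞ (fun u : ℝ => B (u * ε, ε, q)) := hB.comp (by fun_prop)
  have hder : iteratedDeriv (2 * m + 1) (fun u => B (u * ε, ε, q)) 0 =
      ε ^ (2 * m + 1) * D (0, ε, q) := by
    have : ∀ u : ℝ, B (u * ε, ε, q) = (fun v : ℝ => B (v, ε, q)) (ε * u) := by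
      intro u; simp [mul_comm]
    rw [funext this, iteratedDeriv_comp_const_mul (n := 2 * m + 1)
      (f := fun v : ℝ => B (v, ε, q)) ((hB.comp (by fun_prop)).of_le
        (WithTop.coe_le_coe.2 (le_top : ((2 * m + 1 : ℕ) : ℕ∞) ≤ ⊤)))]
    simp only [hline q ε, hB.iteratedDeriv_line, mul_zero, zero_smul, add_zero, hD]
  have h3 := h₂ (0, 0, q) ⟨q, hq, rfl⟩ ε (by rw [abs_of_nonneg hε.1]; exact hε.2)
  simp only [Finset.sum_range_one, Function.iterate_zero, id, hD0] at h3
  have h3' : |D (0, ε, q)| ≤ C₂ * ε := by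
    simpa [abs_of_nonneg hε.1] using h3
  have h4 := h₁ q hq ε hε
  rw [show 2 * (m + 1) = (2 * m + 1) + 1 by ring] at h4 ⊢
  rw [taylorRem_id_mul _ hBs, taylorRem_succ, hder]
  have hfac : |(-1 / 2 : ℝ) ^ (2 * m + 1) / ((2 * m + 1).factorial : ℝ)| ≤ 1 := by
    rw [abs_div, abs_pow]
    have h5 : (1 : ℝ) ≤ ((2 * m + 1).factorial : ℝ) := by
      exact_mod_cast Nat.one_le_iff_ne_zero.2 (Nat.factorial_ne_zero _)
    rw [Nat.abs_cast, div_le_one (by linarith)]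
    refine le_trans (pow_le_one₀ (abs_nonneg _) ?_) h5
    norm_num [abs_le]
  have hε' : |ε ^ (2 * m + 1) * D (0, ε, q)| ≤ C₂ * ε ^ (2 * m + 1 + 1) := by
    rw [abs_mul, abs_pow, abs_of_nonneg hε.1]
    calc ε ^ (2 * m + 1) * |D (0, ε, q)| ≤ ε ^ (2 * m + 1) * (C₂ * ε) := by
          have := hε.1; gcongr
      _ = _ := by ring
  have h6 : |(-1 / 2 : ℝ) ^ (2 * m + 1) / ((2 * m + 1).factorial : ℝ) *
      (ε ^ (2 * m + 1) * D (0, ε, q))| ≤ C₂ * ε ^ (2 * m + 1 + 1) := by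
    rw [abs_mul]
    exact (mul_le_mul hfac hε' (abs_nonneg _) zero_le_one).trans_eq (one_mul _)
  rw [abs_mul]
  calc |(-1 / 2 : ℝ)| * _ ≤ 1 * (C₁ * ε ^ (2 * m + 1 + 1) + C₂ * ε ^ (2 * m + 1 + 1)) := by
        refine mul_le_mul (by norm_num [abs_le]) ((abs_add_le _ _).trans (add_le_add h4 h6))
          (abs_nonneg _) zero_le_one
    _ = _ := by ring

/-- The analytic core of the extended Clausius relation.  Let `g (v, σ, ε, s, q)` vanish for
`σ = s = 0` and let `g (·, ·, 0, 0, q)` be odd.  Then the Taylor remainder of order `2 n` of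
`u ↦ g (u ε, u δ, ε, δ, q)` is of order `ε ^ (2 n) δ + δ ^ 2`, uniformly on compact sets. -/
theorem exists_taylorRem_bound {K : Set Q} (hK : IsCompact K) (b b' : ℝ) {n : ℕ} (hn : 1 ≤ n)
    {g : ℝ × ℝ × ℝ × ℝ × Q → ℝ} (hg : ContDiff ℝ ∞ g)
    (hzero : ∀ v ε q, g (v, 0, ε, 0, q) = 0)
    (hodd : ∀ v σ q, g (-v, -σ, 0, 0, q) = -g (v, σ, 0, 0, q)) :
    ∃ C C' : ℝ, 0 ≤ C ∧ 0 ≤ C' ∧ ∀ q ∈ K, ∀ ε ∈ Set.Icc 0 b, ∀ δ ∈ Set.Icc 0 b',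
      |taylorRem (2 * n) (fun u => g (u * ε, u * δ, ε, δ, q))| ≤
        C * ε ^ (2 * n) * δ + C' * δ ^ 2 := by
  -- `f (u, s, ε, q)` is `g` on the scaled arguments, `F (s, ε, q)` its Taylor remainder in `u`
  set f : ℝ × ℝ × ℝ × Q → ℝ := fun p => g (p.1 * p.2.2.1, p.1 * p.2.1, p.2.2.1, p.2.1, p.2.2.2)
    with hf
  have hfs : ContDiff ℝ ∞ f := hg.comp (by fun_prop)
  set e₁ : ℝ × ℝ × ℝ × Q := (1, 0, 0, 0) with he₁
  set e₂ : ℝ × ℝ × ℝ × Q := (0, 1, 0, 0) with he₂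
  have hiter : ∀ (f : ℝ × ℝ × ℝ × Q → ℝ), ContDiff ℝ ∞ f → ∀ (k : ℕ) (s ε : ℝ) (q : Q),
      iteratedDeriv k (fun u => f (u, s, ε, q)) 0 = (dirDeriv e₁)^[k] f (0, s, ε, q) := by
    intro f hfs k s ε q
    have : ∀ u : ℝ, f (u, s, ε, q) = f ((0, s, ε, q) + u • e₁) := by intro u; simp [he₁]
    rw [funext this, hfs.iteratedDeriv_line]
    simp
  set F : ℝ × ℝ × Q → ℝ := fun p => f (-1 / 2, p) -
    ∑ k ∈ Finset.range (2 * n), (-1 / 2 : ℝ) ^ k / (k.factorial : ℝ) *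
      (dirDeriv e₁)^[k] f (0, p) with hF
  have hFs : ContDiff ℝ ∞ F := by
    refine (hfs.comp (by fun_prop)).sub (ContDiff.sum fun k _ => contDiff_const.mul ?_)
    exact (hfs.dirDeriv_iterate e₁ k).comp (by fun_prop)
  have hFrem : ∀ s ε q, F (s, ε, q) = taylorRem (2 * n) (fun u => f (u, s, ε, q)) := by
    intro s ε q
    simp only [hF, taylorRem, hiter f hfs]
  -- the first order in `s`
  set A : ℝ × ℝ × Q → ℝ := fun p =>
    dirDeriv ((0 : ℝ), (0 : ℝ), (0 : ℝ), (1 : ℝ), (0 : Q)) g (p.1, 0, p.2.1, 0, p.2.2) with hA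
  set B : ℝ × ℝ × Q → ℝ := fun p =>
    dirDeriv ((0 : ℝ), (1 : ℝ), (0 : ℝ), (0 : ℝ), (0 : Q)) g (p.1, 0, p.2.1, 0, p.2.2) with hB
  have hAs : ContDiff ℝ ∞ A := (hg.dirDeriv _).comp (by fun_prop)
  have hBs : ContDiff ℝ ∞ B := (hg.dirDeriv _).comp (by fun_prop)
  have hdf : ∀ u ε q, dirDeriv e₂ f (u, 0, ε, q) = u * B (u * ε, ε, q) + A (u * ε, ε, q) := by
    intro u ε q
    have h1 := hfs.hasDerivAt_line (u, 0, ε, q) e₂ 0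
    have h2 := hg.hasDerivAt_line (u * ε, 0, ε, 0, q) ((0 : ℝ), u, (0 : ℝ), (1 : ℝ), (0 : Q)) 0
    have h3 : (fun t : ℝ => f ((u, 0, ε, q) + t • e₂)) = fun t : ℝ =>
        g ((u * ε, 0, ε, 0, q) + t • ((0 : ℝ), u, (0 : ℝ), (1 : ℝ), (0 : Q))) := by
      funext t; simp [hf, he₂, mul_comm]
    rw [h3] at h1
    have h4 := h1.unique h2
    simp only [zero_smul, add_zero] at h4
    rw [h4]
    have h5 : ((0 : ℝ), u, (0 : ℝ), (1 : ℝ), (0 : Q)) =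
        u • ((0 : ℝ), (1 : ℝ), (0 : ℝ), (0 : ℝ), (0 : Q)) +
          ((0 : ℝ), (0 : ℝ), (0 : ℝ), (1 : ℝ), (0 : Q)) := by simp
    rw [h5, dirDeriv, map_add, map_smul]
    rfl
  have hBeven : ∀ v q, B (-v, 0, q) = B (v, 0, q) := by
    intro v q
    have h1 := hg.hasDerivAt_line (v, 0, 0, 0, q) ((0 : ℝ), (1 : ℝ), (0 : ℝ), (0 : ℝ), (0 : Q)) 0
    have h2 := hg.hasDerivAt_line (-v, 0, 0, 0, q) ((0 : ℝ), (1 : ℝ), (0 : ℝ), (0 : ℝ), (0 : Q))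
      (-0)
    have h3 := (h2.scomp (0 : ℝ) (hasDerivAt_neg (0 : ℝ))).neg
    have h4 : (fun t : ℝ =>
        g ((v, 0, 0, 0, q) + t • ((0 : ℝ), (1 : ℝ), (0 : ℝ), (0 : ℝ), (0 : Q)))) =
        -((fun t : ℝ =>
          g ((-v, 0, 0, 0, q) + t • ((0 : ℝ), (1 : ℝ), (0 : ℝ), (0 : ℝ), (0 : Q)))) ∘ Neg.neg) := by
      funext t
      have := hodd v t q
      simp [this]
    rw [h4] at h1
    have h5 := h1.unique h3
    simp only [neg_zero, zero_smul, add_zero, neg_smul, one_smul, neg_neg] at h5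
    exact h5.symm
  obtain ⟨C₁, hC₁, h₁⟩ := exists_taylorRem_scaled_bound hK b (2 * n) hAs
  obtain ⟨C₂, hC₂, h₂⟩ := exists_taylorRem_even_bound hK b hn hBs hBeven
  have hK' : IsCompact ((fun p : ℝ × Q => ((0 : ℝ), p.1, p.2)) '' (Set.Icc 0 b ×ˢ K)) :=
    (isCompact_Icc.prod hK).image (by fun_prop)
  obtain ⟨C₃, hC₃, h₃⟩ := exists_uniform_taylor_bound (e := ((1 : ℝ), (0 : ℝ), (0 : Q))) hK' b' 2 hFs
  refine ⟨C₁ + C₂, C₃, by positivity, hC₃, fun q hq ε hε δ hδ => ?_⟩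
  have h4 := h₃ (0, ε, q) ⟨(ε, q), ⟨hε, hq⟩, rfl⟩ δ (by rw [abs_of_nonneg hδ.1]; exact hδ.2)
  -- without a step the remainder vanishes, and its first order in `s` is the remainder of
  -- `dirDeriv e₂ f`
  have hF0 : F (0, ε, q) = 0 := by
    rw [hFrem]
    have : ∀ u, f (u, 0, ε, q) = 0 := by intro u; simp [hf, hzero]
    simp [this, taylorRem]
  have hF1 : dirDeriv ((1 : ℝ), (0 : ℝ), (0 : Q)) F (0, ε, q) =
      taylorRem (2 * n) (fun u => u * B (u * ε, ε, q) + A (u * ε, ε, q)) := by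
    have h5 := hFs.hasDerivAt_line (0, ε, q) ((1 : ℝ), (0 : ℝ), (0 : Q)) 0
    have h6 : HasDerivAt (fun t : ℝ => f ((-1 / 2, 0, ε, q) + t • e₂) -
        ∑ k ∈ Finset.range (2 * n), (-1 / 2 : ℝ) ^ k / (k.factorial : ℝ) *
          (dirDeriv e₁)^[k] f ((0, 0, ε, q) + t • e₂))
        (dirDeriv e₂ f ((-1 / 2, 0, ε, q) + (0 : ℝ) • e₂) -
          ∑ k ∈ Finset.range (2 * n), (-1 / 2 : ℝ) ^ k / (k.factorial : ℝ) *
          dirDeriv e₂ ((dirDeriv e₁)^[k] f) ((0, 0, ε, q) + (0 : ℝ) • e₂)) 0 := by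
      refine (hfs.hasDerivAt_line _ _ _).sub (HasDerivAt.fun_sum fun k _ => ?_)
      exact ((hfs.dirDeriv_iterate e₁ k).hasDerivAt_line _ _ _).const_mul _
    have h7 : (fun t : ℝ => F ((0, ε, q) + t • ((1 : ℝ), (0 : ℝ), (0 : Q)))) =
        (fun t : ℝ => f ((-1 / 2, 0, ε, q) + t • e₂) -
        ∑ k ∈ Finset.range (2 * n), (-1 / 2 : ℝ) ^ k / (k.factorial : ℝ) *
          (dirDeriv e₁)^[k] f ((0, 0, ε, q) + t • e₂)) := by
      funext t; simp [hF, he₂]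
    rw [h7] at h5
    have h8 := h5.unique h6
    simp only [zero_smul, add_zero, dirDeriv_iterate_comm hfs] at h8
    rw [h8, taylorRem]
    simp only [← hdf, ← hiter _ (hfs.dirDeriv e₂)]
  simp only [Finset.sum_range_succ, Finset.sum_range_zero, Function.iterate_zero,
    Function.iterate_one, id, hF0, hF1] at h4
  have h9 : taylorRem (2 * n) (fun u => u * B (u * ε, ε, q) + A (u * ε, ε, q)) =
      taylorRem (2 * n) (fun u => u * B (u * ε, ε, q)) +
        taylorRem (2 * n) (fun u => A (u * ε, ε, q)) :=
    taylorRem_add _ (contDiff_id.mul (hBs.comp (by fun_prop))) (hAs.comp (by fun_prop))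
  have h10 := h₁ q hq ε hε
  have h11 := h₂ q hq ε hε
  have h12 : taylorRem (2 * n) (fun u => g (u * ε, u * δ, ε, δ, q)) = F (δ, ε, q) :=
    (hFrem δ ε q).symm
  rw [h12]
  simp only [smul_eq_mul, Prod.smul_mk, mul_one, mul_zero, smul_zero, Prod.mk_add_mk, zero_add,
    add_zero, pow_zero, pow_one, Nat.factorial, Nat.cast_one, div_one, h9, abs_of_nonneg hδ.1]
    at h4
  have h13 : |δ * (taylorRem (2 * n) (fun u => u * B (u * ε, ε, q)) +
      taylorRem (2 * n) (fun u => A (u * ε, ε, q)))| ≤ (C₁ + C₂) * ε ^ (2 * n) * δ := by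
    rw [abs_mul, abs_of_nonneg hδ.1, mul_comm]
    refine mul_le_mul_of_nonneg_right ((abs_add_le _ _).trans ?_) hδ.1
    linarith
  have := abs_sub_abs_le_abs_sub (F (δ, ε, q)) (δ * (taylorRem (2 * n)
    (fun u => u * B (u * ε, ε, q)) + taylorRem (2 * n) (fun u => A (u * ε, ε, q))))
  linarith

end TaylorRemainder

/-! ### Convergence of all derivatives at a point -/

section Jets

variable {𝔸 : Type*} [NormedRing 𝔸] [NormedAlgebra ℝ 𝔸] {ι : Type*} {l : Filter ι}

theorem ContDiff.natCast_contDiffAt {E F : Type*} [NormedAddCommGroup E] [NormedSpace ℝ E]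
    [NormedAddCommGroup F] [NormedSpace ℝ F] {f : E → F} (hf : ContDiff ℝ ∞ f) (k : ℕ) (x : E) :
    ContDiffAt ℝ k f x :=
  hf.contDiffAt.of_le (WithTop.coe_le_coe.2 (le_top : ((k : ℕ) : ℕ∞) ≤ ⊤))

/-- Convergence of all derivatives at `0`. -/
def JetTendsto {F : Type*} [NormedAddCommGroup F] [NormedSpace ℝ F] (f : ι → ℝ → F)
    (l : Filter ι) (f₀ : ℝ → F) : Prop :=
  ∀ k, Tendsto (fun i => iteratedDeriv k (f i) 0) l (𝓝 (iteratedDeriv k f₀ 0))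

theorem JetTendsto.const {F : Type*} [NormedAddCommGroup F] [NormedSpace ℝ F] (f₀ : ℝ → F) :
    JetTendsto (fun _ : ι => f₀) l f₀ := fun _ => tendsto_const_nhds

theorem JetTendsto.mul {f g : ι → ℝ → 𝔸} {f₀ g₀ : ℝ → 𝔸} (hf : JetTendsto f l f₀)
    (hg : JetTendsto g l g₀) (hfs : ∀ i, ContDiff ℝ ∞ (f i)) (hgs : ∀ i, ContDiff ℝ ∞ (g i))
    (hf₀ : ContDiff ℝ ∞ f₀) (hg₀ : ContDiff ℝ ∞ g₀) :
    JetTendsto (fun i u => f i u * g i u) l (fun u => f₀ u * g₀ u) := by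
  intro k
  simp only [iteratedDeriv_fun_mul ((hfs _).natCast_contDiffAt k _)
    ((hgs _).natCast_contDiffAt k _), iteratedDeriv_fun_mul (hf₀.natCast_contDiffAt k _)
    (hg₀.natCast_contDiffAt k _)]
  exact tendsto_finsetSum _ fun i _ => ((tendsto_const_nhds).mul (hf i)).mul (hg (k - i))

theorem ContinuousLinearMap.iteratedDeriv_comp {F G : Type*} [NormedAddCommGroup F]
    [NormedSpace ℝ F] [NormedAddCommGroup G] [NormedSpace ℝ G] (L : F →L[ℝ] G) {f : ℝ → F}
    (hf : ContDiff ℝ ∞ f) (k : ℕ) (x : ℝ) :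
    iteratedDeriv k (fun u => L (f u)) x = L (iteratedDeriv k f x) := by
  induction k generalizing x with
  | zero => simp
  | succ k ih =>
    rw [iteratedDeriv_succ, iteratedDeriv_succ, funext ih]
    have h1 : DifferentiableAt ℝ (iteratedDeriv k f) x :=
      (hf.differentiable_iteratedDeriv k (WithTop.coe_lt_coe.2 (ENat.natCast_lt_top k))) x
    exact (L.hasFDerivAt.comp_hasDerivAt x h1.hasDerivAt).deriv

theorem JetTendsto.clm {F G : Type*} [NormedAddCommGroup F] [NormedSpace ℝ F]
    [NormedAddCommGroup G] [NormedSpace ℝ G] {f : ι → ℝ → F} {f₀ : ℝ → F}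
    (hf : JetTendsto f l f₀) (hfs : ∀ i, ContDiff ℝ ∞ (f i)) (hf₀ : ContDiff ℝ ∞ f₀)
    (L : F →L[ℝ] G) : JetTendsto (fun i u => L (f i u)) l (fun u => L (f₀ u)) := by
  intro k
  simp only [L.iteratedDeriv_comp (hfs _), L.iteratedDeriv_comp hf₀]
  exact (L.continuous.tendsto _).comp (hf k)

/-- The derivatives of `log f` at `0` are rational expressions in those of `f`. -/
theorem iteratedDeriv_succ_real_log {f : ℝ → ℝ} (hf : ContDiff ℝ ∞ f) (hpos : ∀ u, 0 < f u) (k : ℕ) :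
    iteratedDeriv (k + 1) (fun u => Real.log (f u)) 0 =
      (iteratedDeriv (k + 1) f 0 - ∑ i ∈ Finset.range k, (k.choose i : ℝ) *
        iteratedDeriv (i + 1) (fun u => Real.log (f u)) 0 * iteratedDeriv (k - i) f 0) / f 0 := by
  have hL : ContDiff ℝ ∞ (fun u => Real.log (f u)) := hf.log fun u => (hpos u).ne'
  have h1 : deriv f = fun u => deriv (fun u => Real.log (f u)) u * f u := by
    funext u
    rw [deriv.log ((hf.differentiable (by simp)) u) (hpos u).ne', div_mul_cancel₀ _ (hpos u).ne']
  have h2 : ContDiff ℝ ∞ (deriv (fun u => Real.log (f u))) := hL.deriv' 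
  rw [eq_div_iff (hpos 0).ne', eq_sub_iff_add_eq, iteratedDeriv_succ' (f := f), h1,
    iteratedDeriv_fun_mul (h2.natCast_contDiffAt k _) (hf.natCast_contDiffAt k _),
    Finset.sum_range_succ]
  simp [← iteratedDeriv_succ', add_comm]

/-- By induction on the order of the derivative, from `iteratedDeriv_succ_real_log`. -/
theorem JetTendsto.log {f : ι → ℝ → ℝ} {f₀ : ℝ → ℝ} (hf : JetTendsto f l f₀)
    (hfs : ∀ i, ContDiff ℝ ∞ (f i)) (hf₀ : ContDiff ℝ ∞ f₀) (hpos : ∀ᶠ i in l, ∀ u, 0 < f i u)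
    (hpos₀ : ∀ u, 0 < f₀ u) :
    JetTendsto (fun i u => Real.log (f i u)) l (fun u => Real.log (f₀ u)) := by
  intro k
  induction k using Nat.strong_induction_on with
  | _ k ih =>
    cases k with
    | zero => simpa using (hf 0).log (by simpa using (hpos₀ 0).ne')
    | succ k =>
      rw [iteratedDeriv_succ_real_log hf₀ hpos₀]
      refine Tendsto.congr' (f₁ := fun i => (iteratedDeriv (k + 1) (f i) 0 -
        ∑ j ∈ Finset.range k, (k.choose j : ℝ) *
          iteratedDeriv (j + 1) (fun u => Real.log (f i u)) 0 * iteratedDeriv (k - j) (f i) 0) /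
            f i 0) ?_ ?_
      · filter_upwards [hpos] with i hi
        exact (iteratedDeriv_succ_real_log (hfs i) hi k).symm
      refine Tendsto.div (Tendsto.sub (hf _) (tendsto_finsetSum _ fun i hi => ?_))
        (by simpa using hf 0) (hpos₀ 0).ne'
      exact ((tendsto_const_nhds).mul (ih (i + 1) (by simpa using hi))).mul (hf _)

/-- The norm of the truncated power series of `f` at `0`, with radius `r`. It is
submultiplicative. -/
noncomputable def jetNorm (r : ℝ) (K : ℕ) (f : ℝ → 𝔸) : ℝ :=
  ∑ j ∈ Finset.range (K + 1), r ^ j / (j.factorial : ℝ) * ‖iteratedDeriv j f 0‖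

theorem jetNorm_nonneg {r : ℝ} (hr : 0 ≤ r) (K : ℕ) (f : ℝ → 𝔸) : 0 ≤ jetNorm r K f :=
  Finset.sum_nonneg fun _ _ => by positivity

theorem jetNorm_mul_le {r : ℝ} (hr : 0 ≤ r) (K : ℕ) {f g : ℝ → 𝔸} (hf : ContDiff ℝ ∞ f)
    (hg : ContDiff ℝ ∞ g) :
    jetNorm r K (fun u => f u * g u) ≤ jetNorm r K f * jetNorm r K g := by
  set a : ℕ → ℝ := fun j => r ^ j / (j.factorial : ℝ) * ‖iteratedDeriv j f 0‖ with ha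
  set b : ℕ → ℝ := fun j => r ^ j / (j.factorial : ℝ) * ‖iteratedDeriv j g 0‖ with hb
  have ha0 : ∀ j, 0 ≤ a j := fun j => by simp only [ha]; positivity
  have hb0 : ∀ j, 0 ≤ b j := fun j => by simp only [hb]; positivity
  have h1 : ∀ j, r ^ j / (j.factorial : ℝ) * ‖iteratedDeriv j (fun u => f u * g u) 0‖ ≤
      ∑ i ∈ Finset.range (j + 1), a i * b (j - i) := by
    intro j
    have h2 : ‖iteratedDeriv j (fun u => f u * g u) 0‖ ≤ ∑ i ∈ Finset.range (j + 1),
        (j.choose i : ℝ) * ‖iteratedDeriv i f 0‖ * ‖iteratedDeriv (j - i) g 0‖ := by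
      simpa only [norm_iteratedFDeriv_eq_norm_iteratedDeriv] using
        norm_iteratedFDeriv_mul_le hf hg (0 : ℝ)
          (WithTop.coe_le_coe.2 (le_top : ((j : ℕ) : ℕ∞) ≤ ⊤))
    refine (mul_le_mul_of_nonneg_left h2 (by positivity)).trans_eq ?_
    rw [Finset.mul_sum]
    refine Finset.sum_congr rfl fun i hi => ?_
    have hij : i ≤ j := Nat.lt_succ_iff.1 (Finset.mem_range.1 hi)
    have h3 : (j.choose i : ℝ) * (i.factorial : ℝ) * ((j - i).factorial : ℝ) =
        (j.factorial : ℝ) := by exact_mod_cast Nat.choose_mul_factorial_mul_factorial hij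
    have h4 : r ^ j = r ^ i * r ^ (j - i) := by rw [← pow_add, Nat.add_sub_cancel' hij]
    have h5 : ((j.choose i : ℕ) : ℝ) = (j.factorial : ℝ) / ((i.factorial : ℝ) *
        ((j - i).factorial : ℝ)) := by
      rw [eq_div_iff (by positivity), ← h3]; ring
    simp only [ha, hb]
    rw [h4, h5]
    have : ((j.factorial : ℕ) : ℝ) ≠ 0 := by positivity
    field_simp
  calc jetNorm r K (fun u => f u * g u)
      ≤ ∑ j ∈ Finset.range (K + 1), ∑ i ∈ Finset.range (j + 1), a i * b (j - i) :=
        Finset.sum_le_sum fun j _ => h1 j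
    _ = ∑ i ∈ Finset.range (K + 1), ∑ j ∈ Finset.range (K + 1 - i), a i * b j :=
        Finset.sum_range_diag_flip (K + 1) (fun i j => a i * b j)
    _ ≤ ∑ i ∈ Finset.range (K + 1), ∑ j ∈ Finset.range (K + 1), a i * b j := by
        refine Finset.sum_le_sum fun i _ => Finset.sum_le_sum_of_subset_of_nonneg ?_ ?_
        · intro j hj; simp at hj ⊢; omega
        · intro j _ _; exact mul_nonneg (ha0 i) (hb0 j)
    _ = jetNorm r K f * jetNorm r K g := by
        rw [jetNorm, jetNorm, Finset.sum_mul_sum]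

theorem norm_iteratedDeriv_le_jetNorm {r : ℝ} (hr : 0 < r) {k K : ℕ} (hk : k ≤ K) (f : ℝ → 𝔸) :
    ‖iteratedDeriv k f 0‖ ≤ (k.factorial : ℝ) / r ^ k * jetNorm r K f := by
  have h := Finset.single_le_sum (f := fun j => r ^ j / (j.factorial : ℝ) *
    ‖iteratedDeriv j f 0‖) (s := Finset.range (K + 1)) (fun j _ => by positivity)
    (Finset.mem_range.2 (Nat.lt_succ_of_le hk))
  calc ‖iteratedDeriv k f 0‖
      = (k.factorial : ℝ) / r ^ k * (r ^ k / (k.factorial : ℝ) * ‖iteratedDeriv k f 0‖) := by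
        field_simp
    _ ≤ _ := mul_le_mul_of_nonneg_left h (by positivity)

/-- If the powers of `Q 0` tend to zero, then the jets of the powers of `Q` tend to zero, in a jet
norm of small radius. -/
theorem exists_tendsto_jetNorm_pow {Q : ℝ → 𝔸} (hQ : ContDiff ℝ ∞ Q)
    (h0 : Tendsto (fun m : ℕ => Q 0 ^ m) atTop (𝓝 0)) (K : ℕ) :
    ∃ r : ℝ, 0 < r ∧ Tendsto (fun m : ℕ => jetNorm r K (fun u => Q u ^ m)) atTop (𝓝 0) := by
  have hQp : ∀ m, ContDiff ℝ ∞ (fun u => Q u ^ m) := fun m => hQ.pow m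
  obtain ⟨p, hp1, hp⟩ : ∃ p : ℕ, 1 ≤ p ∧ ‖Q 0 ^ p‖ < 1 := by
    have h1 : ∀ᶠ m : ℕ in atTop, ‖Q 0 ^ m‖ < 1 := by
      have := h0.norm
      rw [norm_zero] at this
      exact this.eventually_lt_const one_pos
    exact ((eventually_ge_atTop 1).and h1).exists
  obtain ⟨r, hr, hr1⟩ : ∃ r : ℝ, 0 < r ∧ jetNorm r K (fun u => Q u ^ p) < 1 := by
    have hc : Continuous (fun r : ℝ => jetNorm r K (fun u => Q u ^ p)) := by
      unfold jetNorm; fun_prop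
    -- at radius `0` the jet norm is the norm of the value at `0`
    have h2 : jetNorm 0 K (fun u => Q u ^ p) < 1 := by
      rw [jetNorm, Finset.sum_range_succ']
      simpa using hp
    have h3 := (hc.tendsto 0).eventually_lt_const h2
    have h4 : ∀ᶠ r in 𝓝[>] (0 : ℝ), jetNorm r K (fun u => Q u ^ p) < 1 :=
      h3.filter_mono nhdsWithin_le_nhds
    obtain ⟨r, h5, h6⟩ := (h4.and self_mem_nhdsWithin).exists
    exact ⟨r, h6, h5⟩
  refine ⟨r, hr, ?_⟩
  set θ := jetNorm r K (fun u => Q u ^ p) with hθ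
  have hθ0 : 0 ≤ θ := jetNorm_nonneg hr.le _ _
  set C := ∑ i ∈ Finset.range p, jetNorm r K (fun u => Q u ^ i) with hC
  -- division with remainder by `p` reduces all powers to powers of `Q ^ p`
  have hpow : ∀ (a i : ℕ), i < p → jetNorm r K (fun u => Q u ^ (p * a + i)) ≤ θ ^ a * C := by
    intro a i hi
    induction a with
    | zero =>
      simpa using Finset.single_le_sum (f := fun i => jetNorm r K (fun u => Q u ^ i))
        (fun j _ => jetNorm_nonneg hr.le _ _) (Finset.mem_range.2 hi)
    | succ a ih =>
      have h1 : (fun u => Q u ^ (p * (a + 1) + i)) = fun u => Q u ^ p * Q u ^ (p * a + i) := by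
        funext u; rw [← pow_add]; congr 1; ring
      rw [h1]
      refine (jetNorm_mul_le hr.le K (hQp _) (hQp _)).trans ?_
      rw [pow_succ', mul_assoc]
      exact mul_le_mul_of_nonneg_left ih hθ0
  have hlim : Tendsto (fun m : ℕ => θ ^ (m / p) * C) atTop (𝓝 0) := by
    have h1 : Tendsto (fun m : ℕ => m / p) atTop atTop := Nat.tendsto_div_const_atTop (by omega)
    simpa using ((tendsto_pow_atTop_nhds_zero_of_lt_one hθ0 hr1).comp h1).mul_const C
  refine squeeze_zero (fun m => jetNorm_nonneg hr.le _ _) (fun m => ?_) hlim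
  have := hpow (m / p) (m % p) (Nat.mod_lt _ (by omega))
  rwa [Nat.div_add_mod] at this

variable [CompleteSpace 𝔸]

theorem contDiff_normedSpace_exp : ContDiff ℝ ∞ (NormedSpace.exp : 𝔸 → 𝔸) :=
  contDiff_iff_contDiffAt.2 fun x => (NormedSpace.exp_analytic (𝕂 := ℝ) x).contDiffAt

theorem exists_jetNorm_exp_smul_le {B : ℝ → 𝔸} (hB : ContDiff ℝ ∞ B) (r : ℝ)
    (K : ℕ) : ∃ C : ℝ, ∀ s ∈ Set.Icc (0 : ℝ) 1,
      jetNorm r K (fun u => NormedSpace.exp (s • B u)) ≤ C := by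
  set h : ℝ × ℝ → 𝔸 := fun p => NormedSpace.exp (p.1 • B p.2) with hh
  have hs : ContDiff ℝ ∞ h := by
    refine contDiff_normedSpace_exp.comp (contDiff_fst.smul (hB.comp contDiff_snd))
  have h1 : ∀ (j : ℕ) (s : ℝ), iteratedDeriv j (fun u => NormedSpace.exp (s • B u)) 0 =
      (dirDeriv ((0 : ℝ), (1 : ℝ)))^[j] h (s, 0) := by
    intro j s
    have : (fun u => NormedSpace.exp (s • B u)) =
        fun u : ℝ => h ((s, 0) + u • ((0 : ℝ), (1 : ℝ))) := by funext u; simp [hh]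
    rw [this, hs.iteratedDeriv_line]; simp
  have hc : Continuous (fun s : ℝ => jetNorm r K (fun u => NormedSpace.exp (s • B u))) := by
    simp only [jetNorm, h1]
    refine continuous_finsetSum _ fun j _ => continuous_const.mul (Continuous.norm ?_)
    exact (hs.dirDeriv_iterate _ j).continuous.comp (by fun_prop)
  obtain ⟨C, hC⟩ := (isCompact_Icc (a := (0 : ℝ)) (b := 1)).exists_bound_of_continuousOn
    hc.continuousOn
  exact ⟨C, fun s hs => (le_abs_self _).trans (hC s hs)⟩

theorem exp_smul_mul_of_mul_eq_zero {B P : 𝔸} (h : B * P = 0) (s : ℝ) :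
    NormedSpace.exp (s • B) * P = P := by
  have h1 := (NormedSpace.exp_series_hasSum_exp' (𝕂 := ℝ) (s • B)).mul_right P
  have h2 : ∀ n : ℕ, n ≠ 0 → ((n.factorial : ℝ)⁻¹ • (s • B) ^ n) * P = 0 := by
    intro n hn
    obtain ⟨m, rfl⟩ := Nat.exists_eq_succ_of_ne_zero hn
    rw [pow_succ, smul_mul_assoc, mul_assoc, smul_mul_assoc, h]; simp
  have h3 := h1.unique (hasSum_single 0 h2)
  simpa using h3

theorem mul_exp_smul_of_mul_eq_zero {B P : 𝔸} (h : P * B = 0) (s : ℝ) :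
    P * NormedSpace.exp (s • B) = P := by
  have h1 := (NormedSpace.exp_series_hasSum_exp' (𝕂 := ℝ) (s • B)).mul_left P
  have h2 : ∀ n : ℕ, n ≠ 0 → P * ((n.factorial : ℝ)⁻¹ • (s • B) ^ n) = 0 := by
    intro n hn
    obtain ⟨m, rfl⟩ := Nat.exists_eq_succ_of_ne_zero hn
    rw [pow_succ', mul_smul_comm, ← mul_assoc, mul_smul_comm, h]; simp
  have h3 := h1.unique (hasSum_single 0 h2)
  simpa using h3

/-- For a projection `P` that is annihilated by `B` on both sides, `exp (τ B) - P` is a power of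
`exp B - P` times a bounded factor. -/
theorem exp_smul_sub_eq {B P : 𝔸} (hBP : B * P = 0) (hPB : P * B = 0) (hP : P * P = P) {m : ℕ}
    (hm : 1 ≤ m) (s : ℝ) : NormedSpace.exp (((m : ℝ) + s) • B) - P =
      (NormedSpace.exp B - P) ^ m * NormedSpace.exp (s • B) := by
  have hEP : NormedSpace.exp B * P = P := by simpa using exp_smul_mul_of_mul_eq_zero hBP 1
  have hPE : P * NormedSpace.exp B = P := by simpa using mul_exp_smul_of_mul_eq_zero hPB 1
  have hpow : ∀ k : ℕ, P * NormedSpace.exp B ^ k = P := by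
    intro k
    induction k with
    | zero => simp
    | succ k ih => rw [pow_succ', ← mul_assoc, hPE, ih]
  have h1 : ∀ k : ℕ, (NormedSpace.exp B - P) ^ (k + 1) = NormedSpace.exp B ^ (k + 1) - P := by
    intro k
    induction k with
    | zero => simp
    | succ k ih =>
      rw [pow_succ', ih, sub_mul, mul_sub, mul_sub, hEP, hP, hpow, ← pow_succ']
      abel
  obtain ⟨k, rfl⟩ : ∃ k, m = k + 1 := ⟨m - 1, by omega⟩
  have h2 : NormedSpace.exp ((((k + 1 : ℕ) : ℝ) + s) • B) =
      NormedSpace.exp B ^ (k + 1) * NormedSpace.exp (s • B) := by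
    let _ : NormedAlgebra ℚ 𝔸 := NormedAlgebra.restrictScalars ℚ ℝ 𝔸
    rw [add_smul, NormedSpace.exp_add_of_commute
      (((Commute.refl B).smul_left _).smul_right _), Nat.cast_smul_eq_nsmul,
      NormedSpace.exp_nsmul]
  rw [h1, h2, sub_mul, mul_exp_smul_of_mul_eq_zero hPB]

/-- If `exp (B 0) ^ m` converges to the projection `P 0`, then all `u`-derivatives of
`exp (τ B u)` at `u = 0` converge to those of `P u`. -/
theorem jetTendsto_exp_smul {B P : ℝ → 𝔸} (hB : ContDiff ℝ ∞ B) (hPs : ContDiff ℝ ∞ P)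
    (hBP : ∀ u, B u * P u = 0) (hPB : ∀ u, P u * B u = 0) (hP : ∀ u, P u * P u = P u)
    (h0 : Tendsto (fun m : ℕ => (NormedSpace.exp (B 0) - P 0) ^ m) atTop (𝓝 0)) :
    JetTendsto (fun (τ : ℝ) u => NormedSpace.exp (τ • B u)) atTop P := by
  intro k
  have hQ : ContDiff ℝ ∞ (fun u => NormedSpace.exp (B u) - P u) :=
    (contDiff_normedSpace_exp.comp hB).sub hPs
  have hE : ∀ s : ℝ, ContDiff ℝ ∞ (fun u => NormedSpace.exp (s • B u)) := fun s =>
    contDiff_normedSpace_exp.comp (hB.const_smul s)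
  obtain ⟨r, hr, hlim⟩ := exists_tendsto_jetNorm_pow hQ h0 k
  obtain ⟨C, hC⟩ := exists_jetNorm_exp_smul_le hB r k
  rw [tendsto_iff_norm_sub_tendsto_zero]
  -- split `τ` into its integer part, which gives the decay, and its bounded fractional part
  have hlim2 : Tendsto (fun τ : ℝ => (k.factorial : ℝ) / r ^ k *
      (jetNorm r k (fun u => (NormedSpace.exp (B u) - P u) ^ ⌊τ⌋₊) * C)) atTop (𝓝 0) := by
    simpa using ((hlim.comp tendsto_nat_floor_atTop).mul_const C).const_mul
      ((k.factorial : ℝ) / r ^ k)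
  refine squeeze_zero' (Eventually.of_forall fun _ => norm_nonneg _) ?_ hlim2
  filter_upwards [eventually_ge_atTop (1 : ℝ)] with τ hτ
  have hm : 1 ≤ ⌊τ⌋₊ := Nat.one_le_floor_iff τ |>.2 hτ
  have hfl := Nat.floor_le (show 0 ≤ τ by linarith)
  have hfl2 := Nat.lt_floor_add_one τ
  have h1 : iteratedDeriv k (fun u => NormedSpace.exp (τ • B u)) 0 - iteratedDeriv k P 0 =
      iteratedDeriv k (fun u => (NormedSpace.exp (B u) - P u) ^ ⌊τ⌋₊ *
        NormedSpace.exp ((τ - ⌊τ⌋₊) • B u)) 0 := by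
    rw [← iteratedDeriv_fun_sub ((hE τ).natCast_contDiffAt k 0) (hPs.natCast_contDiffAt k 0)]
    congr 1
    funext u
    rw [← exp_smul_sub_eq (hBP u) (hPB u) (hP u) hm]
    congr 3; ring
  rw [h1]
  refine (norm_iteratedDeriv_le_jetNorm hr le_rfl _).trans ?_
  refine mul_le_mul_of_nonneg_left ?_ (by positivity)
  refine (jetNorm_mul_le hr.le k (hQ.pow _) (hE _)).trans ?_
  exact mul_le_mul_of_nonneg_left (hC _ ⟨by linarith, by linarith⟩) (jetNorm_nonneg hr.le _ _)

end Jets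

/-! ### Perron–Frobenius theory -/

section PerronFrobenius

set_option linter.unusedSectionVars false

open scoped Matrix Matrix.Norms.Operator

variable {S : Type*} [Fintype S] [DecidableEq S]

/-- Irreducible Metzler matrices: the off-diagonal entries are nonnegative and their nonzero
pattern is strongly connected; no condition on the diagonal. -/
structure IsIrredMetzler (L : Matrix S S ℝ) : Prop where
  nonneg : ∀ x y, x ≠ y → 0 ≤ L x y
  conn : ∀ x y, Relation.ReflTransGen (fun u v => u ≠ v ∧ L u v ≠ 0) x y

theorem IsIrredMetzler.transpose {L : Matrix S S ℝ} (hL : IsIrredMetzler L) :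
    IsIrredMetzler Lᵀ where
  nonneg x y h := hL.nonneg y x h.symm
  conn x y := by
    refine Relation.ReflTransGen.mono (fun u v h => ?_) _ _ (hL.conn y x).swap
    exact ⟨h.1.symm, h.2⟩

theorem IsIrredMetzler.sub_smul_one {L : Matrix S S ℝ} (hL : IsIrredMetzler L) (c : ℝ) :
    IsIrredMetzler (L - c • (1 : Matrix S S ℝ)) where
  nonneg x y h := by simpa [Matrix.one_apply, h] using hL.nonneg x y h
  conn x y := Relation.ReflTransGen.mono
    (fun u v h => ⟨h.1, by simpa [Matrix.one_apply, h.1] using h.2⟩) _ _ (hL.conn x y)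

theorem pow_apply_nonneg {A : Matrix S S ℝ} (hA : ∀ x y, 0 ≤ A x y) (n : ℕ) (x y : S) :
    0 ≤ (A ^ n) x y := by
  induction n generalizing x y with
  | zero => rw [pow_zero, Matrix.one_apply]; split_ifs <;> simp
  | succ n ih =>
    rw [pow_succ, Matrix.mul_apply]
    exact Finset.sum_nonneg fun z _ => mul_nonneg (ih x z) (hA z y)

/-- After a shift of the diagonal the entries are nonnegative, and every entry is positive in some
term of the exponential series. -/
theorem IsIrredMetzler.exp_apply_pos {L : Matrix S S ℝ} (hL : IsIrredMetzler L) (x y : S) :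
    0 < NormedSpace.exp L x y := by
  -- shift the diagonal so that all entries are nonnegative
  set c : ℝ := ∑ z, |L z z| with hc
  set A : Matrix S S ℝ := L + c • (1 : Matrix S S ℝ) with hA
  have hA0 : ∀ x y, 0 ≤ A x y := by
    intro x y
    by_cases h : x = y
    · subst h
      have h1 : |L x x| ≤ c :=
        Finset.single_le_sum (f := fun z => |L z z|) (fun z _ => abs_nonneg _) (Finset.mem_univ x)
      have h2 := neg_abs_le (L x x)
      simp [hA]; linarith
    · simpa [hA, Matrix.one_apply, h] using hL.nonneg x y h
  have hApow : ∃ n, 0 < (A ^ n) x y := by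
    induction hL.conn x y with
    | refl => exact ⟨0, by simp⟩
    | @tail u v _ huv ih =>
      obtain ⟨n, hn⟩ := ih
      refine ⟨n + 1, ?_⟩
      rw [pow_succ, Matrix.mul_apply]
      refine lt_of_lt_of_le ?_ (Finset.single_le_sum (f := fun z => (A ^ n) x z * A z v)
        (fun z _ => mul_nonneg (pow_apply_nonneg hA0 n x z) (hA0 z v)) (Finset.mem_univ u))
      refine mul_pos hn (lt_of_le_of_ne (hA0 u v) (Ne.symm ?_))
      simpa [hA, Matrix.one_apply, huv.1] using huv.2
  have hexpA : 0 < NormedSpace.exp A x y := by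
    obtain ⟨n, hn⟩ := hApow
    have h1 := (NormedSpace.exp_series_hasSum_exp' (𝕂 := ℝ) A)
    have h2 : HasSum (fun n => ((n.factorial : ℝ)⁻¹ • A ^ n) x y) (NormedSpace.exp A x y) :=
      h1.map (Matrix.entryAddMonoidHom ℝ x y) (by
        exact (continuous_apply y).comp (continuous_apply x))
    refine lt_of_lt_of_le ?_ (le_hasSum h2 n fun m _ => ?_)
    · simp only [Matrix.smul_apply, smul_eq_mul]; positivity
    · have := pow_apply_nonneg hA0 m x y
      simp only [Matrix.smul_apply, smul_eq_mul]; positivity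
  have h3 : NormedSpace.exp L = Real.exp (-c) • NormedSpace.exp A := by
    have h4 : L = A + (-c) • (1 : Matrix S S ℝ) := by simp [hA]
    conv_lhs => rw [h4]
    rw [Matrix.exp_add_of_commute _ _ ((Commute.one_right A).smul_right _)]
    have h5 : NormedSpace.exp ((-c) • (1 : Matrix S S ℝ)) = Real.exp (-c) • 1 := by
      rw [← Algebra.algebraMap_eq_smul_one, ← Algebra.algebraMap_eq_smul_one,
        Real.exp_eq_exp_ℝ]
      exact (NormedSpace.algebraMap_exp_comm (𝔸 := Matrix S S ℝ) (-c)).symm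
    rw [h5]; simp
  rw [h3, Matrix.smul_apply, smul_eq_mul]
  exact mul_pos (Real.exp_pos _) hexpA

theorem exp_mulVec_of_eigenvector {L : Matrix S S ℝ} {v : S → ℝ} {c : ℝ} (h : L *ᵥ v = c • v) :
    NormedSpace.exp L *ᵥ v = Real.exp c • v := by
  have hpow : ∀ n : ℕ, (L ^ n) *ᵥ v = c ^ n • v := by
    intro n
    induction n with
    | zero => simp
    | succ n ih => rw [pow_succ, ← Matrix.mulVec_mulVec, h, Matrix.mulVec_smul, ih, smul_smul,
        pow_succ, mul_comm]
  have h1 := (NormedSpace.exp_series_hasSum_exp' (𝕂 := ℝ) L)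
  have h2 : HasSum (fun n : ℕ => ((n.factorial : ℝ)⁻¹ • L ^ n) *ᵥ v) (NormedSpace.exp L *ᵥ v) :=
    h1.map (⟨⟨fun M : Matrix S S ℝ => M *ᵥ v, by simp⟩, fun M N => Matrix.add_mulVec M N v⟩ :
      Matrix S S ℝ →+ (S → ℝ)) (by
        exact Continuous.matrix_mulVec continuous_id continuous_const)
  have h3 := (NormedSpace.exp_series_hasSum_exp' (𝕂 := ℝ) c).smul_const v
  rw [Real.exp_eq_exp_ℝ]
  refine h2.unique (h3.congr_fun ?_)
  intro n
  simp [Matrix.smul_mulVec, hpow, smul_smul]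

theorem mulVec_pos_of_nonneg {Y : Matrix S S ℝ} (hY : ∀ x y, 0 < Y x y) {v : S → ℝ}
    (hv : ∀ x, 0 ≤ v x) (hv' : v ≠ 0) (x : S) : 0 < (Y *ᵥ v) x := by
  obtain ⟨y, hy⟩ := Function.ne_iff.1 hv'
  refine lt_of_lt_of_le (mul_pos (hY x y) (lt_of_le_of_ne (hv y) (Ne.symm hy)))
    (Finset.single_le_sum (f := fun y => Y x y * v y)
      (fun z _ => mul_nonneg (hY x z).le (hv z)) (Finset.mem_univ y))

variable [Nonempty S]

/-- Perron's theorem, by maximizing the Collatz–Wielandt quotient of `Y *ᵥ r` over the simplex. -/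
theorem exists_pos_eigenvector {Y : Matrix S S ℝ} (hY : ∀ x y, 0 < Y x y) :
    ∃ (t : ℝ) (v : S → ℝ), (∀ x, 0 < v x) ∧ Y *ᵥ v = t • v := by
  have hpos : ∀ r ∈ stdSimplex ℝ S, ∀ x, 0 < (Y *ᵥ r) x := by
    intro r hr x
    refine mulVec_pos_of_nonneg hY hr.1 ?_ x
    rintro rfl
    simpa using hr.2
  -- use `Y *ᵥ r` instead of `r`, since it is positive also at the boundary of the simplex
  set φ : (S → ℝ) → ℝ := fun r => Finset.univ.inf' Finset.univ_nonempty
    (fun x => (Y *ᵥ (Y *ᵥ r)) x / (Y *ᵥ r) x) with hφ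
  have hcont : ContinuousOn φ (stdSimplex ℝ S) := by
    refine ContinuousOn.finset_inf'_apply _ fun x _ => ContinuousOn.div ?_ ?_ fun r hr =>
      (hpos r hr x).ne'
    · exact (by fun_prop : Continuous fun r : S → ℝ => (Y *ᵥ (Y *ᵥ r)) x).continuousOn
    · exact (by fun_prop : Continuous fun r : S → ℝ => (Y *ᵥ r) x).continuousOn
  have hne : (stdSimplex ℝ S).Nonempty :=
    ⟨_, single_mem_stdSimplex ℝ (Classical.arbitrary S)⟩
  obtain ⟨r, hr, hmax⟩ := (isCompact_stdSimplex ℝ S).exists_isMaxOn hne hcont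
  set v := Y *ᵥ r with hv
  have hvpos := hpos r hr
  refine ⟨φ r, v, hvpos, ?_⟩
  by_contra hne
  -- if `Y *ᵥ v` exceeds `φ r • v` anywhere, one more application of `Y` improves the quotient
  have hle : ∀ x, φ r * v x ≤ (Y *ᵥ v) x := by
    intro x
    have : φ r ≤ (Y *ᵥ v) x / v x := Finset.inf'_le _ (Finset.mem_univ x)
    rwa [le_div_iff₀ (hvpos x)] at this
  have hstrict : ∀ x, φ r * (Y *ᵥ v) x < (Y *ᵥ (Y *ᵥ v)) x := by
    intro x
    have h1 := mulVec_pos_of_nonneg hY (v := Y *ᵥ v - φ r • v)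
      (fun x => by simpa using hle x) (fun h => hne (sub_eq_zero.1 h)) x
    rw [Matrix.mulVec_sub, Matrix.mulVec_smul] at h1
    simpa using h1
  set s : ℝ := ∑ x, v x with hs
  have hspos : 0 < s := Finset.sum_pos (fun x _ => hvpos x) Finset.univ_nonempty
  set r' : S → ℝ := s⁻¹ • v with hr'
  have hr'mem : r' ∈ stdSimplex ℝ S := by
    refine ⟨fun x => ?_, ?_⟩
    · have := hvpos x
      simp only [hr', Pi.smul_apply, smul_eq_mul]; positivity
    · simp only [hr', Pi.smul_apply, smul_eq_mul, ← Finset.mul_sum]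
      exact inv_mul_cancel₀ hspos.ne'
  have h1 : φ r < φ r' := by
    refine (Finset.lt_inf'_iff _).2 fun x _ => ?_
    have h2 : 0 < (Y *ᵥ r') x := hpos r' hr'mem x
    rw [lt_div_iff₀ h2]
    simp only [hr', Matrix.mulVec_smul, Pi.smul_apply, smul_eq_mul]
    have := hstrict x
    have h3 : 0 < s⁻¹ := by positivity
    nlinarith
  exact absurd (hmax hr'mem) (not_le.2 h1)

/-- Subtract from `w` the largest multiple of `v` that leaves a nonnegative vector; this vector has a
zero, so the positivity of `Y` forces it to vanish. -/
theorem eigenvector_unique {Y : Matrix S S ℝ} (hY : ∀ x y, 0 < Y x y) {t : ℝ} {v w : S → ℝ}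
    (hv : ∀ x, 0 < v x) (hYv : Y *ᵥ v = t • v) (hYw : Y *ᵥ w = t • w) : ∃ c : ℝ, w = c • v := by
  obtain ⟨x, hx⟩ := Finite.exists_min (fun x => w x / v x)
  refine ⟨w x / v x, ?_⟩
  by_contra hne
  have h1 := mulVec_pos_of_nonneg hY (v := w - (w x / v x) • v) (fun y => by
    have := hx y
    rw [le_div_iff₀ (hv y)] at this
    simpa using this) (fun h => hne (sub_eq_zero.1 h)) x
  rw [Matrix.mulVec_sub, Matrix.mulVec_smul, hYv, hYw] at h1
  have := (hv x).ne'
  simp at h1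
  field_simp at h1
  simp at h1

theorem IsIrredMetzler.exists_eigenvector {L : Matrix S S ℝ} (hL : IsIrredMetzler L) :
    ∃ (c : ℝ) (v : S → ℝ), (∀ x, 0 < v x) ∧ L *ᵥ v = c • v := by
  obtain ⟨t, v, hv, hYv⟩ := exists_pos_eigenvector hL.exp_apply_pos
  have h1 : NormedSpace.exp L *ᵥ (L *ᵥ v) = t • (L *ᵥ v) := by
    have hc : Commute (NormedSpace.exp L) L := (Commute.refl L).exp_left
    rw [Matrix.mulVec_mulVec, hc.eq, ← Matrix.mulVec_mulVec, hYv, Matrix.mulVec_smul]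
  obtain ⟨c, hc⟩ := eigenvector_unique hL.exp_apply_pos hv hYv h1
  exact ⟨c, v, hv, hc⟩

theorem dotProduct_pos {v w : S → ℝ} (hv : ∀ x, 0 < v x) (hw : ∀ x, 0 < w x) : 0 < v ⬝ᵥ w :=
  Finset.sum_pos (fun x _ => mul_pos (hv x) (hw x)) Finset.univ_nonempty

/-- A right and a left positive eigenvector have the same eigenvalue. -/
theorem eigenvalue_eq {L : Matrix S S ℝ} {v l : S → ℝ} {c c' : ℝ} (hv : ∀ x, 0 < v x)
    (hl : ∀ x, 0 < l x) (h : L *ᵥ v = c • v) (h' : l ᵥ* L = c' • l) : c = c' := by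
  have h1 : l ⬝ᵥ (L *ᵥ v) = (l ᵥ* L) ⬝ᵥ v := Matrix.dotProduct_mulVec l L v
  rw [h, h', dotProduct_smul, smul_dotProduct] at h1
  exact mul_right_cancel₀ (dotProduct_pos hl hv).ne' h1

theorem IsIrredMetzler.exists_left_eigenvector {L : Matrix S S ℝ} (hL : IsIrredMetzler L) :
    ∃ (c : ℝ) (l : S → ℝ), (∀ x, 0 < l x) ∧ l ᵥ* L = c • l := by
  obtain ⟨c, l, hl, h⟩ := hL.transpose.exists_eigenvector
  exact ⟨c, l, hl, by rwa [Matrix.mulVec_transpose] at h⟩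

theorem IsIrredMetzler.eigenvector_unique {L : Matrix S S ℝ} (hL : IsIrredMetzler L)
    {v w : S → ℝ} {c c' : ℝ} (hv : ∀ x, 0 < v x) (hw : ∀ x, 0 < w x) (h : L *ᵥ v = c • v)
    (h' : L *ᵥ w = c' • w) : c = c' ∧ ∃ a : ℝ, w = a • v := by
  obtain ⟨d, l, hl, hd⟩ := hL.exists_left_eigenvector
  have h1 : c = c' := (eigenvalue_eq hv hl h hd).trans (eigenvalue_eq hw hl h' hd).symm
  subst h1
  exact ⟨rfl, _root_.eigenvector_unique hL.exp_apply_pos hv (exp_mulVec_of_eigenvector h)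
    (exp_mulVec_of_eigenvector h')⟩

/-- The projection with range spanned by `r` and kernel `l^⊥`. -/
noncomputable def perronProj (l r : S → ℝ) : Matrix S S ℝ := (l ⬝ᵥ r)⁻¹ • Matrix.vecMulVec r l

theorem mul_perronProj {B : Matrix S S ℝ} {l r : S → ℝ} (h : B *ᵥ r = 0) :
    B * perronProj l r = 0 := by
  rw [perronProj, Matrix.mul_smul, Matrix.mul_vecMulVec, h]; simp

theorem perronProj_mul {B : Matrix S S ℝ} {l r : S → ℝ} (h : l ᵥ* B = 0) :
    perronProj l r * B = 0 := by
  rw [perronProj, Matrix.smul_mul, Matrix.vecMulVec_mul, h]; simp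

theorem perronProj_mul_self {l r : S → ℝ} (hl : ∀ x, 0 < l x) (hr : ∀ x, 0 < r x) :
    perronProj l r * perronProj l r = perronProj l r := by
  have := (dotProduct_pos hl hr).ne'
  rw [perronProj, Matrix.smul_mul, Matrix.mul_smul, Matrix.vecMulVec_mul_vecMulVec, smul_smul,
    Matrix.vecMulVec_smul, smul_smul]
  congr 1
  field_simp

/-- A Doeblin argument: `exp B` dominates a multiple of its Perron projection. -/
theorem IsIrredMetzler.tendsto_exp_sub_pow {B : Matrix S S ℝ} (hB : IsIrredMetzler B)
    {l r : S → ℝ} (hl : ∀ x, 0 < l x) (hr : ∀ x, 0 < r x) (hBr : B *ᵥ r = 0)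
    (hlB : l ᵥ* B = 0) :
    Tendsto (fun m : ℕ => (NormedSpace.exp B - perronProj l r) ^ m) atTop (𝓝 0) := by
  set Y := NormedSpace.exp B with hYdef
  set P := perronProj l r with hPdef
  have hYpos : ∀ x y, 0 < Y x y := hB.exp_apply_pos
  have hYP : Y * P = P := by
    have := exp_smul_mul_of_mul_eq_zero (mul_perronProj (l := l) hBr) 1
    rwa [one_smul] at this
  have hPY : P * Y = P := by
    have := mul_exp_smul_of_mul_eq_zero (perronProj_mul (r := r) hlB) 1
    rwa [one_smul] at this
  have hPP : P * P = P := perronProj_mul_self hl hr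
  have hPr : P *ᵥ r = r := by
    have := (dotProduct_pos hl hr).ne'
    rw [hPdef, perronProj, Matrix.smul_mulVec, Matrix.vecMulVec_mulVec]
    ext x; simp; field_simp
  have hYr : Y *ᵥ r = r := by
    have := exp_mulVec_of_eigenvector (L := B) (v := r) (c := 0) (by simpa using hBr)
    simpa using this
  -- `N = Y - θ P` is nonnegative and contracts the positive vector `r`
  obtain ⟨θ, hθ0, hθ1, hθ⟩ : ∃ θ : ℝ, 0 < θ ∧ θ < 1 ∧ ∀ x y, θ * P x y < Y x y := by
    have h1 : ∀ x y, ∀ᶠ θ : ℝ in 𝓝[>] 0, θ * P x y < Y x y := fun x y => by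
      have : Tendsto (fun θ : ℝ => θ * P x y) (𝓝 0) (𝓝 (0 * P x y)) :=
        tendsto_id.mul_const _
      rw [zero_mul] at this
      exact (this.eventually_lt_const (hYpos x y)).filter_mono nhdsWithin_le_nhds
    have h2 : ∀ᶠ θ : ℝ in 𝓝[>] 0, ∀ x y, θ * P x y < Y x y :=
      eventually_all.2 fun x => eventually_all.2 fun y => h1 x y
    have h3 : ∀ᶠ θ : ℝ in 𝓝[>] 0, θ < 1 :=
      (eventually_lt_nhds one_pos).filter_mono nhdsWithin_le_nhds
    obtain ⟨θ, h4, h5, h6⟩ := (h2.and (h3.and self_mem_nhdsWithin)).exists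
    exact ⟨θ, h6, h5, h4⟩
  set N := Y - θ • P with hN
  have hN0 : ∀ x y, 0 ≤ N x y := fun x y => by simpa [hN] using (hθ x y).le
  have hNr : N *ᵥ r = (1 - θ) • r := by
    rw [hN, Matrix.sub_mulVec, Matrix.smul_mulVec, hPr, hYr, sub_smul, one_smul]
  have hNpow : ∀ m : ℕ, (N ^ m) *ᵥ r = (1 - θ) ^ m • r := by
    intro m
    induction m with
    | zero => simp
    | succ m ih => rw [pow_succ, ← Matrix.mulVec_mulVec, hNr, Matrix.mulVec_smul, ih, smul_smul,
        pow_succ, mul_comm]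
  have hNlim : Tendsto (fun m : ℕ => N ^ m) atTop (𝓝 0) := by
    refine tendsto_pi_nhds.2 fun x => tendsto_pi_nhds.2 fun y => ?_
    have h1 : Tendsto (fun m : ℕ => (1 - θ) ^ m * (r x / r y)) atTop (𝓝 0) := by
      simpa using (tendsto_pow_atTop_nhds_zero_of_lt_one (by linarith) (by linarith)).mul_const
        (r x / r y)
    refine squeeze_zero (fun m => pow_apply_nonneg hN0 m x y) (fun m => ?_) h1
    rw [← mul_div_assoc, le_div_iff₀ (hr y)]
    have h2 := congrFun (hNpow m) x
    simp only [Pi.smul_apply, smul_eq_mul] at h2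
    rw [← h2]
    exact Finset.single_le_sum (f := fun y => (N ^ m) x y * r y)
      (fun z _ => mul_nonneg (pow_apply_nonneg hN0 m x z) (hr z).le) (Finset.mem_univ y)
  -- `Y - P` is `N` on the range of the complementary projection
  have hNP : N * P = (1 - θ) • P := by
    rw [hN, sub_mul, smul_mul_assoc, hYP, hPP, sub_smul, one_smul]
  have hPN : P * N = (1 - θ) • P := by
    rw [hN, mul_sub, mul_smul_comm, hPY, hPP, sub_smul, one_smul]
  have hcomm : Commute N (1 - P) := (Commute.one_right N).sub_right (hNP.trans hPN.symm)
  have hfac : Y - P = N * (1 - P) := by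
    rw [mul_sub, mul_one, hNP, hN, sub_smul, one_smul]; abel
  have hidem : IsIdempotentElem (1 - P) := IsIdempotentElem.one_sub hPP
  rw [← tendsto_add_atTop_iff_nat 1]
  have h2 : ∀ m : ℕ, (Y - P) ^ (m + 1) = N ^ (m + 1) * (1 - P) := fun m => by
    rw [hfac, hcomm.mul_pow, hidem.pow_succ_eq]
  simp only [h2]
  simpa using ((tendsto_add_atTop_iff_nat 1).2 hNlim).mul_const (1 - P)

/-- The positive right eigenvector of an irreducible Metzler matrix, with average entry `1`. -/
noncomputable def perronVec (L : Matrix S S ℝ) : S → ℝ :=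
  Classical.epsilon fun r : S → ℝ =>
    (∀ x, 0 < r x) ∧ ∑ x, r x = Fintype.card S ∧ ∃ c : ℝ, L *ᵥ r = c • r

theorem IsIrredMetzler.perronVec_spec {L : Matrix S S ℝ} (hL : IsIrredMetzler L) :
    (∀ x, 0 < perronVec L x) ∧ ∑ x, perronVec L x = Fintype.card S ∧
      ∃ c : ℝ, L *ᵥ perronVec L = c • perronVec L := by
  refine Classical.epsilon_spec (p := fun r : S → ℝ =>
    (∀ x, 0 < r x) ∧ ∑ x, r x = Fintype.card S ∧ ∃ c : ℝ, L *ᵥ r = c • r) ?_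
  obtain ⟨c, v, hv, h⟩ := hL.exists_eigenvector
  have hs : 0 < ∑ x, v x := Finset.sum_pos (fun x _ => hv x) Finset.univ_nonempty
  have hcard : (0 : ℝ) < Fintype.card S := by exact_mod_cast Fintype.card_pos
  refine ⟨(Fintype.card S / ∑ x, v x : ℝ) • v, fun x => ?_, ?_, c, ?_⟩
  · have := hv x
    simp only [Pi.smul_apply, smul_eq_mul]; positivity
  · simp only [Pi.smul_apply, smul_eq_mul, ← Finset.mul_sum]
    field_simp
  · rw [Matrix.mulVec_smul, h, smul_comm]

theorem IsIrredMetzler.eq_perronVec {L : Matrix S S ℝ} (hL : IsIrredMetzler L) {r : S → ℝ}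
    {c : ℝ} (hr : ∀ x, 0 < r x) (hsum : ∑ x, r x = Fintype.card S) (h : L *ᵥ r = c • r) :
    r = perronVec L := by
  obtain ⟨h1, h2, c', h3⟩ := hL.perronVec_spec
  obtain ⟨-, a, ha⟩ := hL.eigenvector_unique h1 hr h3 h
  have hcard : (0 : ℝ) < Fintype.card S := by exact_mod_cast Fintype.card_pos
  have ha1 : a = 1 := by
    rw [ha] at hsum
    simp only [Pi.smul_apply, smul_eq_mul, ← Finset.mul_sum, h2] at hsum
    exact mul_right_cancel₀ hcard.ne' (hsum.trans (one_mul _).symm)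
  rw [ha, ha1, one_smul]

/-- The Perron vector depends smoothly on parameters, by the implicit function theorem for the
equations `L r = c r`, `∑ r = |S|` in the unknowns `(r, c)`. -/
theorem contDiff_perronVec {X : Type*} [NormedAddCommGroup X] [NormedSpace ℝ X] [CompleteSpace X]
    {L : X → Matrix S S ℝ} (hLs : ∀ x y, ContDiff ℝ ∞ (fun p => L p x y))
    (hL : ∀ p, IsIrredMetzler (L p)) : ContDiff ℝ ∞ (fun p => perronVec (L p)) := by
  rw [contDiff_iff_contDiffAt]
  intro p₀
  obtain ⟨hr, hsum, c, hc⟩ := (hL p₀).perronVec_spec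
  obtain ⟨c', l, hl, hlc⟩ := (hL p₀).exists_left_eigenvector
  obtain rfl := eigenvalue_eq hr hl hc hlc
  set r := perronVec (L p₀) with hrdef
  set f : X × ((S → ℝ) × ℝ) → (S → ℝ) × ℝ := fun q =>
    (fun x => (∑ y, L q.1 x y * q.2.1 y) - q.2.2 * q.2.1 x, ∑ x, q.2.1 x - Fintype.card S) with hf
  have hcoord : ∀ y : S, ContDiff ℝ ∞ (fun q : X × ((S → ℝ) × ℝ) => q.2.1 y) := fun y =>
    (contDiff_apply ℝ ℝ y).comp (contDiff_fst.comp contDiff_snd)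
  have hfs : ContDiff ℝ ∞ f := by
    refine ContDiff.prodMk (contDiff_pi.2 fun x => ContDiff.sub (ContDiff.sum fun y _ => ?_) ?_)
      (ContDiff.sub (ContDiff.sum fun y _ => hcoord y) contDiff_const)
    · exact ((hLs x y).comp contDiff_fst).mul (hcoord y)
    · exact (contDiff_snd.comp contDiff_snd).mul (hcoord x)
  set u : X × ((S → ℝ) × ℝ) := (p₀, (r, c)) with hu
  have hfu : f u = 0 := by
    have : ∀ x, ∑ y, L p₀ x y * r y = c * r x := fun x => congrFun hc x
    simp only [hf, hu, this, hsum, sub_self]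
    rfl
  have hinr : ∀ e : (S → ℝ) × ℝ, fderiv ℝ f u (0, e) =
      (fun x => (∑ y, L p₀ x y * e.1 y) - c * e.1 x - e.2 * r x, ∑ x, e.1 x) := by
    intro e
    have h1 := hfs.hasDerivAt_line u (0, e) 0
    simp only [zero_smul, add_zero] at h1
    refine h1.unique ?_
    refine HasDerivAt.prodMk (hasDerivAt_pi.2 fun x => ?_) ?_
    · simp only [hu, Prod.smul_mk, Prod.mk_add_mk, smul_zero, add_zero, Prod.fst_add,
        Prod.smul_fst, Prod.snd_add, Prod.smul_snd, Pi.add_apply, Pi.smul_apply, smul_eq_mul]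
      have h2 : ∀ y, HasDerivAt (fun t : ℝ => r y + t * e.1 y) (e.1 y) 0 := fun y => by
        simpa using ((hasDerivAt_id (0 : ℝ)).mul_const (e.1 y)).const_add (r y)
      have h3 : HasDerivAt (fun t : ℝ => c + t * e.2) e.2 0 := by
        simpa using ((hasDerivAt_id (0 : ℝ)).mul_const e.2).const_add c
      refine ((HasDerivAt.fun_sum fun y _ => (h2 y).const_mul (L p₀ x y)).sub
        (h3.mul (h2 x))).congr_deriv ?_
      simp; ring
    · simp only [hu, Prod.smul_mk, Prod.mk_add_mk, smul_zero, add_zero, Prod.fst_add,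
        Prod.smul_fst, Pi.add_apply, Pi.smul_apply, smul_eq_mul]
      have h2 : ∀ y, HasDerivAt (fun t : ℝ => r y + t * e.1 y) (e.1 y) 0 := fun y => by
        simpa using ((hasDerivAt_id (0 : ℝ)).mul_const (e.1 y)).const_add (r y)
      exact (HasDerivAt.fun_sum fun y _ => h2 y).sub_const _
  -- the linearization is injective: pairing with `l` shows that the eigenvalue does not move, and
  -- then the eigenvector is fixed by simplicity and by the normalization
  have hinj : Function.Injective (fderiv ℝ f u ∘L .inr ℝ X ((S → ℝ) × ℝ)) := by
    rw [injective_iff_map_eq_zero]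
    rintro ⟨ρ, μ⟩ h
    simp only [ContinuousLinearMap.coe_comp, Function.comp_apply, ContinuousLinearMap.inr_apply,
      hinr, Prod.mk_eq_zero] at h
    obtain ⟨h1, h2⟩ := h
    have h3 : L p₀ *ᵥ ρ = c • ρ + μ • r := by
      ext x
      have := congrFun h1 x
      simp only [Pi.zero_apply] at this
      change ∑ y, L p₀ x y * ρ y = c * ρ x + μ * r x
      linarith
    have h4 : μ = 0 := by
      have h5 := Matrix.dotProduct_mulVec l (L p₀) ρ
      rw [h3, hlc, dotProduct_add, dotProduct_smul, dotProduct_smul, smul_dotProduct] at h5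
      have h6 := (dotProduct_pos hl hr).ne'
      simpa [h6] using h5
    subst h4
    rw [zero_smul, add_zero] at h3
    obtain ⟨a, ha⟩ := _root_.eigenvector_unique (hL p₀).exp_apply_pos hr
      (exp_mulVec_of_eigenvector hc) (exp_mulVec_of_eigenvector h3)
    have hcard : (Fintype.card S : ℝ) ≠ 0 := by exact_mod_cast Fintype.card_ne_zero
    have h7 : a = 0 := by
      rw [ha] at h2
      simp only [Pi.smul_apply, smul_eq_mul, ← Finset.mul_sum, hsum] at h2
      simpa [hcard] using h2
    simp [ha, h7]
  have hinv : (fderiv ℝ f u ∘L .inr ℝ X ((S → ℝ) × ℝ)).IsInvertible := by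
    refine ⟨(LinearEquiv.ofInjectiveEndo
      (fderiv ℝ f u ∘L .inr ℝ X ((S → ℝ) × ℝ) : (S → ℝ) × ℝ →L[ℝ] (S → ℝ) × ℝ).toLinearMap
      hinj).toContinuousLinearEquiv, ?_⟩
    exact ContinuousLinearMap.ext fun _ => rfl
  have hcd : ContDiffAt ℝ ∞ f u := hfs.contDiffAt
  set ψ := hcd.implicitFunction (by simp) hinv with hψ
  have hψs : ContDiffAt ℝ ∞ ψ p₀ := hcd.contDiffAt_implicitFunction (by simp) hinv
  have hψ0 : ψ p₀ = (r, c) := hcd.implicitFunction_apply_self (by simp) hinv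
  have hev : ∀ᶠ p in 𝓝 p₀, f (p, ψ p) = f u :=
    hcd.eventually_apply_implicitFunction (by simp) hinv
  have hposev : ∀ᶠ p in 𝓝 p₀, ∀ x, 0 < (ψ p).1 x := by
    refine eventually_all.2 fun x => ?_
    have h1 : Tendsto (fun p => (ψ p).1 x) (𝓝 p₀) (𝓝 ((ψ p₀).1 x)) :=
      ((continuous_apply x).comp continuous_fst).continuousAt.comp hψs.continuousAt
    rw [hψ0] at h1
    exact h1.eventually_const_lt (hr x)
  have hfst : ContDiffAt ℝ ∞ (fun p => (ψ p).1) p₀ := contDiffAt_fst.comp p₀ hψs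
  refine hfst.congr_of_eventuallyEq ?_
  filter_upwards [hev, hposev] with p hp hpos
  rw [hfu] at hp
  simp only [hf, Prod.mk_eq_zero] at hp
  refine ((hL p).eq_perronVec (c := (ψ p).2) hpos (by linarith [hp.2]) ?_).symm
  ext x
  have := congrFun hp.1 x
  simp only [Pi.zero_apply] at this
  change ∑ y, L p x y * (ψ p).1 y = (ψ p).2 * (ψ p).1 x
  linarith

end PerronFrobenius

/-! ### Path integrals -/

section PathIntegrals

set_option linter.unusedSectionVars false

open MeasureTheory

theorem measurable_intervalIntegral_left {P : Type*} [MeasurableSpace P] (b : ℝ) {a : P → ℝ}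
    (ha : Measurable a) {h : P × ℝ → ℝ} (hh : Measurable h) :
    Measurable fun p => ∫ s in (a p)..b, h (p, s) := by
  have key : ∀ T : Set (P × ℝ), MeasurableSet T →
      Measurable fun p => ∫ s in {s | (p, s) ∈ T}, h (p, s) := by
    intro T hT
    have h1 : ∀ p, ∫ s in {s | (p, s) ∈ T}, h (p, s) = ∫ s, T.indicator h (p, s) := by
      intro p
      exact (integral_indicator (measurable_prodMk_left (x := p) hT)).symm
    simp only [h1]
    exact ((hh.indicator hT).stronglyMeasurable.integral_prod_right').measurable
  have h1 : MeasurableSet {q : P × ℝ | a q.1 < q.2 ∧ q.2 ≤ b} :=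
    (measurableSet_lt (ha.comp measurable_fst) measurable_snd).inter
      (measurableSet_le measurable_snd measurable_const)
  have h2 : MeasurableSet {q : P × ℝ | b < q.2 ∧ q.2 ≤ a q.1} :=
    (measurableSet_lt measurable_const measurable_snd).inter
      (measurableSet_le measurable_snd (ha.comp measurable_fst))
  exact (key _ h1).sub (key _ h2)

theorem measurable_fin_cons {P : Type*} [MeasurableSpace P] {n : ℕ} {s : P → ℝ}
    {t : P → Fin n → ℝ} (hs : Measurable s) (ht : Measurable t) :
    Measurable fun p => (Fin.cons (α := fun _ => ℝ) (s p) (t p) : Fin (n + 1) → ℝ) := by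
  refine measurable_pi_iff.2 fun i => ?_
  refine Fin.cases ?_ (fun j => ?_) i
  · simpa using hs
  · simpa using measurable_pi_iff.1 ht j

theorem measurable_orderedIntegral {P : Type*} [MeasurableSpace P] (b : ℝ) (n : ℕ) {a : P → ℝ}
    (ha : Measurable a) {g : P × (Fin n → ℝ) → ℝ} (hg : Measurable g) :
    Measurable fun p => orderedIntegral b n (a p) (fun t => g (p, t)) := by
  induction n generalizing P with
  | zero => exact hg.comp (measurable_id.prodMk measurable_const)
  | succ n ih =>
    have h1 : Measurable fun q : (P × ℝ) × (Fin n → ℝ) =>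
        g (q.1.1, Fin.cons (α := fun _ => ℝ) q.1.2 q.2) :=
      hg.comp ((measurable_fst.comp measurable_fst).prodMk
        (measurable_fin_cons (measurable_snd.comp measurable_fst) measurable_snd))
    exact measurable_intervalIntegral_left b ha
      (ih (P := P × ℝ) (a := fun q => q.2) measurable_snd h1)

theorem integral_pow_div_factorial (c s b : ℝ) (n : ℕ) :
    ∫ r in s..b, c * ((b - r) ^ n / (n.factorial : ℝ)) =
      c * ((b - s) ^ (n + 1) / ((n + 1).factorial : ℝ)) := by
  rw [intervalIntegral.integral_const_mul, intervalIntegral.integral_div,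
    intervalIntegral.integral_comp_sub_left (fun r => r ^ n), integral_pow, Nat.factorial_succ]
  have h1 : ((n.factorial : ℕ) : ℝ) ≠ 0 := by positivity
  have h2 : ((n : ℝ) + 1) ≠ 0 := by positivity
  push_cast
  field_simp
  simp

theorem abs_orderedIntegral_le {a b : ℝ} (n : ℕ) {g : (Fin n → ℝ) → ℝ} {C : ℝ}
    (hg : ∀ t : Fin n → ℝ, (∀ i, t i ∈ Set.Icc a b) → |g t| ≤ C) {s : ℝ}
    (hs : s ∈ Set.Icc a b) :
    |orderedIntegral b n s g| ≤ C * ((b - s) ^ n / (n.factorial : ℝ)) := by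
  induction n generalizing s with
  | zero => simpa [orderedIntegral] using hg _ (fun i => i.elim0)
  | succ n ih =>
    rw [orderedIntegral, ← integral_pow_div_factorial, ← Real.norm_eq_abs]
    refine intervalIntegral.norm_integral_le_of_norm_le hs.2 ?_ ?_
    · refine Eventually.of_forall fun r hr => ?_
      have hr' : r ∈ Set.Icc a b := ⟨hs.1.trans hr.1.le, hr.2⟩
      exact ih (fun t ht => hg _ fun i => by
        refine Fin.cases ?_ (fun j => ?_) i
        · simpa using hr'
        · simpa using ht j) hr'
    · exact Continuous.intervalIntegrable (by fun_prop) _ _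

/-- Integrands that are measurable, and bounded on the cube of the jump times. -/
structure MeasBddOn (a b : ℝ) {n : ℕ} (g : (Fin n → ℝ) → ℝ) : Prop where
  meas : Measurable g
  bdd : ∃ C, ∀ t : Fin n → ℝ, (∀ i, t i ∈ Set.Icc a b) → |g t| ≤ C

theorem MeasBddOn.cons {a b : ℝ} {n : ℕ} {g : (Fin (n + 1) → ℝ) → ℝ} (hg : MeasBddOn a b g)
    {r : ℝ} (hr : r ∈ Set.Icc a b) :
    MeasBddOn a b (fun t : Fin n → ℝ => g (Fin.cons (α := fun _ => ℝ) r t)) := by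
  obtain ⟨C, hC⟩ := hg.bdd
  refine ⟨hg.meas.comp (measurable_fin_cons measurable_const measurable_id), C, fun t ht =>
    hC _ fun i => ?_⟩
  refine Fin.cases ?_ (fun j => ?_) i
  · simpa using hr
  · simpa using ht j

theorem intervalIntegrable_of_measurable_of_bdd {f : ℝ → ℝ} (hf : Measurable f) {s b C : ℝ}
    (hsb : s ≤ b) (hC : ∀ r ∈ Set.Ioc s b, |f r| ≤ C) : IntervalIntegrable f volume s b := by
  rw [intervalIntegrable_iff_integrableOn_Ioc_of_le hsb]
  refine Measure.integrableOn_of_bounded (M := C) (by simp) hf.aestronglyMeasurable ?_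
  exact (ae_restrict_iff' measurableSet_Ioc).2 (Eventually.of_forall hC)

theorem MeasBddOn.intervalIntegrable {a b : ℝ} {n : ℕ} {g : (Fin (n + 1) → ℝ) → ℝ}
    (hg : MeasBddOn a b g) {s : ℝ} (hs : s ∈ Set.Icc a b) :
    IntervalIntegrable
      (fun r => orderedIntegral b n r (fun t => g (Fin.cons (α := fun _ => ℝ) r t)))
      volume s b := by
  obtain ⟨C, hC⟩ := hg.bdd
  have hm : Measurable
      (fun r => orderedIntegral b n r (fun t => g (Fin.cons (α := fun _ => ℝ) r t))) :=
    measurable_orderedIntegral (P := ℝ) b n measurable_id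
      (g := fun q => g (Fin.cons (α := fun _ => ℝ) q.1 q.2))
      (hg.meas.comp (measurable_fin_cons measurable_fst measurable_snd))
  refine intervalIntegrable_of_measurable_of_bdd hm hs.2
    (C := |C| * ((b - a) ^ n / (n.factorial : ℝ))) fun r hr => ?_
  have hr' : r ∈ Set.Icc a b := ⟨hs.1.trans hr.1.le, hr.2⟩
  have h0 : 0 ≤ b - r := by linarith [hr'.2]
  refine (abs_orderedIntegral_le n (C := |C|) (fun t ht => (hC _ fun i => ?_).trans
    (le_abs_self C)) hr').trans ?_
  · refine Fin.cases ?_ (fun j => ?_) i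
    · simpa using hr'
    · simpa using ht j
  · have : b - r ≤ b - a := by linarith [hr'.1]
    gcongr

theorem orderedIntegral_add {a b : ℝ} {n : ℕ} {f g : (Fin n → ℝ) → ℝ} (hf : MeasBddOn a b f)
    (hg : MeasBddOn a b g) {s : ℝ} (hs : s ∈ Set.Icc a b) :
    orderedIntegral b n s (fun t => f t + g t) =
      orderedIntegral b n s f + orderedIntegral b n s g := by
  induction n generalizing s with
  | zero => rfl
  | succ n ih =>
    simp only [orderedIntegral]
    rw [← intervalIntegral.integral_add (hf.intervalIntegrable hs) (hg.intervalIntegrable hs)]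
    refine intervalIntegral.integral_congr fun r hr => ?_
    rw [Set.uIcc_of_le hs.2] at hr
    have hr' : r ∈ Set.Icc a b := ⟨hs.1.trans hr.1, hr.2⟩
    exact ih (hf.cons hr') (hg.cons hr') hr'

theorem orderedIntegral_const_mul (b : ℝ) (n : ℕ) (c : ℝ) (f : (Fin n → ℝ) → ℝ) (s : ℝ) :
    orderedIntegral b n s (fun t => c * f t) = c * orderedIntegral b n s f := by
  induction n generalizing s with
  | zero => rfl
  | succ n ih =>
    simp only [orderedIntegral, ih]
    exact intervalIntegral.integral_const_mul _ _

theorem orderedIntegral_nonneg {b : ℝ} {n : ℕ} {f : (Fin n → ℝ) → ℝ} (hf : ∀ t, 0 ≤ f t) {s : ℝ}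
    (hs : s ≤ b) : 0 ≤ orderedIntegral b n s f := by
  induction n generalizing s with
  | zero => exact hf _
  | succ n ih =>
    exact intervalIntegral.integral_nonneg hs fun r hr => ih (fun t => hf _) hr.2

variable {S : Type*} [Fintype S] [DecidableEq S]

/-- Path functionals which are measurable in the jump times and grow at most geometrically in the
number of jumps.  On these the path integral is linear. -/
structure TameOn (a b : ℝ) (f : JumpPath S → ℝ) : Prop where
  meas : ∀ n x, Measurable fun t => f ⟨n, x, t⟩
  bdd : ∃ C D : ℝ, 0 ≤ C ∧ 0 ≤ D ∧ ∀ n x t, (∀ i, t i ∈ Set.Icc a b) → |f ⟨n, x, t⟩| ≤ C * D ^ n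

namespace TameOn

variable {a b : ℝ} {f g : JumpPath S → ℝ}

theorem measBddOn (hf : TameOn a b f) (n : ℕ) (x : Fin (n + 1) → S) :
    MeasBddOn a b (fun t => f ⟨n, x, t⟩) := by
  obtain ⟨C, D, -, -, h⟩ := hf.bdd
  exact ⟨hf.meas n x, C * D ^ n, h n x⟩

theorem add (hf : TameOn a b f) (hg : TameOn a b g) : TameOn a b (fun p => f p + g p) := by
  obtain ⟨C, D, hC, hD, h⟩ := hf.bdd
  obtain ⟨C', D', hC', hD', h'⟩ := hg.bdd
  refine ⟨fun n x => (hf.meas n x).add (hg.meas n x), C + C', max D D', by positivity,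
    by positivity, fun n x t ht => ?_⟩
  refine (abs_add_le _ _).trans ?_
  rw [add_mul]
  refine add_le_add ((h n x t ht).trans ?_) ((h' n x t ht).trans ?_)
  · gcongr; exact le_max_left _ _
  · gcongr; exact le_max_right _ _

theorem mul (hf : TameOn a b f) (hg : TameOn a b g) : TameOn a b (fun p => f p * g p) := by
  obtain ⟨C, D, hC, hD, h⟩ := hf.bdd
  obtain ⟨C', D', hC', hD', h'⟩ := hg.bdd
  refine ⟨fun n x => (hf.meas n x).mul (hg.meas n x), C * C', D * D', by positivity,
    by positivity, fun n x t ht => ?_⟩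
  rw [abs_mul]
  calc _ ≤ (C * D ^ n) * (C' * D' ^ n) :=
        mul_le_mul (h n x t ht) (h' n x t ht) (abs_nonneg _) (by positivity)
    _ = _ := by rw [mul_pow]; ring

theorem const_mul (hf : TameOn a b f) (c : ℝ) : TameOn a b (fun p => c * f p) := by
  obtain ⟨C, D, hC, hD, h⟩ := hf.bdd
  refine ⟨fun n x => (hf.meas n x).const_mul c, |c| * C, D, by positivity, hD, fun n x t ht => ?_⟩
  rw [abs_mul, mul_assoc]
  exact mul_le_mul_of_nonneg_left (h n x t ht) (abs_nonneg c)

theorem summable (hf : TameOn a b f) (hab : a ≤ b) : Summable fun n : ℕ =>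
    ∑ x : Fin (n + 1) → S with (∀ j : Fin n, x j.castSucc ≠ x j.succ),
      orderedIntegral b n a (fun t => f ⟨n, x, t⟩) := by
  obtain ⟨C, D, hC, hD, h⟩ := hf.bdd
  set c : ℝ := (Fintype.card S : ℝ) with hc
  have h0 : 0 ≤ b - a := by linarith
  refine Summable.of_norm_bounded
    (g := fun n : ℕ => (c * C) * ((c * D * (b - a)) ^ n / (n.factorial : ℝ)))
    ((Real.summable_pow_div_factorial _).mul_left _) fun n => ?_
  refine (norm_sum_le _ _).trans ?_
  calc _ ≤ ∑ x : Fin (n + 1) → S with (∀ j : Fin n, x j.castSucc ≠ x j.succ),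
        (C * D ^ n) * ((b - a) ^ n / (n.factorial : ℝ)) :=
        Finset.sum_le_sum fun x _ => abs_orderedIntegral_le n (h n x) ⟨le_rfl, hab⟩
    _ ≤ ∑ x : Fin (n + 1) → S, (C * D ^ n) * ((b - a) ^ n / (n.factorial : ℝ)) :=
        Finset.sum_le_sum_of_subset_of_nonneg (Finset.filter_subset _ _)
          fun _ _ _ => by positivity
    _ = _ := by
        rw [Finset.sum_const, Finset.card_univ, Fintype.card_fun, Fintype.card_fin, nsmul_eq_mul]
        push_cast
        rw [← hc, mul_pow (c * D) (b - a)]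
        ring

end TameOn

theorem pathIntegral_add {a b : ℝ} (hab : a ≤ b) {f g : JumpPath S → ℝ} (hf : TameOn a b f)
    (hg : TameOn a b g) :
    pathIntegral a b (fun p => f p + g p) = pathIntegral a b f + pathIntegral a b g := by
  unfold pathIntegral
  rw [← (hf.summable hab).tsum_add (hg.summable hab)]
  refine tsum_congr fun n => ?_
  rw [← Finset.sum_add_distrib]
  exact Finset.sum_congr rfl fun x _ =>
    orderedIntegral_add (hf.measBddOn n x) (hg.measBddOn n x) ⟨le_rfl, hab⟩

theorem pathIntegral_const_mul (a b c : ℝ) (f : JumpPath S → ℝ) :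
    pathIntegral a b (fun p => c * f p) = c * pathIntegral a b f := by
  unfold pathIntegral
  rw [← tsum_mul_left]
  refine tsum_congr fun n => ?_
  rw [Finset.mul_sum]
  exact Finset.sum_congr rfl fun x _ => orderedIntegral_const_mul _ _ _ _ _

theorem pathIntegral_nonneg {a b : ℝ} (hab : a ≤ b) {f : JumpPath S → ℝ}
    (hf : ∀ p : JumpPath S, (∀ j : Fin p.n, p.x j.castSucc ≠ p.x j.succ) → 0 ≤ f p) :
    0 ≤ pathIntegral a b f :=
  tsum_nonneg fun _ => Finset.sum_nonneg fun x hx =>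
    orderedIntegral_nonneg (fun t => hf ⟨_, x, t⟩ (Finset.mem_filter.1 hx).2) hab

theorem pathIntegral_sub {a b : ℝ} (hab : a ≤ b) {f g : JumpPath S → ℝ} (hf : TameOn a b f)
    (hg : TameOn a b g) :
    pathIntegral a b (fun p => f p - g p) = pathIntegral a b f - pathIntegral a b g := by
  have := pathIntegral_add hab hf (hg.const_mul (-1))
  rw [pathIntegral_const_mul] at this
  simpa [sub_eq_add_neg] using this

/-- The functionals which are products over the jumps of a path. -/
def jumpProd (ι : S → ℝ) (K : ℝ → S → S → ℝ) (φ : S → ℝ) (p : JumpPath S) : ℝ :=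
  ι p.first * (∏ j : Fin p.n, K (p.t j) (p.x j.castSucc) (p.x j.succ)) * φ p.last

theorem tameOn_jumpProd {a b M : ℝ} (ι : S → ℝ) {K : ℝ → S → S → ℝ} (φ : S → ℝ)
    (hK : ∀ x y, Measurable fun t => K t x y)
    (hM : ∀ t ∈ Set.Icc a b, ∀ x y, |K t x y| ≤ M) : TameOn a b (jumpProd ι K φ) := by
  refine ⟨fun n x => ?_, (∑ z, |ι z|) * (∑ z, |φ z|), |M|, by positivity, by positivity,
    fun n x t ht => ?_⟩
  · have h : Measurable fun t : Fin n → ℝ => ∏ j : Fin n, K (t j) (x j.castSucc) (x j.succ) :=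
      Finset.measurable_fun_prod _ fun j _ => (hK _ _).comp (measurable_pi_apply j)
    exact (h.const_mul (ι (x 0))).mul_const (φ (x (Fin.last n)))
  · simp only [jumpProd, abs_mul, Finset.abs_prod]
    have h1 : |ι (x 0)| ≤ ∑ z, |ι z| :=
      Finset.single_le_sum (f := fun z => |ι z|) (fun _ _ => abs_nonneg _) (Finset.mem_univ _)
    have h2 : |φ (x (Fin.last n))| ≤ ∑ z, |φ z| :=
      Finset.single_le_sum (f := fun z => |φ z|) (fun _ _ => abs_nonneg _) (Finset.mem_univ _)
    have h3 : ∏ j : Fin n, |K (t j) (x j.castSucc) (x j.succ)| ≤ |M| ^ n := by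
      refine (Finset.prod_le_prod (fun _ _ => abs_nonneg _) fun j _ =>
        (hM _ (ht j) _ _).trans (le_abs_self M)).trans ?_
      simp
    calc |ι (x 0)| * _ * |φ (x (Fin.last n))| ≤ (∑ z, |ι z|) * |M| ^ n * (∑ z, |φ z|) :=
          mul_le_mul (mul_le_mul h1 h3 (Finset.prod_nonneg fun _ _ => abs_nonneg _)
            (by positivity)) h2 (abs_nonneg _) (by positivity)
      _ = _ := by ring

/-- The backward equation: the sum over all jump numbers and state sequences of a product
functional is given by the bounded solution of the Volterra equation
`w s = φ + ∫ t in s..b, K t w t`, since the terms with `n` jumps are the Picard iterates. -/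
theorem hasSum_orderedIntegral_jumpProd {a b M W : ℝ} (hab : a ≤ b) (ι : S → ℝ)
    {K : ℝ → S → S → ℝ} (φ : S → ℝ) (hK : ∀ x y, Measurable fun t => K t x y) (hM0 : 0 ≤ M)
    (hM : ∀ t ∈ Set.Icc a b, ∀ x y, |K t x y| ≤ M) {w : ℝ → S → ℝ}
    (hwm : ∀ x, Measurable fun t => w t x) (hW : ∀ t ∈ Set.Icc a b, ∀ x, |w t x| ≤ W)
    (hw : ∀ s ∈ Set.Icc a b, ∀ x, w s x = φ x + ∫ t in s..b, ∑ y, K t x y * w t y) :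
    HasSum (fun n => ∑ x : Fin (n + 1) → S,
      orderedIntegral b n a (fun t => jumpProd ι K φ ⟨n, x, t⟩)) (∑ x, ι x * w a x) := by
  -- `U n x s` is the integral over jump times in `[s, b]`, `V n s z` its sum over the paths from `z`
  set U : (n : ℕ) → (Fin (n + 1) → S) → ℝ → ℝ := fun n x s => orderedIntegral b n s
    (fun t => (∏ j : Fin n, K (t j) (x j.castSucc) (x j.succ)) * φ (x (Fin.last n))) with hU
  have hgB : ∀ n (x : Fin (n + 1) → S), MeasBddOn a b (fun t : Fin n → ℝ =>
      (∏ j : Fin n, K (t j) (x j.castSucc) (x j.succ)) * φ (x (Fin.last n))) := by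
    intro n x
    have := (tameOn_jumpProd (fun _ => 1) φ hK hM).measBddOn n x
    simpa [jumpProd, JumpPath.last] using this
  have hUsucc : ∀ n (x : Fin (n + 2) → S) s, U (n + 1) x s =
      ∫ r in s..b, K r (x 0) (x 1) * U n (Fin.tail x) r := by
    intro n x s
    simp only [hU, orderedIntegral, Fin.prod_univ_succ, mul_assoc, Fin.cons_zero, Fin.cons_succ,
      orderedIntegral_const_mul]
    rfl
  have hUint : ∀ n (y : S) (x : Fin (n + 1) → S) (s : ℝ), s ∈ Set.Icc a b →
      IntervalIntegrable (fun r => K r y (x 0) * U n x r) volume s b := by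
    intro n y x s hs
    have := (hgB (n + 1) (Fin.cons (α := fun _ => S) y x)).intervalIntegrable hs
    simp only [Fin.prod_univ_succ, mul_assoc, Fin.cons_zero, Fin.cons_succ,
      orderedIntegral_const_mul] at this
    exact this
  set V : ℕ → ℝ → S → ℝ := fun n s z => ∑ x : Fin (n + 1) → S, if x 0 = z then U n x s else 0
    with hV
  have hV0 : ∀ s z, V 0 s z = φ z := by
    intro s z
    simp only [hV, hU, orderedIntegral]
    rw [← (Equiv.funUnique (Fin 1) S).symm.sum_comp]
    simp
  have hVsucc : ∀ n s z, s ∈ Set.Icc a b →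
      V (n + 1) s z = ∫ r in s..b, ∑ y, K r z y * V n r y := by
    intro n s z hs
    simp only [hV]
    rw [← (Fin.consEquiv (fun _ : Fin (n + 2) => S)).sum_comp, Fintype.sum_prod_type]
    have htail : ∀ (y : S) (x : Fin (n + 1) → S),
        Fin.tail ((Fin.consEquiv fun _ : Fin (n + 2) => S) (y, x)) = x := fun y x => rfl
    simp only [hUsucc, htail]
    simp only [Fin.consEquiv_apply, Fin.cons_zero]
    have h1 : ∀ (y : S) (x : Fin (n + 1) → S),
        (Fin.cons (α := fun _ => S) y x : Fin (n + 2) → S) 1 = x 0 := fun y x => rfl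
    simp only [h1]
    rw [Finset.sum_eq_single z (fun y _ hy => by simp [hy]) (by simp)]
    simp only [if_true]
    rw [← intervalIntegral.integral_finsetSum fun x _ => hUint n z x s hs]
    congr 1
    funext r
    simp only [Finset.mul_sum]
    rw [Finset.sum_comm]
    refine Finset.sum_congr rfl fun x _ => ?_
    simp
  -- the error after `N` terms of the Picard iteration, which decays like `1 / N!`
  set d : ℕ → ℝ → S → ℝ := fun N s z => w s z - ∑ n ∈ Finset.range N, V n s z with hd
  have hVm : ∀ n z, Measurable fun s => V n s z := by
    intro n z
    refine Finset.measurable_fun_sum _ fun x _ => ?_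
    split_ifs
    · exact measurable_orderedIntegral (P := ℝ) b n measurable_id
        (g := fun q => (∏ j : Fin n, K (q.2 j) (x j.castSucc) (x j.succ)) * φ (x (Fin.last n)))
        ((hgB n x).meas.comp measurable_snd)
    · exact measurable_const
  have hdm : ∀ N z, Measurable fun s => d N s z := fun N z =>
    (hwm z).sub (Finset.measurable_fun_sum _ fun n _ => hVm n z)
  set D : ℝ := (Fintype.card S : ℝ) * M with hD
  have hD0 : 0 ≤ D := by positivity
  have hbound : ∀ N, ∀ s ∈ Set.Icc a b, ∀ z,
      |d N s z| ≤ |W| * D ^ N * ((b - s) ^ N / (N.factorial : ℝ)) ∧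
      d (N + 1) s z = ∫ r in s..b, ∑ y, K r z y * d N r y := by
    intro N
    induction N with
    | zero =>
      intro s hs z
      refine ⟨by simpa [hd] using (hW s hs z).trans (le_abs_self W), ?_⟩
      simp only [hd, Finset.sum_range_succ, Finset.sum_range_zero, zero_add, sub_zero, hV0]
      rw [hw s hs z, add_sub_cancel_left]
    | succ N ih =>
      have hle : ∀ s ∈ Set.Icc a b, ∀ z, ∀ r ∈ Set.Ioc s b, |∑ y, K r z y * d N r y| ≤
          |W| * D ^ (N + 1) * ((b - r) ^ N / (N.factorial : ℝ)) := by
        intro s hs z r hr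
        have hr' : r ∈ Set.Icc a b := ⟨hs.1.trans hr.1.le, hr.2⟩
        refine (Finset.abs_sum_le_sum_abs _ _).trans ?_
        calc _ ≤ ∑ _y : S, M * (|W| * D ^ N * ((b - r) ^ N / (N.factorial : ℝ))) := by
              refine Finset.sum_le_sum fun y _ => ?_
              rw [abs_mul]
              exact mul_le_mul (hM r hr' z y) (ih r hr' y).1 (abs_nonneg _) hM0
          _ = _ := by
              rw [Finset.sum_const, Finset.card_univ, nsmul_eq_mul, hD]; ring
      have hle' : ∀ s ∈ Set.Icc a b, ∀ z, |d (N + 1) s z| ≤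
          |W| * D ^ (N + 1) * ((b - s) ^ (N + 1) / ((N + 1).factorial : ℝ)) := by
        intro s hs z
        rw [(ih s hs z).2, ← integral_pow_div_factorial, ← Real.norm_eq_abs]
        refine intervalIntegral.norm_integral_le_of_norm_le hs.2
          (Eventually.of_forall fun r hr => hle s hs z r hr) ?_
        exact Continuous.intervalIntegrable (by fun_prop) _ _
      have hsumint : ∀ s ∈ Set.Icc a b, ∀ z, IntervalIntegrable
          (fun r => ∑ y, K r z y * d N r y) volume s b := by
        intro s hs z
        refine intervalIntegrable_of_measurable_of_bdd (Finset.measurable_fun_sum _ fun y _ =>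
          (hK z y).mul (hdm N y)) hs.2 (C := |W| * D ^ (N + 1) * ((b - a) ^ N /
            (N.factorial : ℝ))) fun r hr => (hle s hs z r hr).trans ?_
        have h0 : 0 ≤ b - r := by linarith [hr.2]
        have h1 : b - r ≤ b - a := by linarith [hr.1, hs.1]
        gcongr
      have hVint : ∀ s ∈ Set.Icc a b, ∀ z, IntervalIntegrable
          (fun r => ∑ y, K r z y * V N r y) volume s b := by
        intro s hs z
        have h1 := IntervalIntegrable.sum Finset.univ fun x _ => hUint N z x s hs
        refine h1.congr fun r _ => ?_
        simp only [Finset.sum_apply, hV, Finset.mul_sum]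
        rw [Finset.sum_comm]
        refine Finset.sum_congr rfl fun x _ => ?_
        simp
      intro s hs z
      refine ⟨hle' s hs z, ?_⟩
      have h1 : d (N + 2) s z = d (N + 1) s z - V (N + 1) s z := by
        simp only [hd, Finset.sum_range_succ]; ring
      rw [h1, (ih s hs z).2, hVsucc N s z hs,
        ← intervalIntegral.integral_sub (hsumint s hs z) (hVint s hs z)]
      congr 1
      funext r
      rw [← Finset.sum_sub_distrib]
      refine Finset.sum_congr rfl fun y _ => ?_
      simp only [hd, Finset.sum_range_succ]; ring
  have ha : a ∈ Set.Icc a b := ⟨le_rfl, hab⟩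
  have hdsum : ∀ z, Summable fun N => d N a z := by
    intro z
    refine Summable.of_norm_bounded
      (g := fun N : ℕ => |W| * ((D * (b - a)) ^ N / (N.factorial : ℝ)))
      ((Real.summable_pow_div_factorial _).mul_left _) fun N => ?_
    refine ((hbound N a ha z).1).trans_eq ?_
    rw [mul_pow (D) (b - a)]; ring
  have hVd : ∀ z N, V N a z = d N a z - d (N + 1) a z := by
    intro z N; simp only [hd, Finset.sum_range_succ]; ring
  have hVsum : ∀ z, HasSum (fun N => V N a z) (w a z) := by
    intro z
    have h1 : Summable fun N => V N a z := by
      simp only [hVd]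
      have h2 : Summable fun N => d (N + 1) a z :=
        (summable_nat_add_iff (f := fun N => d N a z) 1).2 (hdsum z)
      exact (hdsum z).sub h2
    refine h1.hasSum_iff_tendsto_nat.2 ?_
    have h2 : Tendsto (fun N => w a z - d N a z) atTop (𝓝 (w a z - 0)) :=
      tendsto_const_nhds.sub (hdsum z).tendsto_atTop_zero
    rw [sub_zero] at h2
    refine h2.congr fun N => ?_
    simp only [hd, sub_sub_cancel]
  have htotal : HasSum (fun N => ∑ z, ι z * V N a z) (∑ z, ι z * w a z) :=
    hasSum_sum fun z _ => (hVsum z).mul_left (ι z)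
  refine htotal.congr_fun fun n => ?_
  simp only [hV, Finset.mul_sum]
  rw [Finset.sum_comm]
  refine Finset.sum_congr rfl fun x _ => ?_
  simp only [mul_ite, mul_zero, Finset.sum_ite_eq, Finset.mem_univ, if_true, hU,
    ← orderedIntegral_const_mul, jumpProd, JumpPath.first, JumpPath.last, mul_assoc]

/-- The version of `hasSum_orderedIntegral_jumpProd` for path integrals. -/
theorem pathIntegral_jumpProd {a b M W : ℝ} (hab : a ≤ b) (ι : S → ℝ) {K : ℝ → S → S → ℝ}
    (φ : S → ℝ) (hK : ∀ x y, Measurable fun t => K t x y)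
    (hM : ∀ t ∈ Set.Icc a b, ∀ x y, |K t x y| ≤ M) {w : ℝ → S → ℝ}
    (hwm : ∀ x, Measurable fun t => w t x) (hW : ∀ t ∈ Set.Icc a b, ∀ x, |w t x| ≤ W)
    (hw : ∀ s ∈ Set.Icc a b, ∀ x,
      w s x = φ x + ∫ t in s..b, ∑ y with y ≠ x, K t x y * w t y) :
    pathIntegral a b (jumpProd ι K φ) = ∑ x, ι x * w a x := by
  -- a zero diagonal takes care of the constraint on neighbouring states
  set K₀ : ℝ → S → S → ℝ := fun t x y => if y = x then 0 else K t x y with hK₀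
  have hK₀m : ∀ x y, Measurable fun t => K₀ t x y := fun x y => by
    by_cases h : y = x
    · simp [hK₀, h]
    · simpa [hK₀, h] using hK x y
  have hK₀M : ∀ t ∈ Set.Icc a b, ∀ x y, |K₀ t x y| ≤ |M| := fun t ht x y => by
    by_cases h : y = x
    · simp [hK₀, h]
    · simpa [hK₀, h] using (hM t ht x y).trans (le_abs_self M)
  have htotal := hasSum_orderedIntegral_jumpProd hab ι φ hK₀m (abs_nonneg M) hK₀M hwm hW
    (fun s hs x => by
      rw [hw s hs x]
      congr 2
      funext t
      rw [Finset.sum_filter]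
      refine Finset.sum_congr rfl fun y _ => ?_
      by_cases h : y = x <;> simp [hK₀, h])
  rw [← htotal.tsum_eq, pathIntegral]
  refine tsum_congr fun n => ?_
  rw [Finset.sum_filter]
  refine Finset.sum_congr rfl fun x _ => ?_
  split_ifs with hx
  · congr 1
    funext t
    have : ∀ j : Fin n, K₀ (t j) (x j.castSucc) (x j.succ) = K (t j) (x j.castSucc) (x j.succ) :=
      fun j => by simp [hK₀, (hx j).symm]
    simp only [jumpProd, this]
  · push Not at hx
    obtain ⟨j, hj⟩ := hx
    have : ∀ t : Fin n → ℝ, ∏ j : Fin n, K₀ (t j) (x j.castSucc) (x j.succ) = 0 := fun t =>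
      Finset.prod_eq_zero (Finset.mem_univ j) (by simp [hK₀, hj])
    have h5 := orderedIntegral_const_mul b n 0 (fun _ => (0 : ℝ)) a
    simp only [zero_mul] at h5
    simp only [jumpProd, this, mul_zero, zero_mul, h5]

end PathIntegrals

/-! ### The Feynman–Kac formula for two-step protocols -/

section TwoStepProtocols

open MeasureTheory

/-- Protocols with the constant value `α₀` before and `α₁` after the time `0`; the value at `0`
is arbitrary. -/
structure IsTwoStep {d e : ℕ} (A : ℝ → Param d e) (α₀ α₁ : Param d e) : Prop where
  neg : ∀ t < 0, A t = α₀
  pos : ∀ t, 0 < t → A t = α₁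

namespace IsTwoStep

variable {d e : ℕ} {A : ℝ → Param d e} {α₀ α₁ : Param d e}

theorem stepProtocol (α α' : Param d e) : IsTwoStep (stepProtocol α α') α α' :=
  ⟨fun t ht => by simp [_root_.stepProtocol, ht.le], fun t ht => by
    simp [_root_.stepProtocol, ht]⟩

theorem reverse (h : IsTwoStep A α₀ α₁) : IsTwoStep (reverseProtocol A) α₁ α₀ :=
  ⟨fun t ht => h.pos (-t) (by linarith), fun t ht => h.neg (-t) (by linarith)⟩

theorem const (α : Param d e) : IsTwoStep (fun _ => α) α α := ⟨fun _ _ => rfl, fun _ _ => rfl⟩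

theorem measurable (h : IsTwoStep A α₀ α₁) (G : Param d e → ℝ) : Measurable fun t => G (A t) := by
  have : (fun t => G (A t)) = fun t => if t < 0 then G α₀ else if t = 0 then G (A 0) else G α₁ := by
    funext t
    rcases lt_trichotomy t 0 with ht | ht | ht
    · simp [ht, h.neg t ht]
    · simp [ht]
    · simp [ht.not_gt, ht.ne', h.pos t ht]
  rw [this]
  exact Measurable.ite measurableSet_Iio measurable_const
    (Measurable.ite (measurableSet_singleton 0) measurable_const measurable_const)

theorem abs_le (h : IsTwoStep A α₀ α₁) (G : Param d e → ℝ) (t : ℝ) :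
    |G (A t)| ≤ |G α₀| + |G (A 0)| + |G α₁| := by
  have h0 := abs_nonneg (G α₀)
  have h1 := abs_nonneg (G (A 0))
  have h2 := abs_nonneg (G α₁)
  rcases lt_trichotomy t 0 with ht | ht | ht
  · rw [h.neg t ht]; linarith
  · rw [ht]; linarith
  · rw [h.pos t ht]; linarith

theorem intervalIntegrable (h : IsTwoStep A α₀ α₁) (G : Param d e → ℝ) (s t : ℝ) :
    IntervalIntegrable (fun r => G (A r)) volume s t := by
  rcases le_total s t with hst | hst
  · exact intervalIntegrable_of_measurable_of_bdd (h.measurable G) hst fun r _ => h.abs_le G r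
  · exact (intervalIntegrable_of_measurable_of_bdd (h.measurable G) hst
      fun r _ => h.abs_le G r).symm

theorem integral_eq (h : IsTwoStep A α₀ α₁) (G : Param d e → ℝ) (s t : ℝ) :
    ∫ r in s..t, G (A r) =
      (G α₀ * min t 0 + G α₁ * max t 0) - (G α₀ * min s 0 + G α₁ * max s 0) := by
  refine MeasureTheory.integral_eq_of_hasDerivAt_off_countable
    (fun r => G α₀ * min r 0 + G α₁ * max r 0) _ (Set.countable_singleton (0 : ℝ))
    (by fun_prop) (fun r hr => ?_) (h.intervalIntegrable G s t)
  rcases lt_or_gt_of_ne hr.2 with hr0 | hr0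
  · rw [h.neg r hr0]
    have h1 : HasDerivAt (fun r : ℝ => G α₀ * r) (G α₀) r := by
      simpa using (hasDerivAt_id r).const_mul (G α₀)
    refine h1.congr_of_eventuallyEq ?_
    filter_upwards [eventually_lt_nhds hr0] with y hy
    simp [hy.le]
  · rw [h.pos r hr0]
    have h1 : HasDerivAt (fun r : ℝ => G α₁ * r) (G α₁) r := by
      simpa using (hasDerivAt_id r).const_mul (G α₁)
    refine h1.congr_of_eventuallyEq ?_
    filter_upwards [eventually_gt_nhds hr0] with y hy
    simp [hy.le]

end IsTwoStep

namespace JumpPath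

variable {S : Type*}

theorem prod_times_succ (a b : ℝ) (p : JumpPath S) (f : ℝ → S → ℝ) :
    ∏ j : Fin (p.n + 1), f (p.times a b j.succ) (p.x j) =
      (∏ j : Fin p.n, f (p.t j) (p.x j.castSucc)) * f b p.last := by
  rw [Fin.prod_univ_castSucc]
  simp [times, last]

theorem prod_times_castSucc (a b : ℝ) (p : JumpPath S) (f : ℝ → S → ℝ) :
    ∏ j : Fin (p.n + 1), f (p.times a b j.castSucc) (p.x j) =
      f a p.first * ∏ j : Fin p.n, f (p.t j) (p.x j.succ) := by
  rw [Fin.prod_univ_succ]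
  simp [times, first]

end JumpPath

namespace NESSModel

set_option linter.unusedSectionVars false

open scoped Matrix Matrix.Norms.Operator

variable {S : Type*} {d e : ℕ} (M : NESSModel S d e) [Fintype S] [DecidableEq S]

/-- The observable `β W + Ψ` on `[a, b]`. -/
noncomputable def workPsi (a b : ℝ) (A : ℝ → Param d e) (p : JumpPath S) : ℝ :=
  M.beta * M.work a b A p + M.Psi A p

/-- The generator whose off-diagonal rates are tilted by `exp (u ψ)`. -/
noncomputable def tilted (α : Param d e) (u : ℝ) : Matrix S S ℝ := fun x y =>
  if y = x then -M.escape α x else M.rate α x y * Real.exp (u * M.psi α x y)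

/-- The integral of the escape rate from time `0` on, for a two-step protocol. -/
noncomputable def cumEscape (α₀ α₁ : Param d e) (t : ℝ) (x : S) : ℝ :=
  M.escape α₀ x * min t 0 + M.escape α₁ x * max t 0

/-- The gauge factor which removes the waiting times and the work from the path weight. -/
noncomputable def gauge (A : ℝ → Param d e) (α₀ α₁ : Param d e) (u t : ℝ) (x : S) : ℝ :=
  Real.exp (u * M.beta * M.H (A t).nu x - M.cumEscape α₀ α₁ t x)

/-- The jump kernel in the gauge `NESSModel.gauge`. -/
noncomputable def gaugedKernel (A : ℝ → Param d e) (α₀ α₁ : Param d e) (u t : ℝ) (x y : S) : ℝ :=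
  M.gauge A α₀ α₁ u t x * (M.rate (A t) x y * Real.exp (u * M.psi (A t) x y)) /
    M.gauge A α₀ α₁ u t y

variable {M}
variable {A : ℝ → Param d e} {α₀ α₁ : Param d e}

/-- The gauge transformation: work and waiting times are differences of the logarithm of the gauge
factor along the path and telescope. -/
theorem exp_workPsi_mul_weight (hA : IsTwoStep A α₀ α₁) (a b u : ℝ) (ι φ : S → ℝ)
    (p : JumpPath S) :
    Real.exp (u * M.workPsi a b A p) * ι p.first * φ p.last * M.weight a b A p =
      jumpProd (fun x => ι x / M.gauge A α₀ α₁ u a x) (M.gaugedKernel A α₀ α₁ u)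
        (fun x => M.gauge A α₀ α₁ u b x * φ x) p := by
  have hg : ∀ t x, M.gauge A α₀ α₁ u t x ≠ 0 := fun t x => (Real.exp_pos _).ne'
  have hint : ∀ s t x, ∫ r in s..t, M.escape (A r) x =
      M.cumEscape α₀ α₁ t x - M.cumEscape α₀ α₁ s x := fun s t x =>
    hA.integral_eq (fun α => M.escape α x) s t
  have h1 : Real.exp (u * M.workPsi a b A p) * (∏ j : Fin (p.n + 1), Real.exp
      (-∫ s in (p.times a b j.castSucc)..(p.times a b j.succ), M.escape (A s) (p.x j))) =
      (∏ j : Fin (p.n + 1), (M.gauge A α₀ α₁ u (p.times a b j.succ) (p.x j) /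
        M.gauge A α₀ α₁ u (p.times a b j.castSucc) (p.x j))) *
      ∏ j : Fin p.n, Real.exp (u * M.psi (A (p.t j)) (p.x j.castSucc) (p.x j.succ)) := by
    simp only [workPsi, work, Psi, gauge, ← Real.exp_sum, ← Real.exp_sub, ← Real.exp_add,
      hint]
    congr 1
    simp only [mul_add, Finset.mul_sum]
    rw [add_right_comm, ← Finset.sum_add_distrib]
    congr 1
    refine Finset.sum_congr rfl fun j _ => ?_
    ring
  have h2 : ∏ j : Fin (p.n + 1), (M.gauge A α₀ α₁ u (p.times a b j.succ) (p.x j) /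
        M.gauge A α₀ α₁ u (p.times a b j.castSucc) (p.x j)) =
      (∏ j : Fin p.n, M.gauge A α₀ α₁ u (p.t j) (p.x j.castSucc) /
        M.gauge A α₀ α₁ u (p.t j) (p.x j.succ)) *
      (M.gauge A α₀ α₁ u b p.last / M.gauge A α₀ α₁ u a p.first) := by
    rw [Finset.prod_div_distrib, JumpPath.prod_times_succ, JumpPath.prod_times_castSucc,
      Finset.prod_div_distrib]
    rw [mul_comm (M.gauge A α₀ α₁ u a p.first), mul_div_mul_comm]
  have h3 : ∏ j : Fin p.n, M.gaugedKernel A α₀ α₁ u (p.t j) (p.x j.castSucc) (p.x j.succ) =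
      (∏ j : Fin p.n, M.gauge A α₀ α₁ u (p.t j) (p.x j.castSucc) /
        M.gauge A α₀ α₁ u (p.t j) (p.x j.succ)) *
      (∏ j : Fin p.n, M.rate (A (p.t j)) (p.x j.castSucc) (p.x j.succ)) *
      ∏ j : Fin p.n, Real.exp (u * M.psi (A (p.t j)) (p.x j.castSucc) (p.x j.succ)) := by
    rw [← Finset.prod_mul_distrib, ← Finset.prod_mul_distrib]
    refine Finset.prod_congr rfl fun j _ => ?_
    rw [gaugedKernel]; ring
  rw [jumpProd, h3, weight]
  rw [h2] at h1
  calc _ = (Real.exp (u * M.workPsi a b A p) * (∏ j : Fin (p.n + 1), Real.exp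
      (-∫ s in (p.times a b j.castSucc)..(p.times a b j.succ), M.escape (A s) (p.x j)))) *
        (ι p.first * φ p.last *
          ∏ j : Fin p.n, M.rate (A (p.t j)) (p.x j.castSucc) (p.x j.succ)) := by ring
    _ = _ := by rw [h1]; ring

theorem continuous_cumEscape (α₀ α₁ : Param d e) (x : S) :
    Continuous fun t => M.cumEscape α₀ α₁ t x := by
  unfold cumEscape; fun_prop

/-- The part of the gauged kernel that depends on time through the parameters only. -/
noncomputable def bareKernel (M : NESSModel S d e) (u : ℝ) (x y : S) (α : Param d e) : ℝ :=
  Real.exp (u * M.beta * M.H α.nu x) * (M.rate α x y * Real.exp (u * M.psi α x y)) /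
    Real.exp (u * M.beta * M.H α.nu y)

theorem gaugedKernel_eq (A : ℝ → Param d e) (α₀ α₁ : Param d e) (u t : ℝ) (x y : S) :
    M.gaugedKernel A α₀ α₁ u t x y = M.bareKernel u x y (A t) *
      Real.exp (M.cumEscape α₀ α₁ t y - M.cumEscape α₀ α₁ t x) := by
  simp only [gaugedKernel, gauge, Real.exp_sub, bareKernel]
  field_simp

theorem measurable_gaugedKernel (hA : IsTwoStep A α₀ α₁) (u : ℝ) (x y : S) :
    Measurable fun t => M.gaugedKernel A α₀ α₁ u t x y := by
  simp only [gaugedKernel_eq]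
  exact (hA.measurable (M.bareKernel u x y)).mul (Continuous.measurable
    (Real.continuous_exp.comp ((continuous_cumEscape _ _ y).sub (continuous_cumEscape _ _ x))))

theorem exists_abs_gaugedKernel_le (hA : IsTwoStep A α₀ α₁) (u a b : ℝ) :
    ∃ C : ℝ, ∀ t ∈ Set.Icc a b, ∀ x y, |M.gaugedKernel A α₀ α₁ u t x y| ≤ C := by
  have h1 : ∀ q : S × S, ∃ C : ℝ, ∀ t ∈ Set.Icc a b,
      |M.gaugedKernel A α₀ α₁ u t q.1 q.2| ≤ C := by
    rintro ⟨x, y⟩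
    obtain ⟨C, hC⟩ := (isCompact_Icc (a := a) (b := b)).exists_bound_of_continuousOn
      (Real.continuous_exp.comp ((continuous_cumEscape (M := M) α₀ α₁ y).sub
        (continuous_cumEscape (M := M) α₀ α₁ x))).continuousOn
    refine ⟨(|M.bareKernel u x y α₀| + |M.bareKernel u x y (A 0)| + |M.bareKernel u x y α₁|) * C,
      fun t ht => ?_⟩
    rw [gaugedKernel_eq, abs_mul]
    exact mul_le_mul (hA.abs_le (M.bareKernel u x y) t) (hC t ht) (abs_nonneg _) (by positivity)
  choose C hC using h1
  refine ⟨∑ q, |C q|, fun t ht x y => (hC (x, y) t ht).trans ((le_abs_self _).trans ?_)⟩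
  exact Finset.single_le_sum (f := fun q => |C q|) (fun _ _ => abs_nonneg _) (Finset.mem_univ _)

theorem tameOn_exp_workPsi (hA : IsTwoStep A α₀ α₁) (a b u : ℝ) (ι φ : S → ℝ) :
    TameOn a b fun p : JumpPath S =>
      Real.exp (u * M.workPsi a b A p) * ι p.first * φ p.last * M.weight a b A p := by
  obtain ⟨C, hC⟩ := exists_abs_gaugedKernel_le (M := M) hA u a b
  have := tameOn_jumpProd (fun x => ι x / M.gauge A α₀ α₁ u a x)
    (fun x => M.gauge A α₀ α₁ u b x * φ x) (measurable_gaugedKernel hA u) hC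
  exact ⟨fun n x => by simpa only [exp_workPsi_mul_weight hA] using this.meas n x,
    by simpa only [exp_workPsi_mul_weight hA] using this.bdd⟩

/-- Path integrals from continuous solutions of the backward differential equation. -/
theorem pathIntegral_exp_workPsi_eq (hA : IsTwoStep A α₀ α₁) {a b : ℝ} (hab : a ≤ b) (u : ℝ)
    (ι φ : S → ℝ) {w : ℝ → S → ℝ} (hwc : ∀ x, Continuous fun s => w s x)
    (hwd : ∀ s ∈ Set.Ioo a b, s ≠ 0 → ∀ x, HasDerivAt (fun s => w s x)
      (-∑ y with y ≠ x, M.gaugedKernel A α₀ α₁ u s x y * w s y) s)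
    (hwb : ∀ x, w b x = M.gauge A α₀ α₁ u b x * φ x) :
    pathIntegral a b (fun p : JumpPath S =>
      Real.exp (u * M.workPsi a b A p) * ι p.first * φ p.last * M.weight a b A p) =
      ∑ x, ι x / M.gauge A α₀ α₁ u a x * w a x := by
  simp only [exp_workPsi_mul_weight hA]
  obtain ⟨C, hC⟩ := exists_abs_gaugedKernel_le (M := M) hA u a b
  have h1 : ∀ x, ∃ W : ℝ, ∀ t ∈ Set.Icc a b, |w t x| ≤ W := fun x =>
    (isCompact_Icc (a := a) (b := b)).exists_bound_of_continuousOn (hwc x).continuousOn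
  choose W hW using h1
  have hW' : ∀ t ∈ Set.Icc a b, ∀ x, |w t x| ≤ ∑ x, |W x| := fun t ht x =>
    (hW x t ht).trans ((le_abs_self _).trans (Finset.single_le_sum (f := fun q => |W q|)
      (fun _ _ => abs_nonneg _) (Finset.mem_univ _)))
  refine pathIntegral_jumpProd hab _ _ (measurable_gaugedKernel hA u) hC
    (fun x => (hwc x).measurable) hW' fun s hs x => ?_
  have hint : IntervalIntegrable
      (fun t => -∑ y with y ≠ x, M.gaugedKernel A α₀ α₁ u t x y * w t y) volume s b := by
    have hm : Measurable
        (fun t => -∑ y with y ≠ x, M.gaugedKernel A α₀ α₁ u t x y * w t y) :=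
      Measurable.neg (Finset.measurable_fun_sum _ fun y _ =>
        (measurable_gaugedKernel hA u x y).mul (hwc y).measurable)
    refine intervalIntegrable_of_measurable_of_bdd hm hs.2
      (C := ∑ y with y ≠ x, |C| * ∑ x, |W x|) fun r hr => ?_
    have hr' : r ∈ Set.Icc a b := ⟨hs.1.trans hr.1.le, hr.2⟩
    rw [abs_neg]
    refine (Finset.abs_sum_le_sum_abs _ _).trans (Finset.sum_le_sum fun y _ => ?_)
    rw [abs_mul]
    exact mul_le_mul ((hC r hr' x y).trans (le_abs_self C)) (hW' r hr' y) (abs_nonneg _)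
      (abs_nonneg _)
  have h2 := MeasureTheory.integral_eq_of_hasDerivAt_off_countable_of_le (fun t => w t x) _ hs.2
    (Set.countable_singleton (0 : ℝ)) (hwc x).continuousOn
    (fun r hr => hwd r ⟨hs.1.trans_lt hr.1.1, hr.1.2⟩ hr.2 x) hint
  rw [intervalIntegral.integral_neg, hwb] at h2
  linarith

/-- For constant parameters the backward equation is solved by the exponential of the tilted
generator. -/
theorem hasDerivAt_exp_tilted (α : Param d e) (u c : ℝ) (g : S → ℝ) (x : S) (s : ℝ) :
    HasDerivAt (fun s : ℝ => Real.exp (u * M.beta * M.H α.nu x - M.escape α x * s) *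
        (NormedSpace.exp ((c - s) • M.tilted α u) *ᵥ g) x)
      (-∑ y with y ≠ x, (Real.exp (u * M.beta * M.H α.nu x - M.escape α x * s) *
          (M.rate α x y * Real.exp (u * M.psi α x y)) /
          Real.exp (u * M.beta * M.H α.nu y - M.escape α y * s)) *
        (Real.exp (u * M.beta * M.H α.nu y - M.escape α y * s) *
          (NormedSpace.exp ((c - s) • M.tilted α u) *ᵥ g) y)) s := by
  set L := M.tilted α u with hL
  have h1 : HasDerivAt (fun s : ℝ => Real.exp (u * M.beta * M.H α.nu x - M.escape α x * s))
      (Real.exp (u * M.beta * M.H α.nu x - M.escape α x * s) * -M.escape α x) s := by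
    have : HasDerivAt (fun s : ℝ => u * M.beta * M.H α.nu x - M.escape α x * s)
        (-M.escape α x) s := by
      simpa using ((hasDerivAt_id s).const_mul (M.escape α x)).const_sub
        (u * M.beta * M.H α.nu x)
    exact this.exp
  have h2 : HasDerivAt (fun s : ℝ => NormedSpace.exp ((c - s) • L))
      (-(L * NormedSpace.exp ((c - s) • L))) s := by
    have h3 := (hasDerivAt_exp_smul_const' (𝕂 := ℝ) L (c - s)).scomp s
      ((hasDerivAt_id s).const_sub c)
    simp only [neg_smul, one_smul] at h3
    exact h3
  set φ : Matrix S S ℝ →L[ℝ] ℝ := LinearMap.toContinuousLinearMap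
    { toFun := fun N => (N *ᵥ g) x
      map_add' := fun N N' => by simp [Matrix.add_mulVec]
      map_smul' := fun r N => by simp [Matrix.smul_mulVec] } with hφ
  have h4 : HasDerivAt (fun s : ℝ => (NormedSpace.exp ((c - s) • L) *ᵥ g) x)
      (-(L *ᵥ (NormedSpace.exp ((c - s) • L) *ᵥ g)) x) s := by
    have := φ.hasFDerivAt.comp_hasDerivAt s h2
    have h5 : φ (-(L * NormedSpace.exp ((c - s) • L))) =
        -φ (L * NormedSpace.exp ((c - s) • L)) := map_neg φ _
    rw [Matrix.mulVec_mulVec]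
    exact this.congr_deriv h5
  refine (h1.mul h4).congr_deriv ?_
  set v := NormedSpace.exp ((c - s) • L) *ᵥ g with hv
  have h5 : (L *ᵥ v) x = -M.escape α x * v x +
      ∑ y with y ≠ x, M.rate α x y * Real.exp (u * M.psi α x y) * v y := by
    rw [Matrix.mulVec, dotProduct, ← Finset.add_sum_erase _ _ (Finset.mem_univ x)]
    congr 1
    · simp [hL, tilted]
    · rw [Finset.filter_ne' Finset.univ x]
      refine Finset.sum_congr rfl fun y hy => ?_
      simp [hL, tilted, Finset.ne_of_mem_erase hy]
  have h6 : ∀ y, (Real.exp (u * M.beta * M.H α.nu x - M.escape α x * s) *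
          (M.rate α x y * Real.exp (u * M.psi α x y)) /
          Real.exp (u * M.beta * M.H α.nu y - M.escape α y * s)) *
        (Real.exp (u * M.beta * M.H α.nu y - M.escape α y * s) * v y) =
      Real.exp (u * M.beta * M.H α.nu x - M.escape α x * s) *
        (M.rate α x y * Real.exp (u * M.psi α x y) * v y) := by
    intro y
    have := (Real.exp_pos (u * M.beta * M.H α.nu y - M.escape α y * s)).ne'
    field_simp
  simp only [h6, ← Finset.mul_sum, h5]
  ring

theorem continuous_exp_tilted (α : Param d e) (u c : ℝ) (g : S → ℝ) (x : S) :
    Continuous (fun s : ℝ => Real.exp (u * M.beta * M.H α.nu x - M.escape α x * s) *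
        (NormedSpace.exp ((c - s) • M.tilted α u) *ᵥ g) x) :=
  continuous_iff_continuousAt.2 fun s => (hasDerivAt_exp_tilted α u c g x s).continuousAt

/-- The Feynman–Kac formula for a constant protocol. -/
theorem pathIntegral_const (α : Param d e) {a b : ℝ} (hab : a ≤ b) (u : ℝ) (ι φ : S → ℝ) :
    pathIntegral a b (fun p : JumpPath S => Real.exp (u * M.workPsi a b (fun _ => α) p) *
      ι p.first * φ p.last * M.weight a b (fun _ => α) p) =
      ι ⬝ᵥ (NormedSpace.exp ((b - a) • M.tilted α u) *ᵥ φ) := by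
  have hcum : ∀ t x, M.cumEscape α α t x = M.escape α x * t := by
    intro t x
    rw [cumEscape, ← mul_add, min_add_max, add_zero]
  rw [pathIntegral_exp_workPsi_eq (IsTwoStep.const α) hab u ι φ
    (w := fun s x => Real.exp (u * M.beta * M.H α.nu x - M.escape α x * s) *
        (NormedSpace.exp ((b - s) • M.tilted α u) *ᵥ φ) x)
    (fun x => continuous_exp_tilted α u b φ x)
    (fun s _ _ x => by
      simpa only [gaugedKernel, gauge, hcum] using hasDerivAt_exp_tilted α u b φ x s)
    (fun x => by simp [gauge, hcum])]
  refine Finset.sum_congr rfl fun x _ => ?_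
  simp only [gauge, hcum]
  have := (Real.exp_pos (u * M.beta * M.H α.nu x - M.escape α x * a)).ne'
  field_simp

/-- The Feynman–Kac formula for a two-step protocol on `[-τ, τ]`. -/
theorem pathIntegral_twoStep (hA : IsTwoStep A α₀ α₁) {τ : ℝ} (hτ : 0 < τ) (u : ℝ)
    (ι φ : S → ℝ) :
    pathIntegral (-τ) τ (fun p : JumpPath S => Real.exp (u * M.workPsi (-τ) τ A p) *
      ι p.first * φ p.last * M.weight (-τ) τ A p) =
      ι ⬝ᵥ ((NormedSpace.exp (τ • M.tilted α₀ u) *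
        Matrix.diagonal (fun x => Real.exp (u * (M.beta * (M.H α₁.nu x - M.H α₀.nu x)))) *
        NormedSpace.exp (τ • M.tilted α₁ u)) *ᵥ φ) := by
  set g : S → ℝ := fun x => Real.exp (u * (M.beta * (M.H α₁.nu x - M.H α₀.nu x))) *
    (NormedSpace.exp (τ • M.tilted α₁ u) *ᵥ φ) x with hg
  set w₀ : ℝ → S → ℝ := fun s x => Real.exp (u * M.beta * M.H α₀.nu x - M.escape α₀ x * s) *
        (NormedSpace.exp ((0 - s) • M.tilted α₀ u) *ᵥ g) x with hw₀
  set w₁ : ℝ → S → ℝ := fun s x => Real.exp (u * M.beta * M.H α₁.nu x - M.escape α₁ x * s) *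
        (NormedSpace.exp ((τ - s) • M.tilted α₁ u) *ᵥ φ) x with hw₁
  -- the work factor makes the gauged solution continuous across the step
  have hmatch : ∀ x, w₀ 0 x = w₁ 0 x := by
    intro x
    simp only [hw₀, hw₁, hg, sub_zero, zero_smul, mul_zero, NormedSpace.exp_zero,
      Matrix.one_mulVec, ← mul_assoc, ← Real.exp_add]
    congr 2
    ring
  have hcum0 : ∀ t x, t ≤ 0 → M.cumEscape α₀ α₁ t x = M.escape α₀ x * t := by
    intro t x ht
    simp [cumEscape, ht]
  have hcum1 : ∀ t x, 0 ≤ t → M.cumEscape α₀ α₁ t x = M.escape α₁ x * t := by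
    intro t x ht
    simp [cumEscape, ht]
  have hneg : A (-τ) = α₀ := hA.neg _ (by linarith)
  have hpos : A τ = α₁ := hA.pos _ hτ
  rw [pathIntegral_exp_workPsi_eq hA (by linarith) u ι φ
    (w := fun s x => if s ≤ 0 then w₀ s x else w₁ s x)]
  · rw [dotProduct]
    refine Finset.sum_congr rfl fun x _ => ?_
    rw [if_pos (by linarith)]
    simp only [gauge, hneg, hcum0 (-τ) x (by linarith), hw₀, zero_sub, neg_neg]
    have := (Real.exp_pos (u * M.beta * M.H α₀.nu x - M.escape α₀ x * -τ)).ne'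
    have hgd : g = Matrix.diagonal (fun x => Real.exp (u * (M.beta * (M.H α₁.nu x - M.H α₀.nu x))))
        *ᵥ (NormedSpace.exp (τ • M.tilted α₁ u) *ᵥ φ) := by
      funext y; rw [Matrix.mulVec_diagonal]
    rw [mul_assoc, ← Matrix.mulVec_mulVec, ← Matrix.mulVec_mulVec, ← hgd]
    field_simp
  · intro x
    refine Continuous.if_le (continuous_exp_tilted α₀ u 0 g x) (continuous_exp_tilted α₁ u τ φ x)
      continuous_id continuous_const ?_
    rintro s rfl
    exact hmatch x
  · intro s _ hs0 x
    rcases lt_or_gt_of_ne hs0 with hs | hs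
    · have h1 := hasDerivAt_exp_tilted (M := M) α₀ u 0 g x s
      simp only [gaugedKernel, gauge, hA.neg s hs, hcum0 s _ hs.le, if_pos hs.le]
      refine h1.congr_of_eventuallyEq ?_
      filter_upwards [eventually_lt_nhds hs] with r hr
      rw [if_pos hr.le]
    · have h1 := hasDerivAt_exp_tilted (M := M) α₁ u τ φ x s
      simp only [gaugedKernel, gauge, hA.pos s hs, hcum1 s _ hs.le, if_neg (not_le.2 hs)]
      refine h1.congr_of_eventuallyEq ?_
      filter_upwards [eventually_gt_nhds hs] with r hr
      rw [if_neg (not_le.2 hr)]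
  · intro x
    rw [if_neg (not_le.2 hτ)]
    simp [hw₁, gauge, hpos, hcum1 τ x hτ.le]

end NESSModel

end TwoStepProtocols

/-! ### Tilted generators and time reversal -/

section TiltedGenerators

namespace NESSModel

set_option linter.unusedSectionVars false

open scoped Matrix Matrix.Norms.Operator

variable {S : Type*} {d e : ℕ} (M : NESSModel S d e)

/-- The equilibrium rates as a function of the energies `h`. -/
noncomputable def eqRateOf (h : S → ℝ) (x y : S) : ℝ :=
  match M.rule with
  | RateRule.exponential => M.c x y * Real.exp (M.beta * h x)
  | RateRule.symmetric => M.c x y * Real.exp (M.beta / 2 * (h x - h y))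

theorem eqRate_eq (ν : EuclideanSpace ℝ (Fin d)) (x y : S) :
    M.eqRate ν x y = M.eqRateOf (M.H ν) x y := rfl

theorem exists_eqRateOf_eq (h : S → ℝ) (x y : S) :
    ∃ r : ℝ, 0 < r ∧ M.eqRateOf h x y = M.c x y * r := by
  unfold eqRateOf
  split <;> exact ⟨_, Real.exp_pos _, rfl⟩

theorem eqRateOf_nonneg (h : S → ℝ) {x y : S} (hxy : x ≠ y) : 0 ≤ M.eqRateOf h x y := by
  obtain ⟨r, hr, h1⟩ := M.exists_eqRateOf_eq h x y
  rw [h1]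
  exact mul_nonneg (M.c_nonneg x y hxy) hr.le

theorem eqRateOf_ne_zero (h : S → ℝ) {x y : S} (hc : M.c x y ≠ 0) : M.eqRateOf h x y ≠ 0 := by
  obtain ⟨r, hr, h1⟩ := M.exists_eqRateOf_eq h x y
  rw [h1]
  exact mul_ne_zero hc hr.ne'

theorem eqRateOf_detailed_balance (h : S → ℝ) {x y : S} (hxy : x ≠ y) :
    Real.exp (-M.beta * h x) * M.eqRateOf h x y = Real.exp (-M.beta * h y) * M.eqRateOf h y x := by
  unfold eqRateOf
  rw [M.c_symm x y hxy]
  split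
  · rw [mul_left_comm, mul_left_comm (Real.exp _), ← Real.exp_add, ← Real.exp_add]
    congr 2; ring
  · rw [mul_left_comm, mul_left_comm (Real.exp _), ← Real.exp_add, ← Real.exp_add]
    congr 2; ring

theorem contDiff_eqRateOf {X : Type*} [NormedAddCommGroup X] [NormedSpace ℝ X] {h : X → S → ℝ}
    (hh : ∀ x, ContDiff ℝ ∞ fun p => h p x) (x y : S) :
    ContDiff ℝ ∞ fun p => M.eqRateOf (h p) x y := by
  unfold eqRateOf
  split
  · exact contDiff_const.mul (contDiff_const.mul (hh x)).exp
  · exact contDiff_const.mul (contDiff_const.mul ((hh x).sub (hh y))).exp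

variable [Fintype S] [DecidableEq S]

/-- The tilted generator with energies `h`, log-perturbation `a` of the rates, and tilt `w`:  the
off-diagonal entries are the equilibrium rates times `exp (a + w)`, the diagonal contains the escape
rates for the rates without tilt. -/
noncomputable def genMat (h : S → ℝ) (a w : S → S → ℝ) : Matrix S S ℝ := fun x y =>
  if y = x then -∑ y with y ≠ x, M.eqRateOf h x y * Real.exp (a x y)
  else M.eqRateOf h x y * Real.exp (a x y + w x y)

theorem genMat_apply_ne (h : S → ℝ) (a w : S → S → ℝ) {x y : S} (hxy : y ≠ x) :
    M.genMat h a w x y = M.eqRateOf h x y * Real.exp (a x y + w x y) := if_neg hxy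

theorem genMat_apply_self (h : S → ℝ) (a w : S → S → ℝ) (x : S) :
    M.genMat h a w x x = -∑ y with y ≠ x, M.eqRateOf h x y * Real.exp (a x y) := if_pos rfl

theorem isIrredMetzler_genMat (h : S → ℝ) (a w : S → S → ℝ) : IsIrredMetzler (M.genMat h a w) where
  nonneg x y hxy := by
    rw [genMat_apply_ne _ _ _ _ hxy.symm]
    exact mul_nonneg (M.eqRateOf_nonneg h hxy) (Real.exp_pos _).le
  conn x y := Relation.ReflTransGen.mono (fun u v huv => ⟨huv.1, by
    rw [genMat_apply_ne _ _ _ _ huv.1.symm]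
    exact mul_ne_zero (M.eqRateOf_ne_zero h huv.2) (Real.exp_pos _).ne'⟩) _ _ (M.c_connected x y)

theorem contDiff_genMat {X : Type*} [NormedAddCommGroup X] [NormedSpace ℝ X]
    {h : X → S → ℝ} {a w : X → S → S → ℝ} (hh : ∀ x, ContDiff ℝ ∞ fun p => h p x)
    (ha : ∀ x y, ContDiff ℝ ∞ fun p => a p x y) (hw : ∀ x y, ContDiff ℝ ∞ fun p => w p x y)
    (x y : S) : ContDiff ℝ ∞ fun p => M.genMat (h p) (a p) (w p) x y := by
  unfold genMat
  split_ifs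
  · exact (ContDiff.sum fun y _ => (M.contDiff_eqRateOf hh x y).mul (ha x y).exp).neg
  · exact (M.contDiff_eqRateOf hh x y).mul ((ha x y).add (hw x y)).exp

variable [Nonempty S]

/-- The positive right eigenvector of the tilted generator. -/
noncomputable def rightVec (h : S → ℝ) (a w : S → S → ℝ) : S → ℝ := perronVec (M.genMat h a w)

/-- The tilt that is conjugate to `w` under time reversal:  `-(a - aᵀ) - w`. -/
def revTilt (a w : S → S → ℝ) (x y : S) : ℝ := -(a x y - a y x) - w x y

/-- The positive left eigenvector of the tilted generator. By detailed balance it is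
`exp (-β h)` times the right eigenvector for the time-reversed tilt. -/
noncomputable def leftVec (h : S → ℝ) (a w : S → S → ℝ) (x : S) : ℝ :=
  Real.exp (-M.beta * h x) * M.rightVec h a (revTilt a w) x

theorem rightVec_pos (h : S → ℝ) (a w : S → S → ℝ) (x : S) : 0 < M.rightVec h a w x :=
  (M.isIrredMetzler_genMat h a w).perronVec_spec.1 x

theorem leftVec_pos (h : S → ℝ) (a w : S → S → ℝ) (x : S) : 0 < M.leftVec h a w x :=
  mul_pos (Real.exp_pos _) (M.rightVec_pos h a _ x)

theorem contDiff_rightVec {X : Type*} [NormedAddCommGroup X] [NormedSpace ℝ X] [CompleteSpace X]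
    {h : X → S → ℝ} {a w : X → S → S → ℝ} (hh : ∀ x, ContDiff ℝ ∞ fun p => h p x)
    (ha : ∀ x y, ContDiff ℝ ∞ fun p => a p x y) (hw : ∀ x y, ContDiff ℝ ∞ fun p => w p x y)
    (x : S) : ContDiff ℝ ∞ fun p => M.rightVec (h p) (a p) (w p) x :=
  contDiff_pi.1 (contDiff_perronVec (M.contDiff_genMat hh ha hw)
    fun _ => M.isIrredMetzler_genMat _ _ _) x

theorem contDiff_leftVec {X : Type*} [NormedAddCommGroup X] [NormedSpace ℝ X] [CompleteSpace X]
    {h : X → S → ℝ} {a w : X → S → S → ℝ} (hh : ∀ x, ContDiff ℝ ∞ fun p => h p x)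
    (ha : ∀ x y, ContDiff ℝ ∞ fun p => a p x y) (hw : ∀ x y, ContDiff ℝ ∞ fun p => w p x y)
    (x : S) : ContDiff ℝ ∞ fun p => M.leftVec (h p) (a p) (w p) x :=
  (contDiff_const.mul (hh x)).exp.mul (M.contDiff_rightVec hh ha
    (fun x y => ((ha x y).sub (ha y x)).neg.sub (hw x y)) x)

/-- The gauge identity behind `NESSModel.leftVec`: detailed balance turns the transposed tilted
generator into the one with the time-reversed tilt. -/
theorem genMat_reversal (h : S → ℝ) {a w : S → S → ℝ} (hw : ∀ x y, w y x = -w x y) (x y : S) :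
    Real.exp (-M.beta * h x) * M.genMat h a w x y =
      Real.exp (-M.beta * h y) * M.genMat h a (revTilt a w) y x := by
  by_cases hxy : x = y
  · subst hxy; rw [genMat_apply_self, genMat_apply_self]
  · rw [genMat_apply_ne _ _ _ _ (Ne.symm hxy), genMat_apply_ne _ _ _ _ hxy, ← mul_assoc,
      M.eqRateOf_detailed_balance h hxy, ← mul_assoc, revTilt, hw x y]
    congr 2; ring

/-- `rightVec` and `leftVec` are eigenvectors with a common eigenvalue. -/
theorem exists_eigenvalue (h : S → ℝ) {a w : S → S → ℝ} (hw : ∀ x y, w y x = -w x y) :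
    ∃ c : ℝ, M.genMat h a w *ᵥ M.rightVec h a w = c • M.rightVec h a w ∧
      M.leftVec h a w ᵥ* M.genMat h a w = c • M.leftVec h a w := by
  obtain ⟨c, hc⟩ := (M.isIrredMetzler_genMat h a w).perronVec_spec.2.2
  obtain ⟨c', hc'⟩ := (M.isIrredMetzler_genMat h a (revTilt a w)).perronVec_spec.2.2
  have hl : M.leftVec h a w ᵥ* M.genMat h a w = c' • M.leftVec h a w := by
    funext y
    have h1 := congrFun hc' y
    simp only [Pi.smul_apply, smul_eq_mul] at h1
    calc ∑ x, M.leftVec h a w x * M.genMat h a w x y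
        = ∑ x, Real.exp (-M.beta * h y) *
            (M.genMat h a (revTilt a w) y x * M.rightVec h a (revTilt a w) x) := by
          refine Finset.sum_congr rfl fun x _ => ?_
          have := M.genMat_reversal h hw (a := a) x y
          rw [leftVec]
          linear_combination (M.rightVec h a (revTilt a w) x) * this
      _ = Real.exp (-M.beta * h y) * (c' * M.rightVec h a (revTilt a w) y) := by
          rw [← Finset.mul_sum]
          exact congrArg _ h1
      _ = _ := by simp only [Pi.smul_apply, smul_eq_mul, leftVec]; ring
  have hcc : c = c' := eigenvalue_eq (M.rightVec_pos h a w) (M.leftVec_pos h a w) hc hl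
  exact ⟨c, hc, hcc ▸ hl⟩

theorem rowSum_genMat_zero (h : S → ℝ) (a : S → S → ℝ) :
    M.genMat h a (fun _ _ => 0) *ᵥ (fun _ => 1) = 0 := by
  funext x
  rw [Matrix.mulVec, dotProduct, ← Finset.add_sum_erase _ _ (Finset.mem_univ x),
    genMat_apply_self, Finset.filter_ne' Finset.univ x]
  have : ∑ y ∈ Finset.univ.erase x, M.genMat h a (fun _ _ => 0) x y * 1 =
      ∑ y ∈ Finset.univ.erase x, M.eqRateOf h x y * Real.exp (a x y) := by
    refine Finset.sum_congr rfl fun y hy => ?_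
    rw [genMat_apply_ne _ _ _ _ (Finset.ne_of_mem_erase hy)]
    simp
  rw [this]
  simp

theorem rightVec_zero (h : S → ℝ) (a : S → S → ℝ) :
    M.rightVec h a (fun _ _ => 0) = fun _ => 1 := by
  refine ((M.isIrredMetzler_genMat h a (fun _ _ => 0)).eq_perronVec (c := 0) (fun _ => one_pos)
    (by simp) ?_).symm
  rw [rowSum_genMat_zero, zero_smul]

/-- The exponent of the nonequilibrium free energy, for a general tilt:  with the stationary
distribution `ρ` and the eigenvectors `l`, `r`, it is `log (ρ · r) - log (l · 1)`. -/
noncomputable def logRatio (h : S → ℝ) (a w : S → S → ℝ) : ℝ :=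
  Real.log (M.leftVec h a (fun _ _ => 0) ⬝ᵥ M.rightVec h a w) -
    Real.log (∑ x, M.leftVec h a (fun _ _ => 0) x) - Real.log (∑ x, M.leftVec h a w x)

/-- The logarithm of the overlap of the left eigenvector before with the right eigenvector after a
step. -/
noncomputable def logOverlap (h : S → ℝ) (a w : S → S → ℝ) (h' : S → ℝ) (a' w' : S → S → ℝ)
    (k : S → ℝ) : ℝ :=
  Real.log (∑ x, M.leftVec h a w x * Real.exp (k x) * M.rightVec h' a' w' x)

/-- The long-time limit of the difference of the cumulant generating functions for the step protocol
and for its time reversal. -/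
noncomputable def cumulantGap (h : S → ℝ) (a w : S → S → ℝ) (h' : S → ℝ) (a' w' : S → S → ℝ)
    (k : S → ℝ) : ℝ :=
  M.logRatio h a w - M.logRatio h' a' w' + M.logOverlap h a w h' a' w' k -
    M.logOverlap h' a' w' h a w (-k)

theorem cumulantGap_self (h : S → ℝ) (a w : S → S → ℝ) :
    M.cumulantGap h a w h a w 0 = 0 := by
  simp [cumulantGap]

/-- At equilibrium, time reversal symmetry makes the cumulant gap an odd function of the tilts. -/
theorem cumulantGap_neg (h : S → ℝ) (w w' : S → S → ℝ) (k : S → ℝ) :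
    M.cumulantGap h (fun _ _ => 0) (fun x y => -w x y) h (fun _ _ => 0) (fun x y => -w' x y)
      (-k) = -M.cumulantGap h (fun _ _ => 0) w h (fun _ _ => 0) w' k := by
  have hrev : ∀ w : S → S → ℝ, revTilt (fun _ _ => 0) w = fun x y => -w x y := by
    intro w; funext x y; simp [revTilt]
  have h1 : ∀ (w w' : S → S → ℝ) (k : S → ℝ),
      M.logOverlap h (fun _ _ => 0) (fun x y => -w x y) h (fun _ _ => 0) (fun x y => -w' x y) k =
      M.logOverlap h (fun _ _ => 0) w' h (fun _ _ => 0) w k := by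
    intro w w' k
    simp only [logOverlap, leftVec, hrev, neg_neg]
    congr 1
    refine Finset.sum_congr rfl fun x _ => ?_
    ring
  have h2 : ∀ w : S → S → ℝ, M.logRatio h (fun _ _ => 0) (fun x y => -w x y) +
      M.logRatio h (fun _ _ => 0) w = -2 * Real.log (∑ x, Real.exp (-M.beta * h x)) := by
    intro w
    simp only [logRatio, leftVec, hrev, neg_neg, neg_zero, rightVec_zero, mul_one, dotProduct]
    ring
  have h3 := h2 w
  have h4 := h2 w'
  simp only [cumulantGap, h1, neg_neg]
  linarith

/-- At the symmetric point of time reversal the overlaps for the step and for the reversed step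
agree. -/
theorem cumulantGap_half (h h' : S → ℝ) (a a' : S → S → ℝ) :
    M.cumulantGap h a (fun x y => -1 / 2 * (a x y - a y x)) h' a'
      (fun x y => -1 / 2 * (a' x y - a' y x)) (fun x => -1 / 2 * (M.beta * (h' x - h x))) =
    M.logRatio h a (fun x y => -1 / 2 * (a x y - a y x)) -
      M.logRatio h' a' (fun x y => -1 / 2 * (a' x y - a' y x)) := by
  have hrev : ∀ a : S → S → ℝ, revTilt a (fun x y => -1 / 2 * (a x y - a y x)) =
      fun x y => -1 / 2 * (a x y - a y x) := by
    intro a; funext x y; simp only [revTilt]; ring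
  have h1 : M.logOverlap h a (fun x y => -1 / 2 * (a x y - a y x)) h' a'
      (fun x y => -1 / 2 * (a' x y - a' y x)) (fun x => -1 / 2 * (M.beta * (h' x - h x))) =
      M.logOverlap h' a' (fun x y => -1 / 2 * (a' x y - a' y x)) h a
      (fun x y => -1 / 2 * (a x y - a y x)) (-fun x => -1 / 2 * (M.beta * (h' x - h x))) := by
    simp only [logOverlap, leftVec, hrev]
    congr 1
    refine Finset.sum_congr rfl fun x _ => ?_
    have h2 : Real.exp (-M.beta * h x) * Real.exp (-1 / 2 * (M.beta * (h' x - h x))) =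
        Real.exp (-M.beta * h' x) *
          Real.exp ((-fun x => -1 / 2 * (M.beta * (h' x - h x))) x) := by
      rw [← Real.exp_add, ← Real.exp_add, Pi.neg_apply]
      congr 1; ring
    linear_combination (M.rightVec h a (fun x y => -1 / 2 * (a x y - a y x)) x *
      M.rightVec h' a' (fun x y => -1 / 2 * (a' x y - a' y x)) x) * h2
  rw [cumulantGap, h1]; ring

theorem cumulantGap_zero (h h' : S → ℝ) (a a' : S → S → ℝ) :
    M.cumulantGap h a (fun _ _ => 0) h' a' (fun _ _ => 0) 0 = 0 := by
  simp [cumulantGap, logRatio, logOverlap, rightVec_zero, dotProduct]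

theorem contDiff_cumulantGap {X : Type*} [NormedAddCommGroup X] [NormedSpace ℝ X]
    [CompleteSpace X] {h h' k : X → S → ℝ} {a w a' w' : X → S → S → ℝ}
    (hh : ∀ x, ContDiff ℝ ∞ fun p => h p x) (hh' : ∀ x, ContDiff ℝ ∞ fun p => h' p x)
    (hk : ∀ x, ContDiff ℝ ∞ fun p => k p x)
    (ha : ∀ x y, ContDiff ℝ ∞ fun p => a p x y) (hw : ∀ x y, ContDiff ℝ ∞ fun p => w p x y)
    (ha' : ∀ x y, ContDiff ℝ ∞ fun p => a' p x y) (hw' : ∀ x y, ContDiff ℝ ∞ fun p => w' p x y) :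
    ContDiff ℝ ∞ fun p => M.cumulantGap (h p) (a p) (w p) (h' p) (a' p) (w' p) (k p) := by
  have hratio : ∀ {h : X → S → ℝ} {a w : X → S → S → ℝ},
      (∀ x, ContDiff ℝ ∞ fun p => h p x) → (∀ x y, ContDiff ℝ ∞ fun p => a p x y) →
      (∀ x y, ContDiff ℝ ∞ fun p => w p x y) →
      ContDiff ℝ ∞ fun p => M.logRatio (h p) (a p) (w p) := by
    intro h a w hh ha hw
    have hl := M.contDiff_leftVec hh ha hw
    have hl0 := M.contDiff_leftVec hh ha (w := fun _ _ _ => 0) (fun _ _ => contDiff_const)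
    have hr := M.contDiff_rightVec hh ha hw
    refine ContDiff.sub (ContDiff.sub (ContDiff.log (ContDiff.sum fun x _ => (hl0 x).mul (hr x))
      fun p => ?_) (ContDiff.log (ContDiff.sum fun x _ => hl0 x) fun p => ?_))
      (ContDiff.log (ContDiff.sum fun x _ => hl x) fun p => ?_)
    · exact (dotProduct_pos (M.leftVec_pos _ _ _) (M.rightVec_pos _ _ _)).ne'
    · exact (Finset.sum_pos (fun x _ => M.leftVec_pos _ _ _ x) Finset.univ_nonempty).ne'
    · exact (Finset.sum_pos (fun x _ => M.leftVec_pos _ _ _ x) Finset.univ_nonempty).ne'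
  have hover : ∀ {h h' k : X → S → ℝ} {a w a' w' : X → S → S → ℝ},
      (∀ x, ContDiff ℝ ∞ fun p => h p x) → (∀ x, ContDiff ℝ ∞ fun p => h' p x) →
      (∀ x, ContDiff ℝ ∞ fun p => k p x) →
      (∀ x y, ContDiff ℝ ∞ fun p => a p x y) → (∀ x y, ContDiff ℝ ∞ fun p => w p x y) →
      (∀ x y, ContDiff ℝ ∞ fun p => a' p x y) → (∀ x y, ContDiff ℝ ∞ fun p => w' p x y) →
      ContDiff ℝ ∞ fun p => M.logOverlap (h p) (a p) (w p) (h' p) (a' p) (w' p) (k p) := by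
    intro h h' k a w a' w' hh hh' hk ha hw ha' hw'
    have hl := M.contDiff_leftVec hh ha hw
    have hr := M.contDiff_rightVec hh' ha' hw'
    refine ContDiff.log (ContDiff.sum fun x _ => ((hl x).mul (hk x).exp).mul (hr x)) fun p => ?_
    exact (Finset.sum_pos (fun x _ => mul_pos (mul_pos (M.leftVec_pos _ _ _ x) (Real.exp_pos _))
      (M.rightVec_pos _ _ _ x)) Finset.univ_nonempty).ne'
  exact (((hratio hh ha hw).sub (hratio hh' ha' hw')).add
    (hover hh hh' hk ha hw ha' hw')).sub (hover (k := fun p => -k p) hh' hh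
      (fun x => (hk x).neg) ha' hw' ha hw)

/-- The uniform bound on the Taylor remainder of the cumulant gap.  Here `h`, `z` describe the
initial parameters, the final energies are `h + δ m`, the final log-perturbation is
`ε z + δ y`. -/
theorem exists_taylorRem_cumulantGap_bound (K : ℝ) (b b' : ℝ) {n : ℕ} (hn : 1 ≤ n) :
    ∃ C C' : ℝ, 0 ≤ C ∧ 0 ≤ C' ∧ ∀ (h m : S → ℝ) (z y : S → S → ℝ),
      (∀ x, |h x| ≤ K) → (∀ x, |m x| ≤ K) → (∀ x x', |z x x'| ≤ K) → (∀ x x', |y x x'| ≤ K) →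
      ∀ ε ∈ Set.Icc 0 b, ∀ δ ∈ Set.Icc 0 b',
      |taylorRem (2 * n) (fun u => M.cumulantGap h (fun x x' => ε * z x x')
        (fun x x' => u * ε * (z x x' - z x' x)) (fun x => h x + δ * m x)
        (fun x x' => ε * z x x' + δ * y x x')
        (fun x x' => u * ε * (z x x' - z x' x) + u * δ * (y x x' - y x' x))
        (fun x => u * δ * (M.beta * m x)))| ≤ C * ε ^ (2 * n) * δ + C' * δ ^ 2 := by
  set g : ℝ × ℝ × ℝ × ℝ × (S → ℝ) × (S → ℝ) × (S → S → ℝ) × (S → S → ℝ) →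
      ℝ := fun p =>
    M.cumulantGap p.2.2.2.2.1 (fun x x' => p.2.2.1 * p.2.2.2.2.2.2.1 x x')
      (fun x x' => p.1 * (p.2.2.2.2.2.2.1 x x' - p.2.2.2.2.2.2.1 x' x))
      (fun x => p.2.2.2.2.1 x + p.2.2.2.1 * p.2.2.2.2.2.1 x)
      (fun x x' => p.2.2.1 * p.2.2.2.2.2.2.1 x x' + p.2.2.2.1 * p.2.2.2.2.2.2.2 x x')
      (fun x x' => p.1 * (p.2.2.2.2.2.2.1 x x' - p.2.2.2.2.2.2.1 x' x) +
        p.2.1 * (p.2.2.2.2.2.2.2 x x' - p.2.2.2.2.2.2.2 x' x))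
      (fun x => p.2.1 * (M.beta * p.2.2.2.2.2.1 x)) with hg
  have hgs : ContDiff ℝ ∞ g := by
    refine M.contDiff_cumulantGap ?_ ?_ ?_ ?_ ?_ ?_ ?_ <;> intros <;> fun_prop
  have hK : IsCompact (Metric.closedBall
      (0 : (S → ℝ) × (S → ℝ) × (S → S → ℝ) × (S → S → ℝ)) |K|) := isCompact_closedBall _ _
  obtain ⟨C, C', hC, hC', hb⟩ := exists_taylorRem_bound hK b b' hn hgs
    (fun v ε q => by
      have := M.cumulantGap_self q.1 (fun x x' => ε * q.2.2.1 x x')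
        (fun x x' => v * (q.2.2.1 x x' - q.2.2.1 x' x))
      simp only [hg, zero_mul, add_zero]
      exact this)
    (fun v σ q => by
      have := M.cumulantGap_neg q.1 (fun x x' => v * (q.2.2.1 x x' - q.2.2.1 x' x))
        (fun x x' => v * (q.2.2.1 x x' - q.2.2.1 x' x) + σ * (q.2.2.2 x x' - q.2.2.2 x' x))
        (fun x => σ * (M.beta * q.2.1 x))
      simp only [hg, zero_mul, add_zero, neg_mul, ← neg_add]
      exact this)
  refine ⟨C, C', hC, hC', fun h m z y hh hm hz hy ε hε δ hδ => ?_⟩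
  have hq : (h, m, z, y) ∈ Metric.closedBall
      (0 : (S → ℝ) × (S → ℝ) × (S → S → ℝ) × (S → S → ℝ)) |K| := by
    rw [mem_closedBall_zero_iff]
    have h1 : ∀ f : S → ℝ, (∀ x, |f x| ≤ K) → ‖f‖ ≤ |K| := fun f hf =>
      (pi_norm_le_iff_of_nonneg (abs_nonneg K)).2 fun x => (hf x).trans (le_abs_self K)
    have h2 : ∀ f : S → S → ℝ, (∀ x x', |f x x'| ≤ K) → ‖f‖ ≤ |K| := fun f hf =>
      (pi_norm_le_iff_of_nonneg (abs_nonneg K)).2 fun x => h1 _ (hf x)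
    simp only [Prod.norm_mk, max_le_iff]
    exact ⟨h1 h hh, h1 m hm, h2 z hz, h2 y hy⟩
  exact hb _ hq ε hε δ hδ

end NESSModel

end TiltedGenerators

/-! ### Limits for long times -/

section LongTimeLimits

open scoped Matrix Matrix.Norms.Operator

theorem contDiff_matrix {S : Type*} [Fintype S] [DecidableEq S] {X : Type*}
    [NormedAddCommGroup X] [NormedSpace ℝ X] {N : X → Matrix S S ℝ}
    (hN : ∀ x y, ContDiff ℝ ∞ fun p => N p x y) : ContDiff ℝ ∞ N := by
  have h1 : N = fun p => ∑ x, ∑ y, N p x y • Matrix.single x y (1 : ℝ) := by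
    funext p
    conv_lhs => rw [Matrix.matrix_eq_sum_single (N p)]
    simp [Matrix.smul_single]
  rw [h1]
  exact ContDiff.sum fun x _ => ContDiff.sum fun y _ => (hN x y).smul contDiff_const

theorem IsIrredMetzler.smul {S : Type*} {L : Matrix S S ℝ} (hL : IsIrredMetzler L) {c : ℝ}
    (hc : 0 < c) : IsIrredMetzler (c • L) where
  nonneg x y h := mul_nonneg hc.le (hL.nonneg x y h)
  conn x y := Relation.ReflTransGen.mono
    (fun _ _ h => ⟨h.1, mul_ne_zero hc.ne' h.2⟩) _ _ (hL.conn x y)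

/-- The functional `N ↦ ι · N φ` on matrices. -/
noncomputable def matrixForm {S : Type*} [Fintype S] [DecidableEq S] (ι φ : S → ℝ) :
    Matrix S S ℝ →L[ℝ] ℝ :=
  LinearMap.toContinuousLinearMap
    { toFun := fun N => ι ⬝ᵥ (N *ᵥ φ)
      map_add' := fun N N' => by rw [Matrix.add_mulVec, dotProduct_add]
      map_smul' := fun c N => by rw [Matrix.smul_mulVec, dotProduct_smul]; rfl }

theorem matrixForm_apply {S : Type*} [Fintype S] [DecidableEq S] (ι φ : S → ℝ)
    (N : Matrix S S ℝ) : matrixForm ι φ N = ι ⬝ᵥ (N *ᵥ φ) := rfl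

theorem matrixForm_perronProj {S : Type*} [Fintype S] [DecidableEq S] (ι φ l r : S → ℝ) :
    matrixForm ι φ (perronProj l r) = (l ⬝ᵥ r)⁻¹ * ((ι ⬝ᵥ r) * (l ⬝ᵥ φ)) := by
  rw [matrixForm_apply, perronProj, Matrix.smul_mulVec, Matrix.vecMulVec_mulVec, op_smul_eq_smul,
    dotProduct_smul, dotProduct_smul, smul_eq_mul, smul_eq_mul, mul_comm (ι ⬝ᵥ r)]

namespace NESSModel

set_option linter.unusedSectionVars false

variable {S : Type*} {d e : ℕ} (M : NESSModel S d e)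

open Classical in
/-- The nonequilibrium function, set to zero where there is no transition. -/
noncomputable def cutXi (κ : EuclideanSpace ℝ (Fin e)) (x y : S) : ℝ :=
  if x ≠ y ∧ M.c x y ≠ 0 then M.xi κ x y else 0

/-- The logarithm of the perturbation of the rates. -/
noncomputable def logPert (α : Param d e) (x y : S) : ℝ := α.eps * M.cutXi α.kappa x y

/-- The antisymmetric part of the log-perturbation, which is the value of `NESSModel.psi` at the
possible transitions. -/
noncomputable def force (α : Param d e) (x y : S) : ℝ := M.logPert α x y - M.logPert α y x

theorem eqRate_eq_zero (ν : EuclideanSpace ℝ (Fin d)) {x y : S} (hc : M.c x y = 0) :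
    M.eqRate ν x y = 0 := by
  obtain ⟨r, -, h1⟩ := M.exists_eqRateOf_eq (M.H ν) x y
  rw [eqRate_eq, h1, hc, zero_mul]

/-- Where `c x y = 0` both sides vanish. -/
theorem rate_eq (α : Param d e) {x y : S} (hxy : x ≠ y) :
    M.rate α x y = M.eqRateOf (M.H α.nu) x y * Real.exp (M.logPert α x y) := by
  by_cases hc : M.c x y = 0
  · rw [rate, ← eqRate_eq, M.eqRate_eq_zero _ hc]; simp
  · rw [rate, logPert, cutXi, if_pos ⟨hxy, hc⟩, eqRate_eq, mul_comm]

theorem rate_nonneg (α : Param d e) {x y : S} (hxy : x ≠ y) : 0 ≤ M.rate α x y :=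
  mul_nonneg (Real.exp_pos _).le (M.eqRateOf_nonneg (M.H α.nu) hxy)

theorem psi_eq (α : Param d e) {x y : S} (hxy : x ≠ y) (hc : M.c x y ≠ 0) :
    M.psi α x y = M.force α x y := by
  have hc' : M.c y x ≠ 0 := M.c_symm x y hxy ▸ hc
  have h1 := M.eqRateOf_ne_zero (M.H α.nu) hc
  have h2 := M.eqRateOf_ne_zero (M.H α.nu) hc'
  have h3 : M.eqRateOf (M.H α.nu) x y / M.eqRateOf (M.H α.nu) y x =
      Real.exp (M.beta * (M.H α.nu x - M.H α.nu y)) := by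
    have := M.eqRateOf_detailed_balance (M.H α.nu) hxy
    rw [div_eq_iff h2, ← mul_right_inj' (Real.exp_pos (-M.beta * M.H α.nu x)).ne', this,
      ← mul_assoc, ← Real.exp_add]
    congr 2; ring
  have h4 : M.rate α x y / M.rate α y x =
      Real.exp (M.force α x y + M.beta * (M.H α.nu x - M.H α.nu y)) := by
    rw [M.rate_eq α hxy, M.rate_eq α hxy.symm, mul_div_mul_comm, h3, ← Real.exp_sub,
      ← Real.exp_add, force]
    congr 1; ring
  rw [psi, theta, h4, Real.log_exp]
  ring

variable [Fintype S] [DecidableEq S]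

/-- Where `c x y = 0` the value of `ψ` is not the antisymmetric part of the log-perturbation, but
then the rate vanishes. -/
theorem tilted_eq (α : Param d e) (u : ℝ) :
    M.tilted α u = M.genMat (M.H α.nu) (M.logPert α) (fun x y => u * M.force α x y) := by
  ext x y
  by_cases hxy : y = x
  · subst hxy
    rw [genMat_apply_self, tilted, if_pos rfl, escape]
    congr 1
    exact Finset.sum_congr rfl fun z hz => M.rate_eq α (Finset.mem_filter.1 hz).2.symm
  · rw [genMat_apply_ne _ _ _ _ hxy, tilted, if_neg hxy]
    by_cases hc : M.c x y = 0
    · rw [rate, ← eqRate_eq, M.eqRate_eq_zero _ hc]; simp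
    · rw [M.psi_eq α (Ne.symm hxy) hc, M.rate_eq α (Ne.symm hxy), Real.exp_add, mul_assoc]

theorem isIrredMetzler_tilted (α : Param d e) (u : ℝ) : IsIrredMetzler (M.tilted α u) :=
  M.tilted_eq α u ▸ M.isIrredMetzler_genMat _ _ _

theorem force_antisymm (α : Param d e) (x y : S) : M.force α y x = -M.force α x y := by
  simp [force]

variable [Nonempty S]

/-- The right Perron vector of the generator tilted by `exp (u ψ)`. -/
noncomputable def rightAt (α : Param d e) (u : ℝ) : S → ℝ :=
  M.rightVec (M.H α.nu) (M.logPert α) (fun x y => u * M.force α x y)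

/-- The left Perron vector of the generator tilted by `exp (u ψ)`. -/
noncomputable def leftAt (α : Param d e) (u : ℝ) : S → ℝ :=
  M.leftVec (M.H α.nu) (M.logPert α) (fun x y => u * M.force α x y)

/-- The Perron eigenvalue of the generator tilted by `exp (u ψ)`, read off at one state. -/
noncomputable def eigAt (α : Param d e) (u : ℝ) : ℝ :=
  (M.tilted α u *ᵥ M.rightAt α u) (Classical.arbitrary S) / M.rightAt α u (Classical.arbitrary S)

/-- The tilted generator, shifted to have Perron eigenvalue zero. -/
noncomputable def shifted (α : Param d e) (u : ℝ) : Matrix S S ℝ :=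
  M.tilted α u - M.eigAt α u • (1 : Matrix S S ℝ)

/-- The Perron projection of the generator tilted by `exp (u ψ)`. -/
noncomputable def projAt (α : Param d e) (u : ℝ) : Matrix S S ℝ :=
  perronProj (M.leftAt α u) (M.rightAt α u)

theorem rightAt_pos (α : Param d e) (u : ℝ) (x : S) : 0 < M.rightAt α u x :=
  M.rightVec_pos _ _ _ x

theorem leftAt_pos (α : Param d e) (u : ℝ) (x : S) : 0 < M.leftAt α u x :=
  M.leftVec_pos _ _ _ x

theorem rightAt_zero (α : Param d e) : M.rightAt α 0 = fun _ => 1 := by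
  simp only [rightAt, zero_mul]
  exact M.rightVec_zero _ _

theorem leftAt_zero (α : Param d e) :
    M.leftAt α 0 = M.leftVec (M.H α.nu) (M.logPert α) (fun _ _ => 0) := by
  simp only [leftAt, zero_mul]

theorem eigenvector_tilted (α : Param d e) (u : ℝ) :
    M.tilted α u *ᵥ M.rightAt α u = M.eigAt α u • M.rightAt α u ∧
      M.leftAt α u ᵥ* M.tilted α u = M.eigAt α u • M.leftAt α u := by
  obtain ⟨c, h1, h2⟩ := M.exists_eigenvalue (M.H α.nu) (a := M.logPert α)
    (w := fun x y => u * M.force α x y) (fun x y => by rw [M.force_antisymm]; ring)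
  rw [← tilted_eq] at h1 h2
  have h3 : M.eigAt α u = c := by
    have := congrFun h1 (Classical.arbitrary S)
    rw [eigAt, div_eq_iff (M.rightAt_pos α u _).ne']
    exact this
  rw [h3]
  exact ⟨h1, h2⟩

theorem tilted_zero_mulVec (α : Param d e) : M.tilted α 0 *ᵥ (fun _ => 1) = 0 := by
  rw [tilted_eq]
  simp only [zero_mul]
  exact M.rowSum_genMat_zero _ _

theorem eigAt_zero (α : Param d e) : M.eigAt α 0 = 0 := by
  rw [eigAt, rightAt_zero, tilted_zero_mulVec]; simp

theorem shifted_mulVec (α : Param d e) (u : ℝ) : M.shifted α u *ᵥ M.rightAt α u = 0 := by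
  rw [shifted, Matrix.sub_mulVec, (M.eigenvector_tilted α u).1, Matrix.smul_mulVec,
    Matrix.one_mulVec, sub_self]

theorem vecMul_shifted (α : Param d e) (u : ℝ) : M.leftAt α u ᵥ* M.shifted α u = 0 := by
  rw [shifted, Matrix.vecMul_sub, (M.eigenvector_tilted α u).2, Matrix.vecMul_smul,
    Matrix.vecMul_one, sub_self]

theorem exp_smul_tilted (α : Param d e) (u τ : ℝ) :
    NormedSpace.exp (τ • M.tilted α u) =
      Real.exp (τ * M.eigAt α u) • NormedSpace.exp (τ • M.shifted α u) := by
  have h1 : τ • M.tilted α u =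
      algebraMap ℝ (Matrix S S ℝ) (τ * M.eigAt α u) + τ • M.shifted α u := by
    rw [shifted, Algebra.algebraMap_eq_smul_one, smul_sub, smul_smul]; abel
  have h2 : Commute (algebraMap ℝ (Matrix S S ℝ) (τ * M.eigAt α u)) (τ • M.shifted α u) :=
    Algebra.commutes _ _
  have h3 : NormedSpace.exp (algebraMap ℝ (Matrix S S ℝ) (τ * M.eigAt α u)) =
      algebraMap ℝ (Matrix S S ℝ) (Real.exp (τ * M.eigAt α u)) := by
    rw [Real.exp_eq_exp_ℝ]
    exact (NormedSpace.algebraMap_exp_comm (𝔸 := Matrix S S ℝ) _).symm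
  rw [h1, Matrix.exp_add_of_commute _ _ h2, h3, Algebra.algebraMap_eq_smul_one, smul_mul_assoc,
    one_mul]

theorem contDiff_rightAt (α : Param d e) (x : S) : ContDiff ℝ ∞ fun u => M.rightAt α u x :=
  M.contDiff_rightVec (h := fun _ => M.H α.nu) (a := fun _ => M.logPert α)
    (w := fun u x y => u * M.force α x y) (fun _ => contDiff_const) (fun _ _ => contDiff_const)
    (fun _ _ => contDiff_id.mul contDiff_const) x

theorem contDiff_leftAt (α : Param d e) (x : S) : ContDiff ℝ ∞ fun u => M.leftAt α u x :=
  M.contDiff_leftVec (h := fun _ => M.H α.nu) (a := fun _ => M.logPert α)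
    (w := fun u x y => u * M.force α x y) (fun _ => contDiff_const) (fun _ _ => contDiff_const)
    (fun _ _ => contDiff_id.mul contDiff_const) x

theorem contDiff_tilted_apply (α : Param d e) (x y : S) :
    ContDiff ℝ ∞ fun u => M.tilted α u x y := by
  simp only [tilted_eq]
  exact M.contDiff_genMat (h := fun _ => M.H α.nu) (a := fun _ => M.logPert α)
    (w := fun u x y => u * M.force α x y) (fun _ => contDiff_const) (fun _ _ => contDiff_const)
    (fun _ _ => contDiff_id.mul contDiff_const) x y

theorem contDiff_tilted (α : Param d e) : ContDiff ℝ ∞ (M.tilted α) :=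
  contDiff_matrix (M.contDiff_tilted_apply α)

theorem contDiff_eigAt (α : Param d e) : ContDiff ℝ ∞ (M.eigAt α) :=
  (ContDiff.sum fun y _ => (M.contDiff_tilted_apply α _ y).mul (M.contDiff_rightAt α y)).div
    (M.contDiff_rightAt α _) fun u => (M.rightAt_pos α u _).ne'

theorem contDiff_shifted (α : Param d e) : ContDiff ℝ ∞ (M.shifted α) :=
  (M.contDiff_tilted α).sub ((M.contDiff_eigAt α).smul contDiff_const)

theorem contDiff_projAt (α : Param d e) : ContDiff ℝ ∞ (M.projAt α) := by
  refine contDiff_matrix fun x y => ?_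
  exact ((ContDiff.sum fun z _ => (M.contDiff_leftAt α z).mul (M.contDiff_rightAt α z)).inv
    fun u => (dotProduct_pos (M.leftAt_pos α u) (M.rightAt_pos α u)).ne').mul
    ((M.contDiff_rightAt α x).mul (M.contDiff_leftAt α y))

theorem contDiff_exp_smul_shifted (α : Param d e) (τ : ℝ) :
    ContDiff ℝ ∞ fun u => NormedSpace.exp (τ • M.shifted α u) :=
  contDiff_normedSpace_exp.comp ((M.contDiff_shifted α).const_smul τ)

theorem tendsto_exp_shifted_sub_pow (α : Param d e) (u : ℝ) :
    Tendsto (fun m : ℕ => (NormedSpace.exp (M.shifted α u) - M.projAt α u) ^ m) atTop (𝓝 0) :=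
  ((M.isIrredMetzler_tilted α u).sub_smul_one _).tendsto_exp_sub_pow (M.leftAt_pos α u)
    (M.rightAt_pos α u) (M.shifted_mulVec α u) (M.vecMul_shifted α u)

/-- Convergence of all derivatives at the tilt `0`. -/
theorem jetTendsto_exp_shifted (α : Param d e) :
    JetTendsto (fun (τ : ℝ) u => NormedSpace.exp (τ • M.shifted α u)) atTop (M.projAt α) :=
  jetTendsto_exp_smul (M.contDiff_shifted α) (M.contDiff_projAt α)
    (fun u => mul_perronProj (M.shifted_mulVec α u))
    (fun u => perronProj_mul (M.vecMul_shifted α u))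
    (fun u => perronProj_mul_self (M.leftAt_pos α u) (M.rightAt_pos α u))
    (M.tendsto_exp_shifted_sub_pow α 0)

/-- Convergence at an arbitrary tilt, from the constant family. -/
theorem tendsto_exp_shifted (α : Param d e) (u : ℝ) :
    Tendsto (fun τ : ℝ => NormedSpace.exp (τ • M.shifted α u)) atTop (𝓝 (M.projAt α u)) := by
  have := jetTendsto_exp_smul (B := fun _ => M.shifted α u) (P := fun _ => M.projAt α u)
    contDiff_const contDiff_const (fun _ => mul_perronProj (M.shifted_mulVec α u))
    (fun _ => perronProj_mul (M.vecMul_shifted α u))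
    (fun _ => perronProj_mul_self (M.leftAt_pos α u) (M.rightAt_pos α u))
    (M.tendsto_exp_shifted_sub_pow α u) 0
  simp only [iteratedDeriv_zero] at this
  exact this

/-! ### The stationary distribution -/

theorem isStationary_iff (α : Param d e) (ρ : S → ℝ) : M.IsStationary α ρ ↔
    (∀ x, 0 ≤ ρ x) ∧ ∑ x, ρ x = 1 ∧ ρ ᵥ* M.tilted α 0 = 0 := by
  have h1 : ∀ x, -M.escape α x * ρ x + ∑ y with y ≠ x, ρ y * M.rate α y x =
      (ρ ᵥ* M.tilted α 0) x := by
    intro x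
    rw [Matrix.vecMul, dotProduct, ← Finset.add_sum_erase _ _ (Finset.mem_univ x),
      Finset.filter_ne' Finset.univ x]
    congr 1
    · rw [tilted, if_pos rfl, mul_comm]
    · refine Finset.sum_congr rfl fun y hy => ?_
      rw [tilted, if_neg (Finset.ne_of_mem_erase hy).symm]
      simp
  simp only [IsStationary, h1, funext_iff, Pi.zero_apply]

theorem stationary_eq (α : Param d e) :
    M.stationary α = (∑ x, M.leftAt α 0 x)⁻¹ • M.leftAt α 0 := by
  have hs : 0 < ∑ x, M.leftAt α 0 x :=
    Finset.sum_pos (fun x _ => M.leftAt_pos α 0 x) Finset.univ_nonempty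
  have hl : M.leftAt α 0 ᵥ* M.tilted α 0 = 0 := by
    rw [(M.eigenvector_tilted α 0).2, eigAt_zero, zero_smul]
  have hex : M.IsStationary α ((∑ x, M.leftAt α 0 x)⁻¹ • M.leftAt α 0) := by
    refine (M.isStationary_iff α _).2 ⟨fun x => ?_, ?_, ?_⟩
    · exact mul_nonneg (inv_nonneg.2 hs.le) (M.leftAt_pos α 0 x).le
    · simp only [Pi.smul_apply, smul_eq_mul]
      rw [← Finset.mul_sum, inv_mul_cancel₀ hs.ne']
    · rw [Matrix.smul_vecMul, hl, smul_zero]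
  obtain ⟨-, hsum, hst⟩ := (M.isStationary_iff α _).1
    (Classical.epsilon_spec (p := M.IsStationary α) ⟨_, hex⟩)
  obtain ⟨c, hc⟩ := eigenvector_unique
    (M.isIrredMetzler_tilted α 0).transpose.exp_apply_pos (M.leftAt_pos α 0)
    (exp_mulVec_of_eigenvector (c := 0) (by rw [Matrix.mulVec_transpose, hl, zero_smul]))
    (exp_mulVec_of_eigenvector (c := 0) (v := Classical.epsilon (M.IsStationary α))
      (by rw [Matrix.mulVec_transpose, hst, zero_smul]))
  rw [stationary]
  rw [hc] at hsum ⊢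
  simp only [Pi.smul_apply, smul_eq_mul] at hsum
  rw [← Finset.mul_sum] at hsum
  rw [eq_inv_of_mul_eq_one_left hsum]

theorem stationary_pos (α : Param d e) (x : S) : 0 < M.stationary α x := by
  rw [stationary_eq]
  exact mul_pos (inv_pos.2 (Finset.sum_pos (fun x _ => M.leftAt_pos α 0 x) Finset.univ_nonempty))
    (M.leftAt_pos α 0 x)

theorem sum_stationary (α : Param d e) : ∑ x, M.stationary α x = 1 := by
  have hs : 0 < ∑ x, M.leftAt α 0 x :=
    Finset.sum_pos (fun x _ => M.leftAt_pos α 0 x) Finset.univ_nonempty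
  simp only [stationary_eq, Pi.smul_apply, smul_eq_mul]
  rw [← Finset.mul_sum, inv_mul_cancel₀ hs.ne']

theorem log_stationary_dotProduct (α : Param d e) (u : ℝ) :
    Real.log (M.stationary α ⬝ᵥ M.rightAt α u) - Real.log (∑ x, M.leftAt α u x) =
      M.logRatio (M.H α.nu) (M.logPert α) (fun x y => u * M.force α x y) := by
  have hs : 0 < ∑ x, M.leftAt α 0 x :=
    Finset.sum_pos (fun x _ => M.leftAt_pos α 0 x) Finset.univ_nonempty
  rw [stationary_eq, smul_dotProduct, smul_eq_mul, Real.log_mul (inv_ne_zero hs.ne')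
    (dotProduct_pos (M.leftAt_pos α 0) (M.rightAt_pos α u)).ne', Real.log_inv, logRatio,
    ← leftAt_zero]
  simp only [leftAt, rightAt]
  ring

/-! ### The nonequilibrium free energy -/

/-- The nonequilibrium free energy, in terms of the Perron vectors for the tilt `-1/2`. -/
noncomputable def freeEnergy (α : Param d e) : ℝ :=
  M.logRatio (M.H α.nu) (M.logPert α) (fun x y => -1 / 2 * M.force α x y) / M.beta

theorem workPsi_const (a b : ℝ) (α : Param d e) (p : JumpPath S) :
    M.workPsi a b (fun _ => α) p = M.Psi (fun _ => α) p := by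
  simp [workPsi, work]

/-- The tilt `-1/2` is its own time reversal. -/
theorem leftAt_half (α : Param d e) (x : S) :
    M.leftAt α (-1 / 2) x = Real.exp (-M.beta * M.H α.nu x) * M.rightAt α (-1 / 2) x := by
  have : revTilt (M.logPert α) (fun x y => -1 / 2 * M.force α x y) =
      fun x y => -1 / 2 * M.force α x y := by
    funext x y; simp only [revTilt, force]; ring
  rw [leftAt, leftVec, this, rightAt]

theorem isFreeEnergy_freeEnergy (α : Param d e) : M.IsFreeEnergy α (M.freeEnergy α) := by
  intro x
  set u : ℝ := -1 / 2 with hu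
  set δx : S → ℝ := fun z => if z = x then 1 else 0 with hδ
  have hnum : ∀ᶠ τ : ℝ in atTop, M.expectFrom (-τ) (-τ / 2) (fun _ => α) x
      (fun p => Real.exp (-M.Psi (fun _ => α) p / 2)) =
      Real.exp (τ / 2 * M.eigAt α u) *
        matrixForm δx (fun _ => 1) (NormedSpace.exp ((τ / 2) • M.shifted α u)) := by
    filter_upwards [eventually_gt_atTop 0] with τ hτ
    have h1 := pathIntegral_const (M := M) α (a := -τ) (b := -τ / 2) (by linarith) u δx
      (fun _ => 1)
    rw [show -τ / 2 - -τ = τ / 2 by ring, exp_smul_tilted, ← matrixForm_apply, map_smul,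
      smul_eq_mul] at h1
    rw [← h1, expectFrom]
    congr 1
    funext p
    rw [workPsi_const, mul_one, hδ, hu]
    congr 3; ring
  have hden : ∀ᶠ τ : ℝ in atTop, M.expectStTo (τ / 2) τ (fun _ => α) x
      (fun p => Real.exp (-M.Psi (fun _ => α) p / 2)) =
      Real.exp (τ / 2 * M.eigAt α u) *
        matrixForm (M.stationary α) δx (NormedSpace.exp ((τ / 2) • M.shifted α u)) := by
    filter_upwards [eventually_gt_atTop 0] with τ hτ
    have h1 := pathIntegral_const (M := M) α (a := τ / 2) (b := τ) (by linarith) u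
      (M.stationary α) δx
    rw [show τ - τ / 2 = τ / 2 by ring, exp_smul_tilted, ← matrixForm_apply, map_smul,
      smul_eq_mul] at h1
    rw [← h1, expectStTo]
    congr 1
    funext p
    rw [workPsi_const, hδ, hu]
    congr 4; ring
  have hlim : Tendsto (fun τ : ℝ => NormedSpace.exp ((τ / 2) • M.shifted α u)) atTop
      (𝓝 (M.projAt α u)) :=
    (M.tendsto_exp_shifted α u).comp (tendsto_id.atTop_div_const two_pos)
  have hl := M.leftAt_pos α u
  have hr := M.rightAt_pos α u
  have hlr : 0 < M.leftAt α u ⬝ᵥ M.rightAt α u := dotProduct_pos hl hr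
  have hsr : 0 < M.stationary α ⬝ᵥ M.rightAt α u := dotProduct_pos (M.stationary_pos α) hr
  have hls : 0 < ∑ z, M.leftAt α u z := Finset.sum_pos (fun z _ => hl z) Finset.univ_nonempty
  have hl1 : M.leftAt α u ⬝ᵥ (fun _ => 1) = ∑ z, M.leftAt α u z := by simp [dotProduct]
  have hδr : ∀ v : S → ℝ, δx ⬝ᵥ v = v x := fun v => by simp [dotProduct, hδ]
  have hδl : ∀ v : S → ℝ, v ⬝ᵥ δx = v x := fun v => by simp [dotProduct, hδ]
  have h1 : matrixForm δx (fun _ => 1) (M.projAt α u) =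
      (M.leftAt α u ⬝ᵥ M.rightAt α u)⁻¹ * (M.rightAt α u x * ∑ z, M.leftAt α u z) := by
    rw [projAt, matrixForm_perronProj, hδr, hl1]
  have h2 : matrixForm (M.stationary α) δx (M.projAt α u) =
      (M.leftAt α u ⬝ᵥ M.rightAt α u)⁻¹ *
        ((M.stationary α ⬝ᵥ M.rightAt α u) * M.leftAt α u x) := by
    rw [projAt, matrixForm_perronProj, hδl]
  have hhalf : M.leftAt α u x = Real.exp (-M.beta * M.H α.nu x) * M.rightAt α u x :=
    M.leftAt_half α x
  have h3 : matrixForm (M.stationary α) δx (M.projAt α u) ≠ 0 := by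
    rw [h2]
    exact (mul_pos (inv_pos.2 hlr) (mul_pos hsr (hl x))).ne'
  -- the dependence on `x` cancels since `leftAt` and `rightAt` differ by `exp (-β H)` only
  have h4 : Real.exp (-M.beta * M.freeEnergy α) = Real.exp (-M.beta * M.H α.nu x) *
      (matrixForm δx (fun _ => 1) (M.projAt α u) /
        matrixForm (M.stationary α) δx (M.projAt α u)) := by
    have h5 : -M.beta * M.freeEnergy α =
        Real.log (∑ z, M.leftAt α u z) - Real.log (M.stationary α ⬝ᵥ M.rightAt α u) := by
      have h6 : M.beta * M.freeEnergy α = M.logRatio (M.H α.nu) (M.logPert α)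
          (fun x y => u * M.force α x y) := mul_div_cancel₀ _ M.beta_pos.ne'
      rw [← M.log_stationary_dotProduct α u] at h6
      linarith
    rw [h5, Real.exp_sub, Real.exp_log hls, Real.exp_log hsr, h1, h2, hhalf]
    have := (Real.exp_pos (-M.beta * M.H α.nu x)).ne'
    have := (hr x).ne'
    have := hlr.ne'
    have := hsr.ne'
    field_simp
  rw [h4]
  have hmain := (((matrixForm δx fun _ => 1).continuous.tendsto _).comp hlim).div
    (((matrixForm (M.stationary α) δx).continuous.tendsto _).comp hlim) h3
  refine (hmain.const_mul (Real.exp (-M.beta * M.H α.nu x))).congr' ?_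
  filter_upwards [hnum, hden] with τ hn hd
  rw [hn, hd, mul_div_mul_left _ _ (Real.exp_pos _).ne']
  rfl

/-! ### Cumulants of `β W + Ψ` for long times -/

/-- The work factor of a step from `α₀` to `α₁`. -/
noncomputable def stepFactor (α₀ α₁ : Param d e) (u : ℝ) : Matrix S S ℝ :=
  Matrix.diagonal fun x => Real.exp (u * (M.beta * (M.H α₁.nu x - M.H α₀.nu x)))

/-- The moment generating function of `β W + Ψ` on `[-τ, τ]` for a two-step protocol, up to the
exponential growth in `τ`. -/
noncomputable def reducedMgf (α₀ α₁ : Param d e) (τ u : ℝ) : ℝ :=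
  matrixForm (M.stationary α₀) (fun _ => 1) (NormedSpace.exp (τ • M.shifted α₀ u) *
    M.stepFactor α₀ α₁ u * NormedSpace.exp (τ • M.shifted α₁ u))

/-- The limit of `NESSModel.reducedMgf` for long times. -/
noncomputable def limitMgf (α₀ α₁ : Param d e) (u : ℝ) : ℝ :=
  matrixForm (M.stationary α₀) (fun _ => 1) (M.projAt α₀ u * M.stepFactor α₀ α₁ u * M.projAt α₁ u)

theorem contDiff_stepFactor (α₀ α₁ : Param d e) : ContDiff ℝ ∞ (M.stepFactor α₀ α₁) := by
  refine contDiff_matrix fun x y => ?_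
  simp only [stepFactor, Matrix.diagonal_apply]
  split_ifs
  · exact (contDiff_id.mul contDiff_const).exp
  · exact contDiff_const

theorem contDiff_reducedMgf (α₀ α₁ : Param d e) (τ : ℝ) :
    ContDiff ℝ ∞ (M.reducedMgf α₀ α₁ τ) :=
  (ContinuousLinearMap.contDiff _).comp (((M.contDiff_exp_smul_shifted α₀ τ).mul
    (M.contDiff_stepFactor α₀ α₁)).mul (M.contDiff_exp_smul_shifted α₁ τ))

theorem contDiff_limitMgf (α₀ α₁ : Param d e) : ContDiff ℝ ∞ (M.limitMgf α₀ α₁) :=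
  (ContinuousLinearMap.contDiff _).comp (((M.contDiff_projAt α₀).mul
    (M.contDiff_stepFactor α₀ α₁)).mul (M.contDiff_projAt α₁))

theorem jetTendsto_reducedMgf (α₀ α₁ : Param d e) :
    JetTendsto (M.reducedMgf α₀ α₁) atTop (M.limitMgf α₀ α₁) := by
  have h0 := M.contDiff_exp_smul_shifted α₀
  have h1 := M.contDiff_exp_smul_shifted α₁
  have hD := M.contDiff_stepFactor α₀ α₁
  have hP0 := M.contDiff_projAt α₀
  have hP1 := M.contDiff_projAt α₁
  exact ((((M.jetTendsto_exp_shifted α₀).mul (JetTendsto.const (M.stepFactor α₀ α₁)) h0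
    (fun _ => hD) hP0 hD).mul (M.jetTendsto_exp_shifted α₁) (fun τ => (h0 τ).mul hD) h1
    (hP0.mul hD) hP1).clm (fun τ => ((h0 τ).mul hD).mul (h1 τ)) ((hP0.mul hD).mul hP1)
    (matrixForm (M.stationary α₀) fun _ => 1))

theorem matrixForm_step_pos (α₀ α₁ : Param d e) (u : ℝ) {N₀ N₁ : Matrix S S ℝ}
    (h₀ : ∀ x y, 0 < N₀ x y) (h₁ : ∀ x y, 0 < N₁ x y) :
    0 < matrixForm (M.stationary α₀) (fun _ => 1) (N₀ * M.stepFactor α₀ α₁ u * N₁) := by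
  rw [matrixForm_apply, ← Matrix.mulVec_mulVec, ← Matrix.mulVec_mulVec]
  refine dotProduct_pos (M.stationary_pos α₀) fun x => ?_
  refine dotProduct_pos (h₀ x) fun y => ?_
  rw [stepFactor, Matrix.mulVec_diagonal]
  exact mul_pos (Real.exp_pos _) (dotProduct_pos (h₁ y) fun _ => one_pos)

theorem reducedMgf_pos (α₀ α₁ : Param d e) {τ : ℝ} (hτ : 0 < τ) (u : ℝ) :
    0 < M.reducedMgf α₀ α₁ τ u :=
  M.matrixForm_step_pos α₀ α₁ u
    (((M.isIrredMetzler_tilted α₀ u).sub_smul_one _).smul hτ).exp_apply_pos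
    (((M.isIrredMetzler_tilted α₁ u).sub_smul_one _).smul hτ).exp_apply_pos

theorem projAt_pos (α : Param d e) (u : ℝ) (x y : S) : 0 < M.projAt α u x y :=
  mul_pos (inv_pos.2 (dotProduct_pos (M.leftAt_pos α u) (M.rightAt_pos α u)))
    (mul_pos (M.rightAt_pos α u x) (M.leftAt_pos α u y))

theorem limitMgf_pos (α₀ α₁ : Param d e) (u : ℝ) : 0 < M.limitMgf α₀ α₁ u :=
  M.matrixForm_step_pos α₀ α₁ u (M.projAt_pos α₀ u) (M.projAt_pos α₁ u)

theorem jetTendsto_log_reducedMgf (α₀ α₁ : Param d e) :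
    JetTendsto (fun τ u => Real.log (M.reducedMgf α₀ α₁ τ u)) atTop
      (fun u => Real.log (M.limitMgf α₀ α₁ u)) :=
  (M.jetTendsto_reducedMgf α₀ α₁).log (M.contDiff_reducedMgf α₀ α₁) (M.contDiff_limitMgf α₀ α₁)
    ((eventually_gt_atTop 0).mono fun _ hτ => M.reducedMgf_pos α₀ α₁ hτ) (M.limitMgf_pos α₀ α₁)

theorem limitMgf_eq (α₀ α₁ : Param d e) (u : ℝ) :
    M.limitMgf α₀ α₁ u = (M.leftAt α₀ u ⬝ᵥ M.rightAt α₀ u)⁻¹ *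
      (M.stationary α₀ ⬝ᵥ M.rightAt α₀ u) *
      (∑ x, M.leftAt α₀ u x * Real.exp (u * (M.beta * (M.H α₁.nu x - M.H α₀.nu x))) *
        M.rightAt α₁ u x) *
      ((M.leftAt α₁ u ⬝ᵥ M.rightAt α₁ u)⁻¹ * ∑ x, M.leftAt α₁ u x) := by
  have h1 : M.projAt α₁ u *ᵥ (fun _ => 1) =
      ((M.leftAt α₁ u ⬝ᵥ M.rightAt α₁ u)⁻¹ * ∑ x, M.leftAt α₁ u x) • M.rightAt α₁ u := by
    rw [projAt, perronProj, Matrix.smul_mulVec, Matrix.vecMulVec_mulVec, op_smul_eq_smul, mul_smul]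
    simp [dotProduct]
  rw [limitMgf, matrixForm_apply, ← Matrix.mulVec_mulVec, ← Matrix.mulVec_mulVec, h1,
    Matrix.mulVec_smul, Matrix.mulVec_smul, dotProduct_smul, smul_eq_mul, mul_comm]
  congr 1
  rw [← matrixForm_apply, projAt, matrixForm_perronProj, ← mul_assoc]
  congr 1
  refine Finset.sum_congr rfl fun x _ => ?_
  rw [stepFactor, Matrix.mulVec_diagonal, ← mul_assoc]

/-- The cumulant gap of the step from `α₀` to `α₁`, as a function of the tilt. -/
noncomputable def gapAt (α₀ α₁ : Param d e) (u : ℝ) : ℝ :=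
  M.cumulantGap (M.H α₀.nu) (M.logPert α₀) (fun x y => u * M.force α₀ x y)
    (M.H α₁.nu) (M.logPert α₁) (fun x y => u * M.force α₁ x y)
    (fun x => u * (M.beta * (M.H α₁.nu x - M.H α₀.nu x)))

/-- The normalizations `l · r` cancel between the step and its reversal. -/
theorem log_limitMgf_sub (α₀ α₁ : Param d e) (u : ℝ) :
    Real.log (M.limitMgf α₀ α₁ u) - Real.log (M.limitMgf α₁ α₀ u) = M.gapAt α₀ α₁ u := by
  have key : ∀ α₀ α₁ : Param d e, Real.log (M.limitMgf α₀ α₁ u) =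
      -Real.log (M.leftAt α₀ u ⬝ᵥ M.rightAt α₀ u) + Real.log (M.stationary α₀ ⬝ᵥ M.rightAt α₀ u) +
      M.logOverlap (M.H α₀.nu) (M.logPert α₀) (fun x y => u * M.force α₀ x y)
        (M.H α₁.nu) (M.logPert α₁) (fun x y => u * M.force α₁ x y)
        (fun x => u * (M.beta * (M.H α₁.nu x - M.H α₀.nu x))) +
      (-Real.log (M.leftAt α₁ u ⬝ᵥ M.rightAt α₁ u) + Real.log (∑ x, M.leftAt α₁ u x)) := by
    intro α₀ α₁
    have h0 := dotProduct_pos (M.leftAt_pos α₀ u) (M.rightAt_pos α₀ u)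
    have h1 := dotProduct_pos (M.leftAt_pos α₁ u) (M.rightAt_pos α₁ u)
    have h2 := dotProduct_pos (M.stationary_pos α₀) (M.rightAt_pos α₀ u)
    have h3 : 0 < ∑ x, M.leftAt α₁ u x :=
      Finset.sum_pos (fun x _ => M.leftAt_pos α₁ u x) Finset.univ_nonempty
    have h4 : 0 < ∑ x, M.leftAt α₀ u x *
        Real.exp (u * (M.beta * (M.H α₁.nu x - M.H α₀.nu x))) * M.rightAt α₁ u x :=
      Finset.sum_pos (fun x _ => mul_pos (mul_pos (M.leftAt_pos α₀ u x) (Real.exp_pos _))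
        (M.rightAt_pos α₁ u x)) Finset.univ_nonempty
    rw [limitMgf_eq, Real.log_mul (by positivity) (by positivity),
      Real.log_mul (by positivity) (by positivity), Real.log_mul (by positivity) (by positivity),
      Real.log_mul (by positivity) (by positivity), Real.log_inv, Real.log_inv]
    rfl
  have hneg : (-fun x => u * (M.beta * (M.H α₁.nu x - M.H α₀.nu x))) =
      fun x => u * (M.beta * (M.H α₀.nu x - M.H α₁.nu x)) := by
    funext x; simp only [Pi.neg_apply]; ring
  rw [key α₀ α₁, key α₁ α₀, gapAt, cumulantGap, hneg, ← log_stationary_dotProduct,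
    ← log_stationary_dotProduct]
  ring

theorem expectSt_exp_workPsi {A : ℝ → Param d e} {α₀ α₁ : Param d e} (hA : IsTwoStep A α₀ α₁)
    {τ : ℝ} (hτ : 0 < τ) (u : ℝ) :
    M.expectSt (-τ) τ A (fun p => Real.exp (u * M.workPsi (-τ) τ A p)) =
      Real.exp (τ * M.eigAt α₀ u + τ * M.eigAt α₁ u) * M.reducedMgf α₀ α₁ τ u := by
  have h1 := pathIntegral_twoStep (M := M) hA hτ u (M.stationary α₀) (fun _ => 1)
  rw [exp_smul_tilted, exp_smul_tilted, smul_mul_assoc, smul_mul_assoc, mul_smul_comm, smul_smul,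
    ← matrixForm_apply, map_smul, ← Real.exp_add] at h1
  rw [expectSt, hA.neg (-τ) (by linarith)]
  simp only [mul_one] at h1
  exact h1

theorem cumulant_workPsi {A : ℝ → Param d e} {α₀ α₁ : Param d e} (hA : IsTwoStep A α₀ α₁)
    {τ : ℝ} (hτ : 0 < τ) (k : ℕ) :
    M.cumulant (-τ) τ A k (fun p => M.workPsi (-τ) τ A p) =
      iteratedDeriv k (fun u => τ * M.eigAt α₀ u + τ * M.eigAt α₁ u) 0 +
        iteratedDeriv k (fun u => Real.log (M.reducedMgf α₀ α₁ τ u)) 0 := by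
  have h1 : (fun u => Real.log (M.expectSt (-τ) τ A
      (fun p => Real.exp (u * M.workPsi (-τ) τ A p)))) = fun u =>
      (τ * M.eigAt α₀ u + τ * M.eigAt α₁ u) + Real.log (M.reducedMgf α₀ α₁ τ u) := by
    funext u
    rw [M.expectSt_exp_workPsi hA hτ, Real.log_mul (Real.exp_pos _).ne'
      (M.reducedMgf_pos α₀ α₁ hτ u).ne', Real.log_exp]
  rw [cumulant, h1]
  refine iteratedDeriv_fun_add (ContDiff.natCast_contDiffAt ?_ k 0)
    (ContDiff.natCast_contDiffAt ?_ k 0)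
  · exact (contDiff_const.mul (M.contDiff_eigAt α₀)).add (contDiff_const.mul (M.contDiff_eigAt α₁))
  · exact (M.contDiff_reducedMgf α₀ α₁ τ).log fun u => (M.reducedMgf_pos α₀ α₁ hτ u).ne'

theorem tendsto_cumulantDiff (α₀ α₁ : Param d e) (k : ℕ) :
    Tendsto (fun τ => M.cumulantDiff τ (stepProtocol α₀ α₁)
      (reverseProtocol (stepProtocol α₀ α₁)) k) atTop
      (𝓝 (iteratedDeriv k (M.gapAt α₀ α₁) 0)) := by
  have hA := IsTwoStep.stepProtocol α₀ α₁
  have h1 := ((M.jetTendsto_log_reducedMgf α₀ α₁) k).sub ((M.jetTendsto_log_reducedMgf α₁ α₀) k)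
  have hs : ∀ α₀ α₁, ContDiff ℝ ∞ fun u => Real.log (M.limitMgf α₀ α₁ u) := fun α₀ α₁ =>
    (M.contDiff_limitMgf α₀ α₁).log fun u => (M.limitMgf_pos α₀ α₁ u).ne'
  rw [← iteratedDeriv_fun_sub ((hs α₀ α₁).natCast_contDiffAt k 0)
    ((hs α₁ α₀).natCast_contDiffAt k 0)] at h1
  simp only [log_limitMgf_sub] at h1
  refine h1.congr' ?_
  filter_upwards [eventually_gt_atTop 0] with τ hτ
  -- the growth rates agree and cancel in the difference
  have h2 := M.cumulant_workPsi hA hτ k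
  have h3 := M.cumulant_workPsi hA.reverse hτ k
  simp only [add_comm (τ * M.eigAt α₁ _)] at h3
  simp only [workPsi] at h2 h3
  rw [cumulantDiff, h2, h3]
  ring

end NESSModel

end LongTimeLimits

/-! ### Entropy production in the baths -/

section Entropy

namespace NESSModel

set_option linter.unusedSectionVars false

open scoped Matrix Matrix.Norms.Operator

variable {S : Type*} {d e : ℕ} (M : NESSModel S d e)

/-- Pathwise energy balance: `Θ = β W + Ψ` minus the total increment of `β H`. -/
theorem Theta_eq (a b : ℝ) (A : ℝ → Param d e) (p : JumpPath S) :
    M.Theta A p = M.workPsi a b A p -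
      (M.beta * M.H (A b).nu p.last - M.beta * M.H (A a).nu p.first) := by
  have h1 : ∑ j : Fin (p.n + 1), M.H (A (p.times a b j.succ)).nu (p.x j) =
      (∑ j : Fin p.n, M.H (A (p.t j)).nu (p.x j.castSucc)) + M.H (A b).nu p.last := by
    rw [Fin.sum_univ_castSucc]
    simp [JumpPath.times, JumpPath.last]
  have h2 : ∑ j : Fin (p.n + 1), M.H (A (p.times a b j.castSucc)).nu (p.x j) =
      M.H (A a).nu p.first + ∑ j : Fin p.n, M.H (A (p.t j)).nu (p.x j.succ) := by
    rw [Fin.sum_univ_succ]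
    simp [JumpPath.times, JumpPath.first]
  rw [workPsi, work, Finset.sum_sub_distrib, h1, h2, Theta, Psi]
  simp only [psi, Finset.sum_sub_distrib, mul_sub, ← Finset.mul_sum]
  ring

variable [Fintype S] [DecidableEq S]

theorem tameOn_Theta {A : ℝ → Param d e} {α₀ α₁ : Param d e} (hA : IsTwoStep A α₀ α₁)
    (a b : ℝ) : TameOn a b (M.Theta A) := by
  set C : ℝ := ∑ q : S × S, (|M.theta α₀ q.1 q.2| + |M.theta (A 0) q.1 q.2| +
    |M.theta α₁ q.1 q.2|) with hC
  have hC0 : 0 ≤ C := Finset.sum_nonneg fun q _ => by positivity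
  refine ⟨fun n x => ?_, C, 2, hC0, by norm_num, fun n x t _ => ?_⟩
  · change Measurable fun t : Fin n → ℝ =>
      ∑ j : Fin n, M.theta (A (t j)) (x j.castSucc) (x j.succ)
    exact Finset.measurable_sum _ fun j _ =>
      (hA.measurable fun α => M.theta α (x (Fin.castSucc j)) (x (Fin.succ j))).comp
        (measurable_pi_apply j)
  · have h1 : ∀ j : Fin n, |M.theta (A (t j)) (x j.castSucc) (x j.succ)| ≤ C := fun j =>
      (hA.abs_le (fun α => M.theta α (x j.castSucc) (x j.succ)) (t j)).trans
        (Finset.single_le_sum (f := fun q : S × S => |M.theta α₀ q.1 q.2| +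
          |M.theta (A 0) q.1 q.2| + |M.theta α₁ q.1 q.2|) (fun q _ => by positivity)
          (Finset.mem_univ (x j.castSucc, x j.succ)))
    calc |M.Theta A ⟨n, x, t⟩| ≤ ∑ j : Fin n, |M.theta (A (t j)) (x j.castSucc) (x j.succ)| :=
          Finset.abs_sum_le_sum_abs _ _
      _ ≤ ∑ _j : Fin n, C := Finset.sum_le_sum fun j _ => h1 j
      _ = C * n := by simp [mul_comm]
      _ ≤ C * 2 ^ n := by
          gcongr
          exact_mod_cast Nat.lt_two_pow_self.le

theorem weight_nonneg (a b : ℝ) (A : ℝ → Param d e) (p : JumpPath S)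
    (hp : ∀ j : Fin p.n, p.x j.castSucc ≠ p.x j.succ) : 0 ≤ M.weight a b A p :=
  mul_nonneg (Finset.prod_nonneg fun j _ => M.rate_nonneg _ (hp j))
    (Finset.prod_nonneg fun _ _ => (Real.exp_pos _).le)

variable [Nonempty S]

section TwoStep

variable {A : ℝ → Param d e} {α₀ α₁ : Param d e} {M}

theorem tameOn_stationary_weight (hA : IsTwoStep A α₀ α₁) (a b : ℝ) (φ ψ : S → ℝ) :
    TameOn a b fun p : JumpPath S =>
      φ p.first * ψ p.last * M.stationary (A a) p.first * M.weight a b A p := by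
  have h1 : (fun p : JumpPath S =>
      φ p.first * ψ p.last * M.stationary (A a) p.first * M.weight a b A p) = fun p =>
      Real.exp (0 * M.workPsi a b A p) * (M.stationary (A a) p.first * φ p.first) * ψ p.last *
        M.weight a b A p := by
    funext p
    rw [zero_mul, Real.exp_zero]
    ring
  rw [h1]
  exact tameOn_exp_workPsi hA a b 0 (fun x => M.stationary (A a) x * φ x) ψ

/-- Expectations of products of an observable of the initial and one of the final state. -/
theorem expectSt_first_last (hA : IsTwoStep A α₀ α₁) {τ : ℝ} (hτ : 0 < τ) (φ ψ : S → ℝ) :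
    M.expectSt (-τ) τ A (fun p => φ p.first * ψ p.last) =
      (fun x => M.stationary α₀ x * φ x) ⬝ᵥ ((NormedSpace.exp (τ • M.tilted α₀ 0) *
        NormedSpace.exp (τ • M.tilted α₁ 0)) *ᵥ ψ) := by
  have h1 := pathIntegral_twoStep (M := M) hA hτ 0 (fun x => M.stationary α₀ x * φ x) ψ
  simp only [zero_mul, Real.exp_zero, Matrix.diagonal_one, mul_one, one_mul] at h1
  rw [← h1, expectSt, hA.neg (-τ) (by linarith)]
  congr 1
  funext p
  ring

theorem exp_tilted_zero_mulVec (α : Param d e) (τ : ℝ) :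
    NormedSpace.exp (τ • M.tilted α 0) *ᵥ (fun _ => 1) = fun _ => 1 := by
  have := exp_mulVec_of_eigenvector (L := τ • M.tilted α 0) (v := fun _ => 1) (c := 0) (by
    rw [Matrix.smul_mulVec, tilted_zero_mulVec]; simp)
  simpa using this

theorem stationary_vecMul_tilted (α : Param d e) : M.stationary α ᵥ* M.tilted α 0 = 0 := by
  rw [stationary_eq, Matrix.smul_vecMul, (M.eigenvector_tilted α 0).2, eigAt_zero]; simp

theorem stationary_vecMul_exp (α : Param d e) (τ : ℝ) :
    M.stationary α ᵥ* NormedSpace.exp (τ • M.tilted α 0) = M.stationary α := by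
  have h1 := exp_mulVec_of_eigenvector (L := (τ • M.tilted α 0)ᵀ) (v := M.stationary α) (c := 0)
    (by rw [Matrix.mulVec_transpose, Matrix.vecMul_smul, stationary_vecMul_tilted]; simp)
  rw [Matrix.exp_transpose, Matrix.mulVec_transpose] at h1
  simpa using h1

theorem expectSt_first (hA : IsTwoStep A α₀ α₁) {τ : ℝ} (hτ : 0 < τ) (φ : S → ℝ) :
    M.expectSt (-τ) τ A (fun p => φ p.first) = ∑ x, φ x * M.stationary α₀ x := by
  have h1 := expectSt_first_last (M := M) hA hτ φ (fun _ => 1)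
  simp only [mul_one] at h1
  rw [h1, ← Matrix.mulVec_mulVec, exp_tilted_zero_mulVec, exp_tilted_zero_mulVec]
  simp [dotProduct, mul_comm]

theorem expectSt_last (hA : IsTwoStep A α₀ α₁) {τ : ℝ} (hτ : 0 < τ) (ψ : S → ℝ) :
    M.expectSt (-τ) τ A (fun p => ψ p.last) =
      matrixForm (M.stationary α₀) ψ (NormedSpace.exp (τ • M.shifted α₁ 0)) := by
  have h1 := expectSt_first_last (M := M) hA hτ (fun _ => 1) ψ
  simp only [mul_one, one_mul] at h1
  rw [h1, ← Matrix.mulVec_mulVec, Matrix.dotProduct_mulVec, stationary_vecMul_exp,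
    matrixForm_apply, exp_smul_tilted, eigAt_zero]
  simp

/-- After a step the system relaxes to the new stationary distribution. -/
theorem tendsto_expectSt_last (hA : IsTwoStep A α₀ α₁) (ψ : S → ℝ) :
    Tendsto (fun τ => M.expectSt (-τ) τ A (fun p => ψ p.last)) atTop
      (𝓝 (∑ x, ψ x * M.stationary α₁ x)) := by
  have h1 : ∑ x, ψ x * M.stationary α₁ x =
      matrixForm (M.stationary α₀) ψ (M.projAt α₁ 0) := by
    rw [projAt, matrixForm_perronProj, rightAt_zero]
    simp only [M.stationary_eq α₁, dotProduct, mul_one, M.sum_stationary α₀, one_mul,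
      Pi.smul_apply, smul_eq_mul, Finset.mul_sum]
    exact Finset.sum_congr rfl fun x _ => by ring
  rw [h1]
  refine (((matrixForm (M.stationary α₀) ψ).continuous.tendsto _).comp
    (M.tendsto_exp_shifted α₁ 0)).congr' ?_
  filter_upwards [eventually_gt_atTop 0] with τ hτ
  exact (expectSt_last hA hτ ψ).symm

/-- The mean is the first cumulant.  Convexity of the exponential function replaces
differentiation under the integral:  `⟨exp (u X)⟩ - u ⟨X⟩` has its minimum at `u = 0`. -/
theorem expectSt_workPsi (hA : IsTwoStep A α₀ α₁) {τ : ℝ} (hτ : 0 < τ) :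
    M.expectSt (-τ) τ A (M.workPsi (-τ) τ A) =
      M.cumulant (-τ) τ A 1 (fun p => M.workPsi (-τ) τ A p) := by
  set Z : ℝ → ℝ := fun u => M.expectSt (-τ) τ A (fun p => Real.exp (u * M.workPsi (-τ) τ A p))
    with hZ
  set m : ℝ := M.expectSt (-τ) τ A (M.workPsi (-τ) τ A) with hm
  have hττ : -τ ≤ τ := by linarith
  have hZ0 : Z 0 = 1 := by
    have := expectSt_first (M := M) hA hτ (fun _ => 1)
    simp only [one_mul, M.sum_stationary] at this
    simpa only [hZ, zero_mul, Real.exp_zero] using this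
  have hZs : ContDiff ℝ ∞ Z := by
    have : Z = fun u => Real.exp (τ * M.eigAt α₀ u + τ * M.eigAt α₁ u) *
        M.reducedMgf α₀ α₁ τ u := funext fun u => M.expectSt_exp_workPsi hA hτ u
    rw [this]
    exact (((contDiff_const.mul (M.contDiff_eigAt α₀)).add
      (contDiff_const.mul (M.contDiff_eigAt α₁))).exp).mul (M.contDiff_reducedMgf α₀ α₁ τ)
  have ht1 : TameOn (-τ) τ fun p : JumpPath S =>
      1 * M.stationary (A (-τ)) p.first * M.weight (-τ) τ A p := by
    simpa using tameOn_stationary_weight (M := M) hA (-τ) τ (fun _ => 1) (fun _ => 1)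
  have htX : TameOn (-τ) τ fun p : JumpPath S =>
      M.workPsi (-τ) τ A p * M.stationary (A (-τ)) p.first * M.weight (-τ) τ A p := by
    have h1 := ((M.tameOn_Theta hA (-τ) τ).mul ht1).add
      ((tameOn_stationary_weight (M := M) hA (-τ) τ (fun _ => 1)
        (fun x => M.beta * M.H (A τ).nu x)).add
      (tameOn_stationary_weight (M := M) hA (-τ) τ
        (fun x => -(M.beta * M.H (A (-τ)).nu x)) (fun _ => 1)))
    convert h1 using 2 with p
    rw [M.Theta_eq (-τ) τ A p]
    ring
  have htE : ∀ u : ℝ, TameOn (-τ) τ fun p : JumpPath S =>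
      Real.exp (u * M.workPsi (-τ) τ A p) * M.stationary (A (-τ)) p.first *
        M.weight (-τ) τ A p := fun u => by
    simpa using tameOn_exp_workPsi (M := M) hA (-τ) τ u (M.stationary (A (-τ))) (fun _ => 1)
  have hmin : ∀ u, Z 0 - 0 * m ≤ Z u - u * m := by
    intro u
    have h1 : Z u - u * m - Z 0 = pathIntegral (-τ) τ (fun p =>
        (Real.exp (u * M.workPsi (-τ) τ A p) - u * M.workPsi (-τ) τ A p - 1) *
          (M.stationary (A (-τ)) p.first * M.weight (-τ) τ A p)) := by
      have hZ0' : Z 0 = pathIntegral (-τ) τ (fun p : JumpPath S =>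
          1 * M.stationary (A (-τ)) p.first * M.weight (-τ) τ A p) := by
        simp only [hZ, zero_mul, Real.exp_zero]
        rfl
      rw [hZ0']
      have h2 := pathIntegral_sub hττ (htE u) ((htX.const_mul u).add ht1)
      rw [pathIntegral_add hττ (htX.const_mul u) ht1, pathIntegral_const_mul] at h2
      rw [sub_sub]
      refine h2.symm.trans ?_
      congr 1
      funext p
      ring
    have h3 : 0 ≤ Z u - u * m - Z 0 := by
      rw [h1]
      refine pathIntegral_nonneg hττ fun p hp => mul_nonneg ?_
        (mul_nonneg (M.stationary_pos _ _).le (M.weight_nonneg _ _ _ p hp))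
      linarith [Real.add_one_le_exp (u * M.workPsi (-τ) τ A p)]
    linarith
  have hd : HasDerivAt Z (deriv Z 0) 0 := (hZs.differentiable (by simp) 0).hasDerivAt
  have hd' : HasDerivAt (fun u => Z u - u * m) (deriv Z 0 - 1 * m) 0 :=
    hd.sub ((hasDerivAt_id 0).mul_const m)
  have h0 := IsLocalMin.hasDerivAt_eq_zero (Eventually.of_forall hmin) hd'
  rw [cumulant, iteratedDeriv_one, deriv.log hd.differentiableAt (by rw [hZ0]; norm_num), hZ0]
  linarith

theorem expectSt_Theta (hA : IsTwoStep A α₀ α₁) {τ : ℝ} (hτ : 0 < τ) :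
    M.expectSt (-τ) τ A (M.Theta A) =
      M.cumulant (-τ) τ A 1 (fun p => M.workPsi (-τ) τ A p) -
        (M.beta * M.expectSt (-τ) τ A (fun p => M.H α₁.nu p.last) -
          M.beta * ∑ x, M.H α₀.nu x * M.stationary α₀ x) := by
  have hττ : -τ ≤ τ := by linarith
  have ht1 : TameOn (-τ) τ fun p : JumpPath S =>
      1 * M.stationary (A (-τ)) p.first * M.weight (-τ) τ A p := by
    simpa using tameOn_stationary_weight (M := M) hA (-τ) τ (fun _ => 1) (fun _ => 1)
  have htT : TameOn (-τ) τ fun p : JumpPath S =>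
      M.Theta A p * M.stationary (A (-τ)) p.first * M.weight (-τ) τ A p := by
    simpa [mul_assoc] using (M.tameOn_Theta hA (-τ) τ).mul ht1
  have htl : TameOn (-τ) τ fun p : JumpPath S =>
      M.H α₁.nu p.last * M.stationary (A (-τ)) p.first * M.weight (-τ) τ A p := by
    simpa using tameOn_stationary_weight (M := M) hA (-τ) τ (fun _ => 1) (M.H α₁.nu)
  have htf : TameOn (-τ) τ fun p : JumpPath S =>
      M.H α₀.nu p.first * M.stationary (A (-τ)) p.first * M.weight (-τ) τ A p := by
    simpa using tameOn_stationary_weight (M := M) hA (-τ) τ (M.H α₀.nu) (fun _ => 1)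
  have h1 := pathIntegral_add hττ htT ((htl.const_mul M.beta).add (htf.const_mul (-M.beta)))
  rw [pathIntegral_add hττ (htl.const_mul M.beta) (htf.const_mul (-M.beta)),
    pathIntegral_const_mul, pathIntegral_const_mul] at h1
  have h2 : (fun p : JumpPath S =>
      M.workPsi (-τ) τ A p * M.stationary (A (-τ)) p.first * M.weight (-τ) τ A p) = fun p =>
      M.Theta A p * M.stationary (A (-τ)) p.first * M.weight (-τ) τ A p +
      (M.beta * (M.H α₁.nu p.last * M.stationary (A (-τ)) p.first * M.weight (-τ) τ A p) +
      -M.beta * (M.H α₀.nu p.first * M.stationary (A (-τ)) p.first * M.weight (-τ) τ A p)) := by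
    funext p
    rw [M.Theta_eq (-τ) τ A p, hA.pos τ hτ, hA.neg (-τ) (by linarith)]
    ring
  have h3 : M.expectSt (-τ) τ A (M.workPsi (-τ) τ A) = M.expectSt (-τ) τ A (M.Theta A) +
      (M.beta * M.expectSt (-τ) τ A (fun p => M.H α₁.nu p.last) +
        -M.beta * M.expectSt (-τ) τ A (fun p => M.H α₀.nu p.first)) := by
    rw [expectSt, h2]
    exact h1
  rw [expectSt_first hA hτ, expectSt_workPsi hA hτ] at h3
  linarith

end TwoStep

theorem tendsto_expectSt_Theta_sub (α₀ α₁ : Param d e) :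
    Tendsto (fun τ : ℝ => (M.expectSt (-τ) τ (stepProtocol α₀ α₁) (M.Theta (stepProtocol α₀ α₁)) -
        M.expectSt (-τ) τ (reverseProtocol (stepProtocol α₀ α₁))
          (M.Theta (reverseProtocol (stepProtocol α₀ α₁)))) / 2) atTop
      (𝓝 (iteratedDeriv 1 (M.gapAt α₀ α₁) 0 / 2 - M.beta *
        (∑ x, M.H α₁.nu x * M.stationary α₁ x - ∑ x, M.H α₀.nu x * M.stationary α₀ x))) := by
  have hA := IsTwoStep.stepProtocol α₀ α₁
  have h1 := M.tendsto_cumulantDiff α₀ α₁ 1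
  have h2 := tendsto_expectSt_last (M := M) hA (M.H α₁.nu)
  have h3 := tendsto_expectSt_last (M := M) hA.reverse (M.H α₀.nu)
  have h4 := ((h1.sub ((h2.const_mul M.beta).sub_const
    (M.beta * ∑ x, M.H α₀.nu x * M.stationary α₀ x))).add ((h3.const_mul M.beta).sub_const
    (M.beta * ∑ x, M.H α₁.nu x * M.stationary α₁ x))).div_const 2
  refine Tendsto.congr' ?_ (h4.trans (le_of_eq (congrArg 𝓝 (by ring))))
  filter_upwards [eventually_gt_atTop 0] with τ hτ
  rw [expectSt_Theta hA hτ, expectSt_Theta hA.reverse hτ, cumulantDiff]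
  simp only [workPsi]
  ring

end NESSModel

end Entropy

/-! ### Bounds that are uniform in the parameters -/

section UniformBounds

/-- Difference quotients by `δ` of quantities that vanish with `δ`;  the case `δ = 0` is covered by
the convention for division by zero. -/
theorem abs_div_le_and_mul_div_cancel {D K δ : ℝ} (hδ : 0 ≤ δ) (hK : 0 ≤ K)
    (h : |D| ≤ K * δ) : |D / δ| ≤ K ∧ δ * (D / δ) = D := by
  rcases hδ.eq_or_lt with rfl | hδ
  · rw [mul_zero] at h
    have : D = 0 := abs_eq_zero.1 (le_antisymm h (abs_nonneg D))
    simp [this, hK]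
  · refine ⟨?_, mul_div_cancel₀ _ hδ.ne'⟩
    rwa [abs_div, abs_of_pos hδ, div_le_iff₀ hδ]

namespace NESSModel

set_option linter.unusedSectionVars false

variable {S : Type*} {d e : ℕ} (M : NESSModel S d e)

theorem abs_cutXi_le {κ : EuclideanSpace ℝ (Fin e)} (hκ : κ ∈ M.kappaSet) (x y : S) :
    |M.cutXi κ x y| ≤ 1 := by
  unfold cutXi
  split_ifs with h
  · exact M.xi_bound κ hκ x y h.1 h.2
  · simp

theorem exists_lipschitz_cutXi [Fintype S] : ∃ K : ℝ, 0 ≤ K ∧ ∀ κ ∈ M.kappaSet, ∀ κ' ∈ M.kappaSet,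
    ∀ x y, |M.cutXi κ' x y - M.cutXi κ x y| ≤ K * ‖κ - κ'‖ := by
  have h1 : ∀ q : S × S, ∃ K : ℝ≥0, ∀ κ ∈ M.kappaSet, ∀ κ' ∈ M.kappaSet,
      |M.cutXi κ' q.1 q.2 - M.cutXi κ q.1 q.2| ≤ K * ‖κ - κ'‖ := by
    rintro ⟨x, y⟩
    by_cases h : x ≠ y ∧ M.c x y ≠ 0
    · obtain ⟨K, hK⟩ := M.xi_lipschitz x y h.1 h.2
      refine ⟨K, fun κ hκ κ' hκ' => ?_⟩
      have := hK.dist_le_mul κ' hκ' κ hκ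
      rw [Real.dist_eq, dist_comm, dist_eq_norm] at this
      simpa only [cutXi, if_pos h] using this
    · refine ⟨0, fun κ _ κ' _ => ?_⟩
      simp [cutXi, if_neg h]
  choose K hK using h1
  refine ⟨∑ q, (K q : ℝ), Finset.sum_nonneg fun q _ => (K q).2, fun κ hκ κ' hκ' x y => ?_⟩
  refine (hK (x, y) κ hκ κ' hκ').trans ?_
  gcongr
  exact Finset.single_le_sum (f := fun q => (K q : ℝ)) (fun q _ => (K q).2) (Finset.mem_univ (x, y))

theorem exists_bound_H [Fintype S] : ∃ K : ℝ, 0 ≤ K ∧ ∀ ν ∈ M.nuSet, ∀ x, |M.H ν x| ≤ K := by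
  have h1 : ∀ x, ∃ K : ℝ, ∀ ν ∈ M.nuSet, |M.H ν x| ≤ K := fun x =>
    M.nuSet_compact.exists_bound_of_continuousOn fun ν hν =>
      (M.H_smooth x ν hν).continuousAt.continuousWithinAt
  choose K hK using h1
  refine ⟨∑ x, |K x|, Finset.sum_nonneg fun _ _ => abs_nonneg _, fun ν hν x => ?_⟩
  exact ((hK x ν hν).trans (le_abs_self _)).trans
    (Finset.single_le_sum (f := fun x => |K x|) (fun _ _ => abs_nonneg _) (Finset.mem_univ x))

theorem exists_lipschitz_H [Fintype S] : ∃ K : ℝ, 0 ≤ K ∧ ∀ ν ∈ M.nuSet, ∀ ν' ∈ M.nuSet, ∀ x,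
    |M.H ν' x - M.H ν x| ≤ K * ‖ν - ν'‖ := by
  have h1 : ∀ x, ∃ K : ℝ≥0, LipschitzOnWith K (fun ν => M.H ν x) M.nuSet := fun x => by
    refine LocallyLipschitzOn.exists_lipschitzOnWith_of_compact M.nuSet_compact fun ν hν => ?_
    obtain ⟨K, t, ht, hK⟩ := ((M.H_smooth x ν hν).of_le (m := 1) (by simp)).exists_lipschitzOnWith
    exact ⟨K, t, mem_nhdsWithin_of_mem_nhds ht, hK⟩
  choose K hK using h1
  refine ⟨∑ x, (K x : ℝ), Finset.sum_nonneg fun x _ => (K x).2, fun ν hν ν' hν' x => ?_⟩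
  have := (hK x).dist_le_mul ν' hν' ν hν
  rw [Real.dist_eq, dist_comm, dist_eq_norm] at this
  refine this.trans ?_
  gcongr
  exact Finset.single_le_sum (f := fun x => (K x : ℝ)) (fun x _ => (K x).2) (Finset.mem_univ x)

variable [Fintype S] [DecidableEq S] [Nonempty S]

theorem exists_taylorRem_gapAt_bound {n : ℕ} (hn : 1 ≤ n) :
    ∃ C C' : ℝ, 0 ≤ C ∧ 0 ≤ C' ∧ ∀ α ∈ M.range, ∀ α' ∈ M.range, α'.eps = α.eps →
      ∀ δ : ℝ, δ = ‖α.nu - α'.nu‖ + α.eps * ‖α.kappa - α'.kappa‖ →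
        |taylorRem (2 * n) (M.gapAt α α')| ≤ C * α.eps ^ (2 * n) * δ + C' * δ ^ 2 := by
  obtain ⟨K₁, hK₁, hH⟩ := M.exists_bound_H
  obtain ⟨K₂, hK₂, hHl⟩ := M.exists_lipschitz_H
  obtain ⟨K₃, hK₃, hxi⟩ := M.exists_lipschitz_cutXi
  obtain ⟨R, hR⟩ := M.nuSet_compact.isBounded.exists_norm_le
  obtain ⟨R', hR'⟩ := M.kappaSet_compact.isBounded.exists_norm_le
  obtain ⟨C, C', hC, hC', hb⟩ := M.exists_taylorRem_cumulantGap_bound (K₁ + K₂ + K₃ + 1) M.epsMax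
    ((R + R) + M.epsMax * (R' + R')) hn
  refine ⟨C, C', hC, hC', fun α hα α' hα' heps δ hδ => ?_⟩
  obtain ⟨hε, hν, hκ⟩ := hα
  obtain ⟨-, hν', hκ'⟩ := hα'
  have hε0 := hε.1
  have hδ0 : 0 ≤ δ := by rw [hδ]; positivity
  have hδ1 : δ ≤ (R + R) + M.epsMax * (R' + R') := by
    rw [hδ]
    have h1 : ‖α.nu - α'.nu‖ ≤ R + R :=
      (norm_sub_le _ _).trans (add_le_add (hR _ hν) (hR _ hν'))
    have h2 : ‖α.kappa - α'.kappa‖ ≤ R' + R' :=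
      (norm_sub_le _ _).trans (add_le_add (hR' _ hκ) (hR' _ hκ'))
    exact add_le_add h1 (mul_le_mul hε.2 h2 (norm_nonneg _) (hε0.trans hε.2))
  have hνδ : ‖α.nu - α'.nu‖ ≤ δ := by
    rw [hδ]; exact le_add_of_nonneg_right (by positivity)
  have hκδ : α.eps * ‖α.kappa - α'.kappa‖ ≤ δ := by
    rw [hδ]; exact le_add_of_nonneg_left (norm_nonneg _)
  -- the differences of the energies and of the log-perturbations are at most of order `δ`
  have hm : ∀ x, |(M.H α'.nu x - M.H α.nu x) / δ| ≤ K₂ ∧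
      δ * ((M.H α'.nu x - M.H α.nu x) / δ) = M.H α'.nu x - M.H α.nu x := fun x =>
    abs_div_le_and_mul_div_cancel hδ0 hK₂ ((hHl _ hν _ hν' x).trans
      (mul_le_mul_of_nonneg_left hνδ hK₂))
  have hy : ∀ x y, |α.eps * (M.cutXi α'.kappa x y - M.cutXi α.kappa x y) / δ| ≤ K₃ ∧
      δ * (α.eps * (M.cutXi α'.kappa x y - M.cutXi α.kappa x y) / δ) =
        α.eps * (M.cutXi α'.kappa x y - M.cutXi α.kappa x y) := fun x y =>
    abs_div_le_and_mul_div_cancel hδ0 hK₃ (by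
      rw [abs_mul, abs_of_nonneg hε0]
      calc _ ≤ α.eps * (K₃ * ‖α.kappa - α'.kappa‖) :=
            mul_le_mul_of_nonneg_left (hxi _ hκ _ hκ' x y) hε0
        _ = K₃ * (α.eps * ‖α.kappa - α'.kappa‖) := by ring
        _ ≤ K₃ * δ := mul_le_mul_of_nonneg_left hκδ hK₃)
  have key := hb (M.H α.nu) (fun x => (M.H α'.nu x - M.H α.nu x) / δ) (M.cutXi α.kappa)
    (fun x y => α.eps * (M.cutXi α'.kappa x y - M.cutXi α.kappa x y) / δ)
    (fun x => (hH _ hν x).trans (by linarith)) (fun x => (hm x).1.trans (by linarith))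
    (fun x y => (M.abs_cutXi_le hκ x y).trans (by linarith))
    (fun x y => (hy x y).1.trans (by linarith)) α.eps hε δ ⟨hδ0, hδ1⟩
  convert key using 3
  funext u
  have e1 : ∀ x, M.H α.nu x + δ * ((M.H α'.nu x - M.H α.nu x) / δ) = M.H α'.nu x := fun x => by
    rw [(hm x).2]; ring
  have e2 : ∀ x y, α.eps * M.cutXi α.kappa x y +
      δ * (α.eps * (M.cutXi α'.kappa x y - M.cutXi α.kappa x y) / δ) =
      M.logPert α' x y := fun x y => by
    rw [(hy x y).2, logPert, heps]; ring
  rw [gapAt]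
  congr 1
  · funext x y; simp only [force, logPert]; ring
  · funext x; exact (e1 x).symm
  · funext x y; exact (e2 x y).symm
  · funext x y
    rw [force, ← e2 x y, ← e2 y x]; ring
  · funext x
    have := (hm x).2
    linear_combination -(u * M.beta) * this

theorem gapAt_zero (α α' : Param d e) : M.gapAt α α' 0 = 0 := by
  have := M.cumulantGap_zero (M.H α.nu) (M.H α'.nu) (M.logPert α) (M.logPert α')
  simp only [gapAt, zero_mul]
  exact this

theorem gapAt_half (α α' : Param d e) :
    M.gapAt α α' (-1 / 2) = M.beta * (M.freeEnergy α - M.freeEnergy α') := by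
  have h := M.cumulantGap_half (M.H α.nu) (M.H α'.nu) (M.logPert α) (M.logPert α')
  have hF : ∀ α, M.beta * M.freeEnergy α = M.logRatio (M.H α.nu) (M.logPert α)
      (fun x y => -1 / 2 * M.force α x y) := fun α => mul_div_cancel₀ _ M.beta_pos.ne'
  rw [mul_sub, hF, hF]
  exact h

/-- The partial sum of the cumulant expansion is a Taylor polynomial of `gapAt` at `-1/2`. The term
of order zero vanishes. -/
theorem sum_cumulants_eq (α α' : Param d e) {n : ℕ} (hn : 1 ≤ n) :
    ∑ k ∈ Finset.Icc 1 (2 * n - 1), (-1 : ℝ) ^ k / (2 ^ k * (Nat.factorial k : ℝ)) *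
      iteratedDeriv k (M.gapAt α α') 0 =
    M.beta * (M.freeEnergy α - M.freeEnergy α') - taylorRem (2 * n) (M.gapAt α α') := by
  have h1 : Finset.Icc 1 (2 * n - 1) = Finset.Ico (0 + 1) (2 * n) := by
    ext k; simp only [Finset.mem_Icc, Finset.mem_Ico]; omega
  have h2 := Finset.sum_eq_sum_Ico_succ_bot (a := 0) (b := 2 * n) (by omega) (fun k =>
    (-1 / 2 : ℝ) ^ k / (k.factorial : ℝ) * iteratedDeriv k (M.gapAt α α') 0)
  rw [iteratedDeriv_zero, gapAt_zero, mul_zero, zero_add] at h2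
  rw [taylorRem, gapAt_half, Finset.range_eq_Ico, h2, h1, sub_sub_cancel]
  refine Finset.sum_congr rfl fun k _ => ?_
  rw [div_pow, div_div]

end NESSModel

theorem mainTheorem5 {S : Type*} [Fintype S] [DecidableEq S] [Nonempty S] {d e : ℕ}
    (M : NESSModel S d e) :
    ∃ F : Param d e → ℝ, (∀ α ∈ M.range, M.IsFreeEnergy α (F α)) ∧
      ∃ (B : ℝ) (C C' : ℕ → ℝ), 0 < B ∧ (∀ n, 1 ≤ n → 0 < C n ∧ 0 < C' n) ∧
        ∀ (α α' : Param d e), α ∈ M.range → α' ∈ M.range → α'.eps = α.eps →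
          ∀ δ : ℝ, δ = ‖α.nu - α'.nu‖ + B * α.eps * ‖α.kappa - α'.kappa‖ →
            (∀ n : ℕ, 1 ≤ n → ∃ L : ℝ,
              Tendsto
                (fun τ : ℝ => ∑ k ∈ Finset.Icc 1 (2 * n - 1),
                  (-1 : ℝ) ^ k / (2 ^ k * (Nat.factorial k : ℝ)) *
                    M.cumulantDiff τ (stepProtocol α α')
                      (reverseProtocol (stepProtocol α α')) k)
                atTop (𝓝 L) ∧
              |F α' - F α + 1 / M.beta * L| ≤
                C n * α.eps ^ (2 * n) * δ + C' n * δ ^ 2) ∧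
            ∃ L : ℝ,
              Tendsto
                (fun τ : ℝ =>
                  (M.expectSt (-τ) τ (stepProtocol α α') (M.Theta (stepProtocol α α')) -
                    M.expectSt (-τ) τ (reverseProtocol (stepProtocol α α'))
                      (M.Theta (reverseProtocol (stepProtocol α α')))) / 2)
                atTop (𝓝 L) ∧
              |M.entropy F α' - M.entropy F α + L| ≤
                M.beta * C 1 * α.eps ^ 2 * δ + M.beta * C' 1 * δ ^ 2 := by
  have hβ := M.beta_pos
  have hbound : ∀ n : ℕ, ∃ C C' : ℝ, 0 < C ∧ 0 < C' ∧ (1 ≤ n → ∀ α ∈ M.range, ∀ α' ∈ M.range,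
      α'.eps = α.eps → ∀ δ : ℝ, δ = ‖α.nu - α'.nu‖ + α.eps * ‖α.kappa - α'.kappa‖ →
        |taylorRem (2 * n) (M.gapAt α α')| / M.beta ≤
          C * α.eps ^ (2 * n) * δ + C' * δ ^ 2) := by
    intro n
    by_cases hn : 1 ≤ n
    · obtain ⟨C, C', hC, hC', h⟩ := M.exists_taylorRem_gapAt_bound hn
      refine ⟨(C + 1) / M.beta, (C' + 1) / M.beta, by positivity, by positivity,
        fun _ α hα α' hα' heps δ hδ => ?_⟩
      have hε := hα.1.1
      have hδ0 : 0 ≤ δ := by rw [hδ]; positivity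
      rw [div_le_iff₀ hβ]
      refine (h α hα α' hα' heps δ hδ).trans ?_
      have h1 : ((C + 1) / M.beta * α.eps ^ (2 * n) * δ + (C' + 1) / M.beta * δ ^ 2) * M.beta =
          (C + 1) * α.eps ^ (2 * n) * δ + (C' + 1) * δ ^ 2 := by
        field_simp
      rw [h1]
      gcongr <;> linarith
    · exact ⟨1, 1, one_pos, one_pos, fun h => absurd h hn⟩
  choose C C' hC hC' hb using hbound
  refine ⟨M.freeEnergy, fun α _ => M.isFreeEnergy_freeEnergy α, 1, C, C', one_pos,
    fun n _ => ⟨hC n, hC' n⟩, fun α α' hα hα' heps δ hδ => ?_⟩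
  rw [one_mul] at hδ
  have herr : ∀ n : ℕ, 1 ≤ n → |M.freeEnergy α' - M.freeEnergy α + 1 / M.beta *
      ∑ k ∈ Finset.Icc 1 (2 * n - 1), (-1 : ℝ) ^ k / (2 ^ k * (Nat.factorial k : ℝ)) *
        iteratedDeriv k (M.gapAt α α') 0| ≤ C n * α.eps ^ (2 * n) * δ + C' n * δ ^ 2 := by
    intro n hn
    refine le_trans (le_of_eq ?_) (hb n hn α hα α' hα' heps δ hδ)
    rw [M.sum_cumulants_eq α α' hn, ← abs_of_pos hβ, ← abs_div, abs_of_pos hβ, ← abs_neg]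
    congr 1
    field_simp
    ring
  refine ⟨fun n hn => ⟨_, tendsto_finsetSum _ fun k _ =>
    (M.tendsto_cumulantDiff α α' k).const_mul _, herr n hn⟩, _, M.tendsto_expectSt_Theta_sub α α', ?_⟩
  have h1 := herr 1 le_rfl
  rw [show 2 * 1 - 1 = 1 from rfl, Finset.Icc_self, Finset.sum_singleton] at h1
  have h2 : M.entropy M.freeEnergy α' - M.entropy M.freeEnergy α +
      (iteratedDeriv 1 (M.gapAt α α') 0 / 2 - M.beta * (∑ x, M.H α'.nu x * M.stationary α' x -
        ∑ x, M.H α.nu x * M.stationary α x)) =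
      -(M.beta * (M.freeEnergy α' - M.freeEnergy α + 1 / M.beta * ((-1 : ℝ) ^ 1 /
        (2 ^ 1 * (Nat.factorial 1 : ℝ)) * iteratedDeriv 1 (M.gapAt α α') 0))) := by
    simp only [NESSModel.entropy, pow_one, Nat.factorial_one, Nat.cast_one]
    field_simp
    ring
  rw [h2, abs_neg, abs_mul, abs_of_pos hβ]
  calc _ ≤ M.beta * (C 1 * α.eps ^ (2 * 1) * δ + C' 1 * δ ^ 2) :=
        mul_le_mul_of_nonneg_left h1 hβ.le
    _ = _ := by ring

end UniformBounds
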